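/- Let $\mathbf k$ be a field of characteristic $\neq 2$, let $p,q,\lambda\in\mathbf k^\times$ with $p\neq\pm1$, and put $I^{\pm}=\{p^{2n}\lambda^{\pm1}\mid n\in\mathbb Z\}$ and $I=I^+\cup I^-$. Make $I$ the vertex set of a quiver with one arrow $p^2i\to i$ for each $i\in I$. Assume $\pm1\notin I$, $p\notin I$, $q\notin I$, and $I^+\cap I^-=\emptyset$ (given $\pm 1\notin I$, the last condition says $\pm p\notin I$). Let $\nu=\sum_{i\in I}\nu_i i$ be a finitely supported vector with $\nu_i\in\mathbb Z_{\ge0}$ and $\nu_i=\nu_{i^{-1}}$ for all $i$, let $|\nu|=\sum_i\nu_i=2m$, and let $\tilde\nu=\sum_{i\in I^+}\nu_i i$, so $|\tilde\nu|=m$. Let $I^{\tilde\nu}$ be the set of sequences $\mathbf i=(i_1,\dots,i_m)$ with $\sum_k i_k=\tilde\nu$, and ${}^\theta I^\nu\supseteq I^{\tilde\nu}$ the set of those with $\sum_k i_k+\sum_k i_k^{-1}=\nu$ (formal sums). The *KLR algebra* $\mathbf R^+_{\tilde\nu}$ is the unital $\mathbf k$-algebra generated by $x_1,\dots,x_m$,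 $\sigma_1,\dots,\sigma_{m-1}$ and $\mathbf e(\mathbf i)$, $\mathbf i\in I^{\tilde\nu}$, with the following relations. (1) $\mathbf e(\mathbf i)\mathbf e(\mathbf j)=\delta_{\mathbf i\mathbf j}\mathbf e(\mathbf i)$, $\sum_{\mathbf i}\mathbf e(\mathbf i)=1$, $\sigma_k\mathbf e(\mathbf i)=\mathbf e(s_k\mathbf i)\sigma_k$, $x_l\mathbf e(\mathbf i)=\mathbf e(\mathbf i)x_l$, $x_lx_{l'}=x_{l'}x_l$. (2) $\sigma_k^2\mathbf e(\mathbf i)$ is $0$ if $i_k=i_{k+1}$; otherwise it is $\mathbf e(\mathbf i)$ if there is no arrow between $i_k$ and $i_{k+1}$, $(x_{k+1}-x_k)\mathbf e(\mathbf i)$ if there is only an arrow $i_k\leftarrow i_{k+1}$, $(x_k-x_{k+1})\mathbf e(\mathbf i)$ if there is only an arrow $i_k\to i_{k+1}$, and $(x_{k+1}-x_k)(x_k-x_{k+1})\mathbf e(\mathbf i)$ if there are arrows both ways. (3) $\sigma_j\sigma_k=\sigma_k\sigma_j$ for $j\ne k\pm1$; and $(\sigma_{k+1}\sigma_k\sigma_{k+1}-\sigma_k\sigma_{k+1}\sigma_k)\mathbf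 e(\mathbf i)$ is $0$ if $i_k\ne i_{k+2}$ or there is no arrow between $i_k$ and $i_{k+1}$; otherwise it is $\mathbf e(\mathbf i)$ if only $i_k\to i_{k+1}$, $-\mathbf e(\mathbf i)$ if only $i_k\leftarrow i_{k+1}$, and $(2x_{k+1}-x_{k+2}-x_k)\mathbf e(\mathbf i)$ if both. (4) $(\sigma_kx_l-x_{s_k(l)}\sigma_k)\mathbf e(\mathbf i)$ is $-\mathbf e(\mathbf i)$ if $l=k$ and $i_k=i_{k+1}$, $\mathbf e(\mathbf i)$ if $l=k+1$ and $i_k=i_{k+1}$, and $0$ otherwise. The *VV algebra* $\mathfrak W_\nu$ is the unital $\mathbf k$-algebra generated by $x_1,\dots,x_m$, $\sigma_1,\dots,\sigma_{m-1}$, $\mathbf e(\mathbf i)$ with $\mathbf i\in{}^\theta I^\nu$, and $\pi$, with the relations (1)–(4) for $\mathbf i,\mathbf j\in{}^\theta I^\nu$ and the following ones. $\pi\,\mathbf e(i_1,i_2,\dots,i_m)=\mathbf e(i_1^{-1},i_2,\dots,i_m)\,\pi$; $\pi^2\mathbf e(\mathbf i)$ is $x_1\mathbf e(\mathbf i)$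 if $i_1=q$, $-x_1\mathbf e(\mathbf i)$ if $i_1=q^{-1}$, and $\mathbf e(\mathbf i)$ otherwise; $\pi x_1=-x_1\pi$; $\pi x_l=x_l\pi$ for $l>1$; $\pi\sigma_k=\sigma_k\pi$ for $k\neq1$; $(\sigma_1\pi)^2\mathbf e(\mathbf i)-(\pi\sigma_1)^2\mathbf e(\mathbf i)$ is $\sigma_1\mathbf e(\mathbf i)$ if $i_1^{-1}=i_2=q^{-1}$, $-\sigma_1\mathbf e(\mathbf i)$ if $i_1^{-1}=i_2=q$, and $0$ if $i_1^{-1}\ne i_2$ or $i_1\neq q^{\pm1}$. For $\nu=0$ both algebras are $\mathbf k$. **Theorem.** $\mathfrak W_\nu$ and $\mathbf R^+_{\tilde\nu}$ are Morita equivalent, i.e. their categories of left modules are $\mathbf k$-linearly equivalent. More precisely, let $\mathbf e=\sum_{\mathbf i\in I^{\tilde\nu}}\mathbf e(\mathbf i)$, an idempotent of $\mathfrak W_\nu$. Then $\mathbf e$ is full, that is $\mathfrak W_\nu\mathbf e\mathfrak W_\nu=\mathfrak W_\nu$; there is an isomorphism of $\mathbf k$-algebras $\varphi:\mathbf R^+_{\tilde\nu}\to\mathbf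 e\mathfrak W_\nu\mathbf e$ with $\mathbf e(\mathbf i)\mapsto\mathbf e(\mathbf i)$, $x_l\mapsto x_l\mathbf e$ and $\sigma_k\mapsto\sigma_k\mathbf e$; and $M\mapsto\mathbf eM$, with $\mathbf R^+_{\tilde\nu}$ acting on $\mathbf eM$ through $\varphi$, is a $\mathbf k$-linear equivalence from $\mathfrak W_\nu$-modules to $\mathbf R^+_{\tilde\nu}$-modules. -/

import Mathlib

open CategoryTheory

universe u v w

namespace VV

/-! ### Orbits, the quiver, dimension vectors and sequences

Vertices are elements of `kˣ`. A dimension vector `∑ ν_i i` is a finitely supported function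
`ν : kˣ →₀ ℕ`, and its height `|ν|` is `ν.degree = ∑ i, ν_i`. -/

section Combinatorics

variable {k : Type u} [Field k]

/-- `I⁺_lam`, the orbit `{p^(2n) lam}` of `lam` under `ℤ`. -/
def orbitPos (p lam : kˣ) : Set kˣ := {i | ∃ n : ℤ, i = p ^ (2 * n) * lam}

/-- `I⁻_lam = {p^(2n) lam⁻¹}`. -/
def orbitNeg (p lam : kˣ) : Set kˣ := {i | ∃ n : ℤ, i = p ^ (2 * n) * lam⁻¹}

/-- `I_lam = {p^(2n) lam^(±1)}`, the orbit of `lam` under `ℤ ⋊ ℤ₂`. -/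
def orbit (p lam : kˣ) : Set kˣ :=
  {i | ∃ n : ℤ, i = p ^ (2 * n) * lam ∨ i = p ^ (2 * n) * lam⁻¹}

/-- There is an arrow `i → j` in the quiver: the arrows are `p² j → j`. -/
def Arrow (p i j : kˣ) : Prop := i = p ^ 2 * j

/-- `ν` lies in `ᶿℕI`: it is supported on `I` and `ν_i = ν_{i⁻¹}` for all `i`. -/
def IsThetaDimVector (I : Set kˣ) (ν : kˣ →₀ ℕ) : Prop :=
  (∀ i ∈ ν.support, i ∈ I) ∧ ∀ i, ν i = ν i⁻¹

open Classical in
/-- The part `∑_{i ∈ J} ν_i i` of `ν` supported on `J`. -/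
noncomputable def restrictTo (J : Set kˣ) (ν : kˣ →₀ ℕ) : kˣ →₀ ℕ := ν.filter (· ∈ J)

/-- `I^ν` for a dimension vector `ν` with `|ν| = m`: the sequences `(i_1, …, i_m)` with
`∑ i_k = ν`. -/
def klrSeq (ν : kˣ →₀ ℕ) (m : ℕ) : Set (Fin m → kˣ) :=
  {i | ∑ a, Finsupp.single (i a) 1 = ν}

/-- `ᶿI^ν` for a dimension vector `ν` with `|ν| = 2m`: the sequences `(i_1, …, i_m)` with
`∑ i_k + ∑ i_k⁻¹ = ν`. -/
def vvSeq (ν : kˣ →₀ ℕ) (m : ℕ) : Set (Fin m → kˣ) :=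
  {i | ∑ a, Finsupp.single (i a) 1 + ∑ a, Finsupp.single (i a)⁻¹ 1 = ν}

theorem finite_of_le (ν : kˣ →₀ ℕ) {m : ℕ} (S : Set (Fin m → kˣ))
    (h : ∀ i ∈ S, ∑ a, Finsupp.single (i a) 1 ≤ ν) : S.Finite := by
  refine Set.Finite.subset (Set.Finite.pi' fun _ : Fin m => ν.support.finite_toSet) ?_
  intro i hi a
  have h1 := h i hi (i a)
  rw [Finsupp.finsetSum_apply] at h1
  have h2 : (Finsupp.single (i a) 1 : kˣ →₀ ℕ) (i a) ≤ ∑ b, (Finsupp.single (i b) 1) (i a) :=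
    Finset.single_le_sum (f := fun b => (Finsupp.single (i b) 1 : kˣ →₀ ℕ) (i a))
      (fun _ _ => Nat.zero_le _) (Finset.mem_univ a)
  rw [Finsupp.single_eq_same] at h2
  simp only [Finset.mem_coe, Finsupp.mem_support_iff]
  omega

noncomputable instance (ν : kˣ →₀ ℕ) (m : ℕ) : Fintype (klrSeq ν m) :=
  (finite_of_le ν _ fun _ hi => le_of_eq hi).fintype

noncomputable instance (ν : kˣ →₀ ℕ) (m : ℕ) : Fintype (vvSeq ν m) :=
  (finite_of_le ν _ fun _ hi => le_of_le_of_eq le_self_add hi).fintype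

end Combinatorics

/-! ### Generators and relations

Positions are numbered from `0`: `x l` and `sigma a` stand for `x_{l+1}` and `σ_{a+1}`, and
`i 0, i 1, …` are the entries `i_1, i_2, …` of a sequence. -/

section Algebras

variable {k : Type u} [Field k]

/-- The KLR relations between elements `x_l`, `σ_a` and `e(i)`, `i ∈ S`, of a ring `A`. Here `S` is
a set of sequences stable under permutation of the entries. -/
inductive KLRRel (p : kˣ) {m : ℕ} (S : Set (Fin m → kˣ)) [Fintype S] {A : Type v} [Ring A]
    (x : Fin m → A) (s : (a : ℕ) → a + 1 < m → A) (e : S → A) : A → A → Prop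
  | e_mul_self (i : S) : KLRRel p S x s e (e i * e i) (e i)
  | e_mul_ne (i j : S) (hij : i ≠ j) : KLRRel p S x s e (e i * e j) 0
  | sum_e : KLRRel p S x s e (∑ i, e i) 1
  | s_e (a : ℕ) (h : a + 1 < m) (i j : S)
      (hj : j.1 = i.1 ∘ Equiv.swap (⟨a, by omega⟩ : Fin m) ⟨a + 1, h⟩) :
      KLRRel p S x s e (s a h * e i) (e j * s a h)
  | x_e (l : Fin m) (i : S) : KLRRel p S x s e (x l * e i) (e i * x l)
  | x_comm (l l' : Fin m) : KLRRel p S x s e (x l * x l') (x l' * x l)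
  -- the square of `σ_a`
  | s_sq_none (a : ℕ) (h : a + 1 < m) (i : S)
      (hne : i.1 ⟨a, by omega⟩ ≠ i.1 ⟨a + 1, h⟩)
      (h₁ : ¬ Arrow p (i.1 ⟨a, by omega⟩) (i.1 ⟨a + 1, h⟩))
      (h₂ : ¬ Arrow p (i.1 ⟨a + 1, h⟩) (i.1 ⟨a, by omega⟩)) :
      KLRRel p S x s e (s a h * s a h * e i) (e i)
  | s_sq_left (a : ℕ) (h : a + 1 < m) (i : S)
      (hne : i.1 ⟨a, by omega⟩ ≠ i.1 ⟨a + 1, h⟩)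
      (h₁ : ¬ Arrow p (i.1 ⟨a, by omega⟩) (i.1 ⟨a + 1, h⟩))
      (h₂ : Arrow p (i.1 ⟨a + 1, h⟩) (i.1 ⟨a, by omega⟩)) :
      KLRRel p S x s e (s a h * s a h * e i) ((x ⟨a + 1, h⟩ - x ⟨a, by omega⟩) * e i)
  | s_sq_right (a : ℕ) (h : a + 1 < m) (i : S)
      (hne : i.1 ⟨a, by omega⟩ ≠ i.1 ⟨a + 1, h⟩)
      (h₁ : Arrow p (i.1 ⟨a, by omega⟩) (i.1 ⟨a + 1, h⟩))
      (h₂ : ¬ Arrow p (i.1 ⟨a + 1, h⟩) (i.1 ⟨a, by omega⟩)) :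
      KLRRel p S x s e (s a h * s a h * e i) ((x ⟨a, by omega⟩ - x ⟨a + 1, h⟩) * e i)
  | s_sq_both (a : ℕ) (h : a + 1 < m) (i : S)
      (hne : i.1 ⟨a, by omega⟩ ≠ i.1 ⟨a + 1, h⟩)
      (h₁ : Arrow p (i.1 ⟨a, by omega⟩) (i.1 ⟨a + 1, h⟩))
      (h₂ : Arrow p (i.1 ⟨a + 1, h⟩) (i.1 ⟨a, by omega⟩)) :
      KLRRel p S x s e (s a h * s a h * e i)
        ((x ⟨a + 1, h⟩ - x ⟨a, by omega⟩) * (x ⟨a, by omega⟩ - x ⟨a + 1, h⟩) * e i)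
  | s_sq_eq (a : ℕ) (h : a + 1 < m) (i : S)
      (heq : i.1 ⟨a, by omega⟩ = i.1 ⟨a + 1, h⟩) :
      KLRRel p S x s e (s a h * s a h * e i) 0
  -- braid relations
  | s_comm (a b : ℕ) (ha : a + 1 < m) (hb : b + 1 < m) (h₁ : a ≠ b + 1) (h₂ : b ≠ a + 1) :
      KLRRel p S x s e (s a ha * s b hb) (s b hb * s a ha)
  | braid_zero (a : ℕ) (h : a + 2 < m) (i : S)
      (hc : i.1 ⟨a, by omega⟩ ≠ i.1 ⟨a + 2, h⟩ ∨
        (¬ Arrow p (i.1 ⟨a, by omega⟩) (i.1 ⟨a + 1, by omega⟩) ∧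
          ¬ Arrow p (i.1 ⟨a + 1, by omega⟩) (i.1 ⟨a, by omega⟩))) :
      KLRRel p S x s e
        ((s (a + 1) h * s a (by omega) * s (a + 1) h -
          s a (by omega) * s (a + 1) h * s a (by omega)) * e i) 0
  | braid_right (a : ℕ) (h : a + 2 < m) (i : S)
      (heq : i.1 ⟨a, by omega⟩ = i.1 ⟨a + 2, h⟩)
      (h₁ : Arrow p (i.1 ⟨a, by omega⟩) (i.1 ⟨a + 1, by omega⟩))
      (h₂ : ¬ Arrow p (i.1 ⟨a + 1, by omega⟩) (i.1 ⟨a, by omega⟩)) :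
      KLRRel p S x s e
        ((s (a + 1) h * s a (by omega) * s (a + 1) h -
          s a (by omega) * s (a + 1) h * s a (by omega)) * e i) (e i)
  | braid_left (a : ℕ) (h : a + 2 < m) (i : S)
      (heq : i.1 ⟨a, by omega⟩ = i.1 ⟨a + 2, h⟩)
      (h₁ : ¬ Arrow p (i.1 ⟨a, by omega⟩) (i.1 ⟨a + 1, by omega⟩))
      (h₂ : Arrow p (i.1 ⟨a + 1, by omega⟩) (i.1 ⟨a, by omega⟩)) :
      KLRRel p S x s e
        ((s (a + 1) h * s a (by omega) * s (a + 1) h -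
          s a (by omega) * s (a + 1) h * s a (by omega)) * e i) (-e i)
  | braid_both (a : ℕ) (h : a + 2 < m) (i : S)
      (heq : i.1 ⟨a, by omega⟩ = i.1 ⟨a + 2, h⟩)
      (h₁ : Arrow p (i.1 ⟨a, by omega⟩) (i.1 ⟨a + 1, by omega⟩))
      (h₂ : Arrow p (i.1 ⟨a + 1, by omega⟩) (i.1 ⟨a, by omega⟩)) :
      KLRRel p S x s e
        ((s (a + 1) h * s a (by omega) * s (a + 1) h -
          s a (by omega) * s (a + 1) h * s a (by omega)) * e i)
        ((2 * x ⟨a + 1, by omega⟩ - x ⟨a + 2, h⟩ - x ⟨a, by omega⟩) * e i)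
  -- moving `σ_a` past `x_l`
  | s_x_left (a : ℕ) (h : a + 1 < m) (i : S)
      (heq : i.1 ⟨a, by omega⟩ = i.1 ⟨a + 1, h⟩) :
      KLRRel p S x s e ((s a h * x ⟨a, by omega⟩ - x ⟨a + 1, h⟩ * s a h) * e i) (-e i)
  | s_x_right (a : ℕ) (h : a + 1 < m) (i : S)
      (heq : i.1 ⟨a, by omega⟩ = i.1 ⟨a + 1, h⟩) :
      KLRRel p S x s e ((s a h * x ⟨a + 1, h⟩ - x ⟨a, by omega⟩ * s a h) * e i) (e i)
  | s_x_else (a : ℕ) (h : a + 1 < m) (l : Fin m) (i : S)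
      (hc : i.1 ⟨a, by omega⟩ ≠ i.1 ⟨a + 1, h⟩ ∨ (l.1 ≠ a ∧ l.1 ≠ a + 1)) :
      KLRRel p S x s e
        ((s a h * x l - x (Equiv.swap (⟨a, by omega⟩ : Fin m) ⟨a + 1, h⟩ l) * s a h) * e i) 0

/-- Generators of a KLR algebra. -/
inductive KLRGen {m : ℕ} (S : Set (Fin m → kˣ)) : Type u
  | x (l : Fin m) : KLRGen S
  | s (a : ℕ) (h : a + 1 < m) : KLRGen S
  | e (i : S) : KLRGen S

/-- The KLR algebra `R_ν` of a dimension vector `ν` of height `m`. -/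
abbrev KLRAlgebra (p : kˣ) (ν : kˣ →₀ ℕ) (m : ℕ) : Type u :=
  RingQuot (KLRRel (A := FreeAlgebra k (KLRGen (klrSeq ν m))) p (klrSeq ν m)
    (fun l => FreeAlgebra.ι k (KLRGen.x l)) (fun a h => FreeAlgebra.ι k (KLRGen.s a h))
    (fun i => FreeAlgebra.ι k (KLRGen.e i)))

/-- The image in the KLR algebra of a generator. -/
noncomputable def KLRAlgebra.gen (p : kˣ) (ν : kˣ →₀ ℕ) (m : ℕ) (g : KLRGen (klrSeq ν m)) :
    KLRAlgebra p ν m :=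
  RingQuot.mkAlgHom k _ (FreeAlgebra.ι k g)

/-- The relations of the VV algebras between elements `x_l`, `σ_a`, `e(i)` (`i ∈ S`) and `π` of a
ring `A`. The generator `π` is only there for `m > 0`, so that the VV algebra of `ν = 0` is `k`.
Here `S` is a set of sequences stable under permutation of the entries and inversion of the first
entry. -/
inductive VVRel (p q : kˣ) {m : ℕ} (S : Set (Fin m → kˣ)) [Fintype S] {A : Type v} [Ring A]
    (x : Fin m → A) (s : (a : ℕ) → a + 1 < m → A) (e : S → A) (pi : 0 < m → A) : A → A → Prop
  | klr (a b : A) (h : KLRRel p S x s e a b) : VVRel p q S x s e pi a b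
  | pi_e (h : 0 < m) (i j : S)
      (hj : j.1 = Function.update i.1 ⟨0, h⟩ (i.1 ⟨0, h⟩)⁻¹) :
      VVRel p q S x s e pi (pi h * e i) (e j * pi h)
  | pi_sq_pos (h : 0 < m) (i : S) (hq : i.1 ⟨0, h⟩ = q) :
      VVRel p q S x s e pi (pi h * pi h * e i) (x ⟨0, h⟩ * e i)
  | pi_sq_neg (h : 0 < m) (i : S) (hq : i.1 ⟨0, h⟩ = q⁻¹) :
      VVRel p q S x s e pi (pi h * pi h * e i) (-x ⟨0, h⟩ * e i)
  | pi_sq_else (h : 0 < m) (i : S) (hq : i.1 ⟨0, h⟩ ≠ q) (hq' : i.1 ⟨0, h⟩ ≠ q⁻¹) :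
      VVRel p q S x s e pi (pi h * pi h * e i) (e i)
  | pi_x_zero (h : 0 < m) : VVRel p q S x s e pi (pi h * x ⟨0, h⟩) (-x ⟨0, h⟩ * pi h)
  | pi_x (h : 0 < m) (l : Fin m) (hl : 0 < l.1) : VVRel p q S x s e pi (pi h * x l) (x l * pi h)
  | braid_zero (h : 1 < m) (i : S)
      (hc : (i.1 ⟨0, by omega⟩)⁻¹ ≠ i.1 ⟨1, h⟩ ∨
        (i.1 ⟨0, by omega⟩ ≠ q ∧ i.1 ⟨0, by omega⟩ ≠ q⁻¹)) :
      VVRel p q S x s e pi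
        ((s 0 h * pi (by omega)) ^ 2 * e i - (pi (by omega) * s 0 h) ^ 2 * e i) 0
  | braid_pos (h : 1 < m) (i : S)
      (h₁ : (i.1 ⟨0, by omega⟩)⁻¹ = i.1 ⟨1, h⟩) (h₂ : i.1 ⟨1, h⟩ = q⁻¹) :
      VVRel p q S x s e pi
        ((s 0 h * pi (by omega)) ^ 2 * e i - (pi (by omega) * s 0 h) ^ 2 * e i) (s 0 h * e i)
  | braid_neg (h : 1 < m) (i : S)
      (h₁ : (i.1 ⟨0, by omega⟩)⁻¹ = i.1 ⟨1, h⟩) (h₂ : i.1 ⟨1, h⟩ = q) :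
      VVRel p q S x s e pi
        ((s 0 h * pi (by omega)) ^ 2 * e i - (pi (by omega) * s 0 h) ^ 2 * e i) (-(s 0 h * e i))
  | pi_s (a : ℕ) (h : a + 1 < m) (ha : a ≠ 0) :
      VVRel p q S x s e pi (pi (by omega) * s a h) (s a h * pi (by omega))

/-- Generators of a VV algebra. -/
inductive VVGen {m : ℕ} (S : Set (Fin m → kˣ)) : Type u
  | x (l : Fin m) : VVGen S
  | s (a : ℕ) (h : a + 1 < m) : VVGen S
  | e (i : S) : VVGen S
  | pi (h : 0 < m) : VVGen S

/-- The VV algebra `𝔚_ν` of a dimension vector `ν` of height `2m`. -/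
abbrev VVAlgebra (p q : kˣ) (ν : kˣ →₀ ℕ) (m : ℕ) : Type u :=
  RingQuot (VVRel (A := FreeAlgebra k (VVGen (vvSeq ν m))) p q (vvSeq ν m)
    (fun l => FreeAlgebra.ι k (VVGen.x l)) (fun a h => FreeAlgebra.ι k (VVGen.s a h))
    (fun i => FreeAlgebra.ι k (VVGen.e i)) (fun h => FreeAlgebra.ι k (VVGen.pi h)))

/-- The image in the VV algebra of a generator. -/
noncomputable def VVAlgebra.gen (p q : kˣ) (ν : kˣ →₀ ℕ) (m : ℕ) (g : VVGen (vvSeq ν m)) :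
    VVAlgebra p q ν m :=
  RingQuot.mkAlgHom k _ (FreeAlgebra.ι k g)

open Classical in
/-- The element `∑_{i ∈ I^μ} e(i)` of `𝔚_ν`. -/
noncomputable def seqIdem (p q : kˣ) (ν μ : kˣ →₀ ℕ) (m : ℕ) : VVAlgebra p q ν m :=
  ∑ i : vvSeq ν m with i.1 ∈ klrSeq μ m, VVAlgebra.gen p q ν m (VVGen.e i)

theorem VVAlgebra.e_mul_self (p q : kˣ) (ν : kˣ →₀ ℕ) (m : ℕ) (i : vvSeq ν m) :
    gen p q ν m (VVGen.e i) * gen p q ν m (VVGen.e i) = gen p q ν m (VVGen.e i) := by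
  unfold gen
  rw [← map_mul]
  exact RingQuot.mkAlgHom_rel k (VVRel.klr _ _ (KLRRel.e_mul_self i))

theorem VVAlgebra.e_mul_ne (p q : kˣ) (ν : kˣ →₀ ℕ) (m : ℕ) (i j : vvSeq ν m) (h : i ≠ j) :
    gen p q ν m (VVGen.e i) * gen p q ν m (VVGen.e j) = 0 := by
  unfold gen
  rw [← map_mul, ← map_zero (RingQuot.mkAlgHom k _)]
  exact RingQuot.mkAlgHom_rel k (VVRel.klr _ _ (KLRRel.e_mul_ne i j h))

theorem isIdempotentElem_seqIdem (p q : kˣ) (ν μ : kˣ →₀ ℕ) (m : ℕ) :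
    IsIdempotentElem (seqIdem p q ν μ m) := by
  unfold IsIdempotentElem seqIdem
  rw [Finset.sum_mul]
  refine Finset.sum_congr rfl fun i hi => ?_
  rw [Finset.mul_sum, Finset.sum_eq_single i]
  · exact VVAlgebra.e_mul_self p q ν m i
  · exact fun j _ hj => VVAlgebra.e_mul_ne p q ν m i j hj.symm
  · exact fun h => absurd hi h

end Algebras

/-! ### The corner ring `eAe` and the functor `M ↦ eM` -/

section Corner

variable {A : Type v} [Ring A] {e : A}

theorem mul_corner (he : IsIdempotentElem e) (a : he.Corner) : e * a.1 = a.1 :=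
  ((Subsemigroup.mem_corner_iff he).1 a.2).1

theorem corner_mul (he : IsIdempotentElem e) (a : he.Corner) : a.1 * e = a.1 :=
  ((Subsemigroup.mem_corner_iff he).1 a.2).2

/-- `eAe` is a `k`-algebra, with unit `e`, if `A` is one. -/
instance cornerAlgebra {k : Type u} [Field k] [Algebra k A] (he : IsIdempotentElem e) :
    Algebra k he.Corner where
  smul r a := ⟨r • a.1, (Subsemigroup.mem_corner_iff he).2
    ⟨by rw [mul_smul_comm, mul_corner], by rw [smul_mul_assoc, corner_mul]⟩⟩
  algebraMap :=
    { toFun := fun r => ⟨r • e, (Subsemigroup.mem_corner_iff he).2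
        ⟨by rw [mul_smul_comm, he.eq], by rw [smul_mul_assoc, he.eq]⟩⟩
      map_one' := Subtype.ext (one_smul k e)
      map_mul' := fun r t => Subtype.ext <| by
        change (r * t) • e = (r • e) * (t • e)
        rw [smul_mul_smul_comm, he.eq]
      map_zero' := Subtype.ext (zero_smul k e)
      map_add' := fun r t => Subtype.ext (add_smul r t e) }
  commutes' r a := Subtype.ext <| by
    change (r • e) * a.1 = a.1 * (r • e)
    rw [smul_mul_assoc, mul_smul_comm, mul_corner, corner_mul]
  smul_def' r a := Subtype.ext <| by
    change r • a.1 = (r • e) * a.1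
    rw [smul_mul_assoc, mul_corner]

/-- `eM = {y ∈ M | e y = y}`. -/
def cornerPart (_ : IsIdempotentElem e) (M : Type w) [AddCommGroup M] [Module A M] :
    AddSubgroup M where
  carrier := {y | e • y = y}
  add_mem' {y z} hy hz := by
    change e • (y + z) = y + z
    rw [smul_add, show e • y = y from hy, show e • z = z from hz]
  zero_mem' := smul_zero e
  neg_mem' {y} hy := by
    change e • (-y) = -y
    rw [smul_neg, show e • y = y from hy]

/-- `eM` is a module over `eAe`. -/
instance cornerModule (he : IsIdempotentElem e) (M : Type w) [AddCommGroup M] [Module A M] :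
    Module he.Corner (cornerPart he M) where
  smul a y := ⟨a.1 • y.1, by
    change e • a.1 • y.1 = a.1 • y.1
    rw [smul_smul, mul_corner]⟩
  one_smul y := Subtype.ext y.2
  mul_smul a b y := Subtype.ext (mul_smul a.1 b.1 y.1)
  smul_zero a := Subtype.ext (smul_zero a.1)
  smul_add a y z := Subtype.ext (smul_add a.1 y.1 z.1)
  add_smul a b y := Subtype.ext (add_smul a.1 b.1 y.1)
  zero_smul y := Subtype.ext (zero_smul A y.1)

/-- The restriction `eM → eN` of an `A`-linear map `M → N`. -/
def cornerMap (he : IsIdempotentElem e) {M N : Type w} [AddCommGroup M] [Module A M]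
    [AddCommGroup N] [Module A N] (f : M →ₗ[A] N) :
    cornerPart he M →ₗ[he.Corner] cornerPart he N where
  toFun y := ⟨f y.1, by
    change e • f y.1 = f y.1
    rw [← map_smul, show e • y.1 = y.1 from y.2]⟩
  map_add' y z := Subtype.ext (map_add f y.1 z.1)
  map_smul' a y := Subtype.ext (map_smul f a.1 y.1)

/-- The functor `M ↦ eM` from `A`-modules to `eAe`-modules. -/
def cornerFunctor (he : IsIdempotentElem e) : ModuleCat.{w} A ⥤ ModuleCat.{w} he.Corner where
  obj M := ModuleCat.of he.Corner (cornerPart he M)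
  map f := ModuleCat.ofHom (cornerMap he f.hom)

end Corner

end VV

namespace VV

/-! ### Morita theory of a full idempotent -/

section Morita

variable {A : Type v} [Ring A] {e : A}

/-! Call a vertex positive if it lies in `I⁺` and negative if it lies in `I⁻`. The two orbits are
disjoint, inversion exchanges them, and no arrow joins them. Hence `σ_a² = 1` wherever `σ_a`
exchanges entries of opposite sign, and no correction terms occur there when `σ_a` passes `x_l`, nor
in a braid relation whose outer entries have opposite signs. Since `q` is not in the
inversion-stable set `I`, also `π² = 1`, and the relation between `π` and `σ_1` is a plain braid
relation of type `B`. So crossings that change the sign pattern are invertible and only those inside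
one sign class carry KLR information.

Fullness. A descent moves a negative entry one step to the left, or inverts it once it is in front.
Repeated descents turn any sequence into one with positive entries, and each descent `i ↦ i'` gives
`e(i) = T e(i') T` with `T` a generator. So all `e(i)` lie in the ideal of `e` (`span_seqIdem`).

Surjectivity of `φ`. The KLR relations hold in the corner because `x_l`, `σ_a` and the positive
`e(i)` commute with `e`. A path is a product of generators along descents down to a positive
sequence. Distinct descents of one sequence commute, so a path may begin with any of them. With the
braid relations this shows that a generator times a path is a path times an element of the image of
`φ` (`exists_cross_mul_path`, `exists_x_mul_path`). The span of paths times the image is therefore a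
left ideal containing `e`, and multiplying it by `e` on the left leaves only the image
(`toCorner_surjective`).

Injectivity of `φ`. The VV algebra acts on functions from sign patterns to the KLR algebra `R`
(`signRep`). The value at `ε` stands for sequences of sign pattern `ε`, each encoded by the positive
sequence to which it straightens. Straightening reverses the order of the negative entries and
inverts them, while `x` changes sign; these three changes together preserve the KLR relations, which
is why the action exists (`rep_vvRel`). On the value at the all-positive pattern `φ(r)` is left
multiplication by `r` (`signRep_toCorner`), hence `r` is recovered from `φ(r)`.

The Morita statement is then the general equivalence `M ↦ eM` for a full idempotent
(`cornerFunctor_isEquivalence`), followed by transport along `φ`. -/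

theorem exists_sum_of_span_eq_top (h : TwoSidedIdeal.span {e} = ⊤) :
    ∃ (n : ℕ) (a b : Fin n → A), ∑ i, a i * e * b i = 1 := by
  have h1 : (1 : A) ∈ TwoSidedIdeal.span {e} := h ▸ trivial
  rw [TwoSidedIdeal.mem_span_iff_mem_addSubgroup_closure] at h1
  generalize (1 : A) = c at h1 ⊢
  induction h1 using AddSubgroup.closure_induction with
  | mem x hx =>
    obtain ⟨_, ⟨a, _, _, rfl, rfl⟩, b, _, rfl⟩ := hx
    exact ⟨1, fun _ => a, fun _ => b, by simp⟩
  | zero => exact ⟨0, Fin.elim0, Fin.elim0, by simp⟩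
  | add x y _ _ hx hy =>
    obtain ⟨n, a, b, rfl⟩ := hx
    obtain ⟨n', a', b', rfl⟩ := hy
    exact ⟨n + n', Fin.append a a', Fin.append b b', by simp [Fin.sum_univ_add]⟩
  | neg x _ hx =>
    obtain ⟨n, a, b, rfl⟩ := hx
    exact ⟨n, -a, b, by simp⟩

variable (he : IsIdempotentElem e)

theorem smul_mem_cornerPart {M : Type w} [AddCommGroup M] [Module A M] (b : A) (y : M) :
    (e * b) • y ∈ cornerPart he M := by
  change e • (e * b) • y = (e * b) • y
  rw [smul_smul, ← mul_assoc, he.eq]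

/-- From `1 = ∑ aᵢ e bᵢ` one gets `y = ∑ aᵢ (e bᵢ y)`, so `M` is generated by `eM` and a linear map
is determined there. -/
theorem cornerMap_injective (h : TwoSidedIdeal.span {e} = ⊤) {M N : Type w} [AddCommGroup M]
    [Module A M] [AddCommGroup N] [Module A N] {f g : M →ₗ[A] N}
    (hfg : cornerMap he f = cornerMap he g) : f = g := by
  obtain ⟨n, a, b, hab⟩ := exists_sum_of_span_eq_top h
  ext y
  have key (b : A) : f ((e * b) • y) = g ((e * b) • y) :=
    congrArg Subtype.val (LinearMap.congr_fun hfg ⟨_, smul_mem_cornerPart he b y⟩)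
  rw [← one_smul A y, ← hab, Finset.sum_smul, map_sum, map_sum]
  refine Finset.sum_congr rfl fun i _ => ?_
  rw [mul_assoc, mul_smul, map_smul, map_smul g, key]

/-- The extension is forced to be `y ↦ ∑ aᵢ g(e bᵢ y)`, where `1 = ∑ aᵢ e bᵢ`. Its linearity comes
from inserting this expression for `1` a second time. -/
theorem cornerMap_surjective (h : TwoSidedIdeal.span {e} = ⊤) {M N : Type w} [AddCommGroup M]
    [Module A M] [AddCommGroup N] [Module A N]
    (g : cornerPart he M →ₗ[he.Corner] cornerPart he N) : ∃ f : M →ₗ[A] N, cornerMap he f = g := by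
  obtain ⟨n, a, b, hab⟩ := exists_sum_of_span_eq_top h
  let r (c : A) (y : M) : cornerPart he M := ⟨(e * c) • y, smul_mem_cornerPart he c y⟩
  have r_add (c : A) (y z : M) : r c (y + z) = r c y + r c z := Subtype.ext (smul_add _ _ _)
  have corner_mem (c : A) : e * c * e ∈ Subsemigroup.corner e :=
    (Subsemigroup.mem_corner_iff he).2
      ⟨by rw [← mul_assoc, ← mul_assoc, he.eq], by rw [mul_assoc, he.eq]⟩
  -- On `eM` the element `e c` acts as `e c e`, which lies in `eAe` and hence passes through `g`.
  have key (c : A) (y : cornerPart he M) :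
      (g (r c y.1)).1 = (e * c) • (g y).1 := by
    have h1 : r c y.1 = (show he.Corner from ⟨e * c * e, corner_mem c⟩) • y := by
      refine Subtype.ext ?_
      change (e * c) • y.1 = (e * c * e) • y.1
      rw [mul_smul _ e, show e • y.1 = y.1 from y.2]
    rw [h1, map_smul]
    change (e * c * e) • (g y).1 = _
    rw [mul_smul _ e, show e • (g y).1 = (g y).1 from (g y).2]
  have sum_r (c : A) (y : M) : ∑ i, r (c * a i) (r (b i) y).1 = r c y := by
    refine Subtype.ext ?_
    rw [AddSubgroup.val_finsetSum]
    change ∑ i, (e * (c * a i)) • (e * b i) • y = (e * c) • y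
    simp_rw [smul_smul, ← Finset.sum_smul]
    congr 1
    calc _ = e * c * ∑ i, a i * e * b i := by simp [Finset.mul_sum, mul_assoc]
      _ = _ := by rw [hab, mul_one]
  refine ⟨{ toFun := fun y => ∑ i, a i • (g (r (b i) y)).1
            map_add' := fun y z => by
              simp [r_add, Finset.sum_add_distrib]
            map_smul' := fun c y => ?_ }, ?_⟩
  -- Write `e bⱼ c y = ∑ᵢ (e bⱼ c aᵢ)(e bᵢ y)` and apply `key` to each term; the sum over `j` then
  -- collapses to `1`.
  · have h1 (j) : (g (r (b j) (c • y))).1 = ∑ i, (e * (b j * c * a i)) • (g (r (b i) y)).1 := by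
      have h2 : r (b j) (c • y) = r (b j * c) y :=
        Subtype.ext (by simp only [r, smul_smul, mul_assoc])
      rw [h2, ← sum_r, map_sum, AddSubgroup.val_finsetSum]
      simp_rw [key]
    simp_rw [h1, RingHom.id_apply, Finset.smul_sum]
    rw [Finset.sum_comm]
    refine Finset.sum_congr rfl fun i _ => ?_
    simp_rw [smul_smul, ← Finset.sum_smul]
    congr 1
    calc _ = (∑ j, a j * e * b j) * (c * a i) := by simp [Finset.sum_mul, mul_assoc]
      _ = _ := by rw [hab, one_mul]
  · ext y
    change ∑ i, a i • (g (r (b i) y.1)).1 = (g y).1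
    simp_rw [key, smul_smul, ← mul_assoc, ← Finset.sum_smul, hab, one_smul]

/-- The submodule `eA` of `A`, a left `eAe`-module, has a right action of `A`. -/
def cornerPartMulRight (a : A) : cornerPart he A →ₗ[he.Corner] cornerPart he A where
  toFun x := ⟨x.1 * a, by
    change e * (x.1 * a) = x.1 * a
    rw [← mul_assoc, show e * x.1 = x.1 from x.2]⟩
  map_add' x y := Subtype.ext (add_mul x.1 y.1 a)
  map_smul' c x := Subtype.ext (mul_assoc c.1 x.1 a)

/-- The coinduced module `Hom(eA, N)` of an `eAe`-module `N`. -/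
def Coind (N : Type w) [AddCommGroup N] [Module he.Corner N] :=
  cornerPart he A →ₗ[he.Corner] N

variable (N : Type w) [AddCommGroup N] [Module he.Corner N]

instance : AddCommGroup (Coind he N) :=
  inferInstanceAs (AddCommGroup (cornerPart he A →ₗ[he.Corner] N))

instance : Module A (Coind he N) where
  smul a f := LinearMap.comp (show cornerPart he A →ₗ[he.Corner] N from f) (cornerPartMulRight he a)
  one_smul f := LinearMap.ext fun x => congrArg f.toFun (Subtype.ext (mul_one x.1))
  mul_smul a b f := LinearMap.ext fun x => congrArg f.toFun (Subtype.ext (mul_assoc x.1 a b).symm)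
  smul_zero _ := rfl
  smul_add _ _ _ := rfl
  add_smul a b f := LinearMap.ext fun x =>
    (congrArg f.toFun (Subtype.ext (mul_add x.1 a b))).trans (f.map_add' _ _)
  zero_smul f := LinearMap.ext fun x =>
    (congrArg f.toFun (Subtype.ext (mul_zero x.1))).trans
      (map_zero (show cornerPart he A →ₗ[he.Corner] N from f))

/-- Right multiplication by `e`, as a map from `eA` to `eAe`. -/
def cornerPartToCorner : cornerPart he A →ₗ[he.Corner] he.Corner where
  toFun x := ⟨x.1 * e, (Subsemigroup.mem_corner_iff he).2
    ⟨by rw [← mul_assoc, show e * x.1 = x.1 from x.2], by rw [mul_assoc, he.eq]⟩⟩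
  map_add' x y := Subtype.ext (add_mul x.1 y.1 e)
  map_smul' c x := Subtype.ext (mul_assoc c.1 x.1 e)

/-- The `eAe`-module `e Hom(eA, N)` is `N`. -/
def cornerPartCoindEquiv : cornerPart he (Coind he N) ≃ₗ[he.Corner] N where
  toFun f := (show cornerPart he A →ₗ[he.Corner] N from f.1) ⟨e, he⟩
  map_add' _ _ := rfl
  map_smul' c f := by
    rw [RingHom.id_apply, ← map_smul]
    exact congrArg (show cornerPart he A →ₗ[he.Corner] N from f.1)
      (Subtype.ext ((mul_corner he c).trans (corner_mul he c).symm))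
  invFun n := ⟨(LinearMap.toSpanSingleton he.Corner N n).comp (cornerPartToCorner he),
    LinearMap.ext fun x => congrArg (fun c : he.Corner => c • n)
      (Subtype.ext (by
        change x.1 * e * e = x.1 * e
        rw [mul_assoc, he.eq]))⟩
  left_inv f := by
    refine Subtype.ext (LinearMap.ext fun x => ?_)
    -- The condition `e f = f` reads `f(x e) = f(x)`, hence `f(x) = f(x e · e) = (x e) f(e)`.
    have h1 := LinearMap.congr_fun (show LinearMap.comp (show cornerPart he A →ₗ[he.Corner] N
      from f.1) (cornerPartMulRight he e) = f.1 from f.2) x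
    change cornerPartToCorner he x • (show cornerPart he A →ₗ[he.Corner] N from f.1) ⟨e, he⟩ = _
    rw [← map_smul]
    refine Eq.trans (congrArg (show cornerPart he A →ₗ[he.Corner] N from f.1) (Subtype.ext ?_)) h1
    change x.1 * e * e = x.1 * e
    rw [mul_assoc, he.eq]
  right_inv n := by
    have h1 : cornerPartToCorner he ⟨e, he⟩ = 1 := Subtype.ext he.eq
    exact (congrArg (· • n) h1).trans (one_smul _ n)

/-- Fullness of the idempotent makes the functor fully faithful. Essential surjectivity holds for
any idempotent, by coinduction; the universe `max v w` is that of the maps `eA → N`. -/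
theorem cornerFunctor_isEquivalence (h : TwoSidedIdeal.span {e} = ⊤) :
    (cornerFunctor.{v, max v w} he).IsEquivalence where
  faithful := ⟨fun {M N f g} hfg => ModuleCat.hom_ext
    (cornerMap_injective he h (congrArg ModuleCat.Hom.hom hfg))⟩
  full := ⟨fun {M N} g => by
    obtain ⟨f, hf⟩ := cornerMap_surjective he h g.hom
    exact ⟨ModuleCat.ofHom f, ModuleCat.hom_ext hf⟩⟩
  essSurj := ⟨fun N => ⟨ModuleCat.of A (Coind he N),
    ⟨(cornerPartCoindEquiv he N).toModuleIso⟩⟩⟩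

open scoped ModuleCat.Algebra in
-- A scalar `r` acts on `eM` through `r • e`, which is multiplication by `r` because `e` fixes `eM`.
theorem cornerFunctor_linear (k : Type u) [Field k] [Algebra k A] :
    (cornerFunctor.{v, w} he).Linear k where
  map_smul {M N} f r := by
    refine ModuleCat.hom_ext (LinearMap.ext fun y => Subtype.ext ?_)
    change algebraMap k A r • f.hom y.1 = (r • e) • f.hom y.1
    rw [← map_smul, ← map_smul, Algebra.smul_def, mul_smul, show e • y.1 = y.1 from y.2]

open scoped ModuleCat.Algebra in
/-- An algebra isomorphism `φ : B ≃ eAe` with `e` full makes `M ↦ eM` a Morita equivalence. -/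
theorem exists_moritaEquivalence {k : Type u} [Field k] {A B : Type v} [Ring A] [Algebra k A]
    [Ring B] [Algebra k B] {e : A} (he : IsIdempotentElem e) (h : TwoSidedIdeal.span {e} = ⊤)
    (φ : B ≃ₐ[k] he.Corner) :
    ∃ E : MoritaEquivalence k A B,
      Nonempty (E.eqv.functor ≅ cornerFunctor.{v, v} he ⋙
        ModuleCat.restrictScalars (φ : B →+* he.Corner)) := by
  have := cornerFunctor_isEquivalence.{v, v} he h
  have := cornerFunctor_linear.{u, v, v} he k
  have : (ModuleCat.restrictScalars.{v} (φ : B →+* he.Corner)).IsEquivalence :=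
    ModuleCat.restrictScalars_isEquivalence_of_ringEquiv φ.toRingEquiv
  have : (ModuleCat.restrictScalars.{v} (φ : B →+* he.Corner)).Linear k :=
    ModuleCat.Algebra.restrictScalarsEquivalenceOfRingEquiv_linear φ
  exact ⟨⟨(cornerFunctor.{v, v} he ⋙
    ModuleCat.restrictScalars (φ : B →+* he.Corner)).asEquivalence,
    Functor.instLinearComp _ _⟩, ⟨Iso.refl _⟩⟩

end Morita

/-! ### Transport of the relations along ring homomorphisms -/

section Relations

variable {k : Type u} [Field k] {A : Type v} [Ring A] {B : Type w} [Ring B]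

/-- Ring homomorphisms preserve the relations. -/
theorem KLRRel.map {p : kˣ} {m : ℕ} {S : Set (Fin m → kˣ)} [Fintype S]
    {x : Fin m → A} {s : (a : ℕ) → a + 1 < m → A} {e : S → A}
    (f : A →+* B) {a b : A} (h : KLRRel p S x s e a b) :
    KLRRel p S (fun l => f (x l)) (fun a h => f (s a h)) (fun i => f (e i)) (f a) (f b) := by
  cases h with
  | e_mul_self i =>
    simpa only [map_mul, map_sub, map_neg, map_pow, map_sum, map_one, map_zero, map_ofNat]
      using KLRRel.e_mul_self (A := B) i
  | e_mul_ne i j hij =>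
    simpa only [map_mul, map_sub, map_neg, map_pow, map_sum, map_one, map_zero, map_ofNat]
      using KLRRel.e_mul_ne (A := B) i j hij
  | sum_e =>
    simpa only [map_mul, map_sub, map_neg, map_pow, map_sum, map_one, map_zero, map_ofNat]
      using KLRRel.sum_e (A := B)
  | s_e a h i j hj =>
    simpa only [map_mul, map_sub, map_neg, map_pow, map_sum, map_one, map_zero, map_ofNat]
      using KLRRel.s_e (A := B) a h i j hj
  | x_e l i =>
    simpa only [map_mul, map_sub, map_neg, map_pow, map_sum, map_one, map_zero, map_ofNat]
      using KLRRel.x_e (A := B) l i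
  | x_comm l l' =>
    simpa only [map_mul, map_sub, map_neg, map_pow, map_sum, map_one, map_zero, map_ofNat]
      using KLRRel.x_comm (A := B) l l'
  | s_sq_none a h i hne h₁ h₂ =>
    simpa only [map_mul, map_sub, map_neg, map_pow, map_sum, map_one, map_zero, map_ofNat]
      using KLRRel.s_sq_none (A := B) a h i hne h₁ h₂
  | s_sq_left a h i hne h₁ h₂ =>
    simpa only [map_mul, map_sub, map_neg, map_pow, map_sum, map_one, map_zero, map_ofNat]
      using KLRRel.s_sq_left (A := B) a h i hne h₁ h₂
  | s_sq_right a h i hne h₁ h₂ =>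
    simpa only [map_mul, map_sub, map_neg, map_pow, map_sum, map_one, map_zero, map_ofNat]
      using KLRRel.s_sq_right (A := B) a h i hne h₁ h₂
  | s_sq_both a h i hne h₁ h₂ =>
    simpa only [map_mul, map_sub, map_neg, map_pow, map_sum, map_one, map_zero, map_ofNat]
      using KLRRel.s_sq_both (A := B) a h i hne h₁ h₂
  | s_sq_eq a h i heq =>
    simpa only [map_mul, map_sub, map_neg, map_pow, map_sum, map_one, map_zero, map_ofNat]
      using KLRRel.s_sq_eq (A := B) a h i heq
  | s_comm a b ha hb h₁ h₂ =>
    simpa only [map_mul, map_sub, map_neg, map_pow, map_sum, map_one, map_zero, map_ofNat]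
      using KLRRel.s_comm (A := B) a b ha hb h₁ h₂
  | braid_zero a h i hc =>
    simpa only [map_mul, map_sub, map_neg, map_pow, map_sum, map_one, map_zero, map_ofNat]
      using KLRRel.braid_zero (A := B) a h i hc
  | braid_right a h i heq h₁ h₂ =>
    simpa only [map_mul, map_sub, map_neg, map_pow, map_sum, map_one, map_zero, map_ofNat]
      using KLRRel.braid_right (A := B) a h i heq h₁ h₂
  | braid_left a h i heq h₁ h₂ =>
    simpa only [map_mul, map_sub, map_neg, map_pow, map_sum, map_one, map_zero, map_ofNat]
      using KLRRel.braid_left (A := B) a h i heq h₁ h₂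
  | braid_both a h i heq h₁ h₂ =>
    simpa only [map_mul, map_sub, map_neg, map_pow, map_sum, map_one, map_zero, map_ofNat]
      using KLRRel.braid_both (A := B) a h i heq h₁ h₂
  | s_x_left a h i heq =>
    simpa only [map_mul, map_sub, map_neg, map_pow, map_sum, map_one, map_zero, map_ofNat]
      using KLRRel.s_x_left (A := B) a h i heq
  | s_x_right a h i heq =>
    simpa only [map_mul, map_sub, map_neg, map_pow, map_sum, map_one, map_zero, map_ofNat]
      using KLRRel.s_x_right (A := B) a h i heq
  | s_x_else a h l i hc =>
    simpa only [map_mul, map_sub, map_neg, map_pow, map_sum, map_one, map_zero, map_ofNat]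
      using KLRRel.s_x_else (A := B) a h l i hc

/-- The relations between images under a ring homomorphism are images of relations. -/
theorem KLRRel.exists_of_map {p : kˣ} {m : ℕ} {S : Set (Fin m → kˣ)} [Fintype S]
    {x : Fin m → A} {s : (a : ℕ) → a + 1 < m → A} {e : S → A}
    (f : A →+* B) {a b : B}
    (h : KLRRel p S (fun l => f (x l)) (fun a h => f (s a h)) (fun i => f (e i)) a b) :
    ∃ a' b', KLRRel p S x s e a' b' ∧ f a' = a ∧ f b' = b := by
  cases h with
  | e_mul_self i => exact ⟨_, _, .e_mul_self i, by simp, by simp⟩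
  | e_mul_ne i j hij => exact ⟨_, _, .e_mul_ne i j hij, by simp, by simp⟩
  | sum_e => exact ⟨_, _, .sum_e, by simp, by simp⟩
  | s_e a h i j hj => exact ⟨_, _, .s_e a h i j hj, by simp, by simp⟩
  | x_e l i => exact ⟨_, _, .x_e l i, by simp, by simp⟩
  | x_comm l l' => exact ⟨_, _, .x_comm l l', by simp, by simp⟩
  | s_sq_none a h i hne h₁ h₂ => exact ⟨_, _, .s_sq_none a h i hne h₁ h₂, by simp, by simp⟩
  | s_sq_left a h i hne h₁ h₂ => exact ⟨_, _, .s_sq_left a h i hne h₁ h₂, by simp, by simp⟩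
  | s_sq_right a h i hne h₁ h₂ => exact ⟨_, _, .s_sq_right a h i hne h₁ h₂, by simp, by simp⟩
  | s_sq_both a h i hne h₁ h₂ => exact ⟨_, _, .s_sq_both a h i hne h₁ h₂, by simp, by simp⟩
  | s_sq_eq a h i heq => exact ⟨_, _, .s_sq_eq a h i heq, by simp, by simp⟩
  | s_comm a b ha hb h₁ h₂ => exact ⟨_, _, .s_comm a b ha hb h₁ h₂, by simp, by simp⟩
  | braid_zero a h i hc => exact ⟨_, _, .braid_zero a h i hc, by simp, by simp⟩
  | braid_right a h i heq h₁ h₂ => exact ⟨_, _, .braid_right a h i heq h₁ h₂, by simp, by simp⟩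
  | braid_left a h i heq h₁ h₂ => exact ⟨_, _, .braid_left a h i heq h₁ h₂, by simp, by simp⟩
  | braid_both a h i heq h₁ h₂ => exact ⟨_, _, .braid_both a h i heq h₁ h₂, by simp, by simp [map_ofNat f 2]⟩
  | s_x_left a h i heq => exact ⟨_, _, .s_x_left a h i heq, by simp, by simp⟩
  | s_x_right a h i heq => exact ⟨_, _, .s_x_right a h i heq, by simp, by simp⟩
  | s_x_else a h l i hc => exact ⟨_, _, .s_x_else a h l i hc, by simp, by simp⟩

/-- Ring homomorphisms preserve the relations. -/
theorem VVRel.map {p q : kˣ} {m : ℕ} {S : Set (Fin m → kˣ)} [Fintype S]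
    {x : Fin m → A} {s : (a : ℕ) → a + 1 < m → A} {e : S → A} {pi : 0 < m → A}
    (f : A →+* B) {a b : A} (h : VVRel p q S x s e pi a b) :
    VVRel p q S (fun l => f (x l)) (fun a h => f (s a h)) (fun i => f (e i))
      (fun h => f (pi h)) (f a) (f b) := by
  cases h with
  | klr a b h => exact .klr _ _ (h.map f)
  | pi_e h i j hj =>
    simpa only [map_mul, map_sub, map_neg, map_pow, map_sum, map_one, map_zero, map_ofNat]
      using VVRel.pi_e (A := B) h i j hj
  | pi_sq_pos h i hq =>
    simpa only [map_mul, map_sub, map_neg, map_pow, map_sum, map_one, map_zero, map_ofNat]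
      using VVRel.pi_sq_pos (A := B) h i hq
  | pi_sq_neg h i hq =>
    simpa only [map_mul, map_sub, map_neg, map_pow, map_sum, map_one, map_zero, map_ofNat]
      using VVRel.pi_sq_neg (A := B) h i hq
  | pi_sq_else h i hq hq' =>
    simpa only [map_mul, map_sub, map_neg, map_pow, map_sum, map_one, map_zero, map_ofNat]
      using VVRel.pi_sq_else (A := B) h i hq hq'
  | pi_x_zero h =>
    simpa only [map_mul, map_sub, map_neg, map_pow, map_sum, map_one, map_zero, map_ofNat]
      using VVRel.pi_x_zero (A := B) h
  | pi_x h l hl =>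
    simpa only [map_mul, map_sub, map_neg, map_pow, map_sum, map_one, map_zero, map_ofNat]
      using VVRel.pi_x (A := B) h l hl
  | braid_zero h i hc =>
    simpa only [map_mul, map_sub, map_neg, map_pow, map_sum, map_one, map_zero, map_ofNat]
      using VVRel.braid_zero (A := B) h i hc
  | braid_pos h i h₁ h₂ =>
    simpa only [map_mul, map_sub, map_neg, map_pow, map_sum, map_one, map_zero, map_ofNat]
      using VVRel.braid_pos (A := B) h i h₁ h₂
  | braid_neg h i h₁ h₂ =>
    simpa only [map_mul, map_sub, map_neg, map_pow, map_sum, map_one, map_zero, map_ofNat]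
      using VVRel.braid_neg (A := B) h i h₁ h₂
  | pi_s a h ha =>
    simpa only [map_mul, map_sub, map_neg, map_pow, map_sum, map_one, map_zero, map_ofNat]
      using VVRel.pi_s (A := B) a h ha

/-- The relations between images under a ring homomorphism are images of relations. -/
theorem VVRel.exists_of_map {p q : kˣ} {m : ℕ} {S : Set (Fin m → kˣ)} [Fintype S]
    {x : Fin m → A} {s : (a : ℕ) → a + 1 < m → A} {e : S → A} {pi : 0 < m → A}
    (f : A →+* B) {a b : B}
    (h : VVRel p q S (fun l => f (x l)) (fun a h => f (s a h)) (fun i => f (e i))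
      (fun h => f (pi h)) a b) :
    ∃ a' b', VVRel p q S x s e pi a' b' ∧ f a' = a ∧ f b' = b := by
  cases h with
  | klr a b h =>
    obtain ⟨a', b', h, ha, hb⟩ := h.exists_of_map f
    exact ⟨a', b', .klr _ _ h, ha, hb⟩
  | pi_e h i j hj => exact ⟨_, _, .pi_e h i j hj, by simp, by simp⟩
  | pi_sq_pos h i hq => exact ⟨_, _, .pi_sq_pos h i hq, by simp, by simp⟩
  | pi_sq_neg h i hq => exact ⟨_, _, .pi_sq_neg h i hq, by simp, by simp⟩
  | pi_sq_else h i hq hq' => exact ⟨_, _, .pi_sq_else h i hq hq', by simp, by simp⟩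
  | pi_x_zero h => exact ⟨_, _, .pi_x_zero h, by simp, by simp⟩
  | pi_x h l hl => exact ⟨_, _, .pi_x h l hl, by simp, by simp⟩
  | braid_zero h i hc => exact ⟨_, _, .braid_zero h i hc, by simp, by simp⟩
  | braid_pos h i h₁ h₂ => exact ⟨_, _, .braid_pos h i h₁ h₂, by simp, by simp⟩
  | braid_neg h i h₁ h₂ => exact ⟨_, _, .braid_neg h i h₁ h₂, by simp, by simp⟩
  | pi_s a h ha => exact ⟨_, _, .pi_s a h ha, by simp, by simp⟩

end Relations

/-! ### Universal properties of the two algebras -/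

section Universal

variable {k : Type u} [Field k]

namespace KLRAlgebra

variable {p : kˣ} {ν : kˣ →₀ ℕ} {m : ℕ}

/-- The relation is stated inside the quotient; by `KLRRel.exists_of_map` it is the image of a
defining relation of the free algebra. -/
theorem eq_of_rel {a b : KLRAlgebra p ν m}
    (h : KLRRel p (klrSeq ν m) (fun l => gen p ν m (.x l)) (fun a h => gen p ν m (.s a h))
      (fun i => gen p ν m (.e i)) a b) : a = b := by
  obtain ⟨a', b', h', rfl, rfl⟩ := KLRRel.exists_of_map (RingQuot.mkAlgHom k _ :
    _ →ₐ[k] KLRAlgebra p ν m).toRingHom h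
  exact RingQuot.mkAlgHom_rel k h'

theorem adjoin_range_gen : Algebra.adjoin k (Set.range (gen p ν m)) = ⊤ := by
  rw [eq_top_iff]
  rintro a -
  obtain ⟨a, rfl⟩ := RingQuot.mkAlgHom_surjective k _ a
  induction a using FreeAlgebra.induction with
  | grade0 r => simp
  | grade1 g => exact Algebra.subset_adjoin ⟨g, rfl⟩
  | mul a b ha hb => simpa using mul_mem ha hb
  | add a b ha hb => simpa using add_mem ha hb

variable {B : Type w} [Ring B] [Algebra k B]

/-- The homomorphism from a KLR algebra given by elements that satisfy the relations. -/
noncomputable def lift (x : Fin m → B) (s : (a : ℕ) → a + 1 < m → B) (e : klrSeq ν m → B)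
    (h : ∀ a b, KLRRel p (klrSeq ν m) x s e a b → a = b) : KLRAlgebra p ν m →ₐ[k] B :=
  RingQuot.liftAlgHom k ⟨FreeAlgebra.lift k fun g => match g with
    | .x l => x l
    | .s a h => s a h
    | .e i => e i, fun a b hab => h _ _ (by
      have h1 := hab.map (FreeAlgebra.lift k fun g : KLRGen (klrSeq ν m) => match g with
        | .x l => x l
        | .s a h => s a h
        | .e i => e i).toRingHom
      simpa using h1)⟩

variable {x : Fin m → B} {s : (a : ℕ) → a + 1 < m → B} {e : klrSeq ν m → B}
  (h : ∀ a b, KLRRel p (klrSeq ν m) x s e a b → a = b)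

theorem lift_x (l : Fin m) : lift x s e h (gen p ν m (.x l)) = x l := by
  simp [lift, gen]

theorem lift_s (a : ℕ) (ha : a + 1 < m) : lift x s e h (gen p ν m (.s a ha)) = s a ha := by
  simp [lift, gen]

theorem lift_e (i : klrSeq ν m) : lift x s e h (gen p ν m (.e i)) = e i := by
  simp [lift, gen]

end KLRAlgebra

namespace VVAlgebra

variable {p q : kˣ} {ν : kˣ →₀ ℕ} {m : ℕ}

theorem eq_of_rel {a b : VVAlgebra p q ν m}
    (h : VVRel p q (vvSeq ν m) (fun l => gen p q ν m (.x l)) (fun a h => gen p q ν m (.s a h))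
      (fun i => gen p q ν m (.e i)) (fun h => gen p q ν m (.pi h)) a b) : a = b := by
  obtain ⟨a', b', h', rfl, rfl⟩ := VVRel.exists_of_map (RingQuot.mkAlgHom k _ :
    _ →ₐ[k] VVAlgebra p q ν m).toRingHom h
  exact RingQuot.mkAlgHom_rel k h'

theorem adjoin_range_gen : Algebra.adjoin k (Set.range (gen p q ν m)) = ⊤ := by
  rw [eq_top_iff]
  rintro a -
  obtain ⟨a, rfl⟩ := RingQuot.mkAlgHom_surjective k _ a
  induction a using FreeAlgebra.induction with
  | grade0 r => simp
  | grade1 g => exact Algebra.subset_adjoin ⟨g, rfl⟩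
  | mul a b ha hb => simpa using mul_mem ha hb
  | add a b ha hb => simpa using add_mem ha hb

variable {B : Type w} [Ring B] [Algebra k B]

/-- The homomorphism from a VV algebra given by elements that satisfy the relations. -/
noncomputable def lift (x : Fin m → B) (s : (a : ℕ) → a + 1 < m → B) (e : vvSeq ν m → B)
    (pi : 0 < m → B) (h : ∀ a b, VVRel p q (vvSeq ν m) x s e pi a b → a = b) :
    VVAlgebra p q ν m →ₐ[k] B :=
  RingQuot.liftAlgHom k ⟨FreeAlgebra.lift k fun g => match g with
    | .x l => x l
    | .s a h => s a h
    | .e i => e i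
    | .pi h => pi h, fun a b hab => h _ _ (by
      have h1 := hab.map (FreeAlgebra.lift k fun g : VVGen (vvSeq ν m) => match g with
        | .x l => x l
        | .s a h => s a h
        | .e i => e i
        | .pi h => pi h).toRingHom
      simpa using h1)⟩

variable {x : Fin m → B} {s : (a : ℕ) → a + 1 < m → B} {e : vvSeq ν m → B} {pi : 0 < m → B}
  (h : ∀ a b, VVRel p q (vvSeq ν m) x s e pi a b → a = b)

theorem lift_x (l : Fin m) : lift x s e pi h (gen p q ν m (.x l)) = x l := by
  simp [lift, gen]

theorem lift_s (a : ℕ) (ha : a + 1 < m) : lift x s e pi h (gen p q ν m (.s a ha)) = s a ha := by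
  simp [lift, gen]

theorem lift_e (i : vvSeq ν m) : lift x s e pi h (gen p q ν m (.e i)) = e i := by
  simp [lift, gen]

end VVAlgebra

end Universal

/-! ### Signs of vertices, reflections and descents of sequences -/

section Sequences

variable {k : Type u} [Field k] {p q lam : kˣ} {ν ν' : kˣ →₀ ℕ} {m : ℕ}

theorem mem_orbit_iff {z : kˣ} : z ∈ orbit p lam ↔ z ∈ orbitPos p lam ∨ z ∈ orbitNeg p lam :=
  exists_or

theorem inv_mem_orbitNeg {z : kˣ} (h : z ∈ orbitPos p lam) : z⁻¹ ∈ orbitNeg p lam := by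
  obtain ⟨n, rfl⟩ := h
  exact ⟨-n, by rw [mul_inv, ← zpow_neg, mul_neg]⟩

theorem inv_mem_orbitPos {z : kˣ} (h : z ∈ orbitNeg p lam) : z⁻¹ ∈ orbitPos p lam := by
  obtain ⟨n, rfl⟩ := h
  exact ⟨-n, by rw [mul_inv, ← zpow_neg, mul_neg, inv_inv]⟩

theorem inv_mem_orbit {z : kˣ} (h : z ∈ orbit p lam) : z⁻¹ ∈ orbit p lam := by
  rw [mem_orbit_iff] at h ⊢
  exact h.symm.imp inv_mem_orbitPos inv_mem_orbitNeg

/-- An arrow is multiplication by `p²`, which preserves the orbit. This is what excludes arrows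
between vertices of opposite sign. -/
theorem Arrow.mem_orbitNeg_iff {z w : kˣ} (h : Arrow p z w) :
    z ∈ orbitNeg p lam ↔ w ∈ orbitNeg p lam := by
  constructor
  · rintro ⟨n, hn⟩
    refine ⟨n - 1, ?_⟩
    rw [show w = (p ^ 2)⁻¹ * z by rw [h]; simp, hn, mul_sub, zpow_sub, ← mul_assoc]
    congr 1
    rw [mul_comm]
    rfl
  · rintro ⟨n, rfl⟩
    refine ⟨n + 1, ?_⟩
    rw [h, mul_add, zpow_add, ← mul_assoc]
    congr 1
    rw [mul_comm]
    rfl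

/-- Inversion turns arrows around. The representation below compensates for this by reversing the
order of the negative entries. -/
theorem arrow_inv_iff {z w : kˣ} : Arrow p z⁻¹ w⁻¹ ↔ Arrow p w z := by
  unfold Arrow
  constructor
  · intro h
    rw [← inv_inv z, h]
    simp
  · rintro rfl
    simp

open Classical in
/-- Whether a vertex lies in `I⁻`. -/
noncomputable def isNeg (p lam z : kˣ) : Bool := decide (z ∈ orbitNeg p lam)

theorem isNeg_eq_true {z : kˣ} : isNeg p lam z = true ↔ z ∈ orbitNeg p lam := by
  simp [isNeg]

theorem isNeg_eq_false {z : kˣ} : isNeg p lam z = false ↔ z ∉ orbitNeg p lam := by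
  simp [isNeg]

theorem Arrow.isNeg_eq {z w : kˣ} (h : Arrow p z w) : isNeg p lam z = isNeg p lam w := by
  simp [isNeg, h.mem_orbitNeg_iff]

/-- The hypotheses on the orbit and on the dimension vectors that make `𝔚_ν` and `R_ν'` Morita
equivalent. -/
structure Admissible (p q lam : kˣ) (ν ν' : kˣ →₀ ℕ) : Prop where
  disjoint : Disjoint (orbitPos p lam) (orbitNeg p lam)
  q_notMem : q ∉ orbit p lam
  theta : IsThetaDimVector (orbit p lam) ν
  eq_restrict : ν' = restrictTo (orbitPos p lam) ν

theorem Admissible.isNeg_of_mem_orbitPos (H : Admissible p q lam ν ν') {z : kˣ}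
    (hz : z ∈ orbitPos p lam) : isNeg p lam z = false :=
  isNeg_eq_false.2 fun h => Set.disjoint_left.1 H.disjoint hz h

theorem Admissible.isNeg_inv (H : Admissible p q lam ν ν') {z : kˣ} (hz : z ∈ orbit p lam) :
    isNeg p lam z⁻¹ = !isNeg p lam z := by
  rcases mem_orbit_iff.1 hz with h | h
  · rw [H.isNeg_of_mem_orbitPos h, isNeg_eq_true.2 (inv_mem_orbitNeg h), Bool.not_false]
  · rw [H.isNeg_of_mem_orbitPos (inv_mem_orbitPos h), isNeg_eq_true.2 h, Bool.not_true]

theorem mem_vvSeq_iff {i : Fin m → kˣ} :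
    i ∈ vvSeq ν m ↔ ∑ a, (Finsupp.single (i a) 1 + Finsupp.single (i a)⁻¹ 1) = ν := by
  rw [Finset.sum_add_distrib]
  rfl

theorem mem_vvSeq_of_perm {i i' : Fin m → kˣ} (hi : i ∈ vvSeq ν m) (τ : Equiv.Perm (Fin m))
    (h : ∀ a, i' a = i (τ a) ∨ i' a = (i (τ a))⁻¹) : i' ∈ vvSeq ν m := by
  rw [mem_vvSeq_iff] at hi ⊢
  rw [← hi, ← Equiv.sum_comp τ fun a => Finsupp.single (i a) 1 + Finsupp.single (i a)⁻¹ 1]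
  refine Finset.sum_congr rfl fun a _ => ?_
  rcases h a with h | h
  · rw [h]
  · rw [h, inv_inv, add_comm]

theorem comp_mem_klrSeq {i : Fin m → kˣ} (hi : i ∈ klrSeq ν m) (τ : Equiv.Perm (Fin m)) :
    i ∘ τ ∈ klrSeq ν m := by
  refine Eq.trans ?_ hi
  exact Equiv.sum_comp τ fun a => Finsupp.single (i a) 1

theorem mem_support_of_sum_single {i : Fin m → kˣ} {μ : kˣ →₀ ℕ}
    (h : ∑ a, Finsupp.single (i a) 1 ≤ μ) (a : Fin m) : i a ∈ μ.support := by
  have h1 := h (i a)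
  rw [Finsupp.finsetSum_apply] at h1
  have h2 : (Finsupp.single (i a) 1 : kˣ →₀ ℕ) (i a) ≤ ∑ b, (Finsupp.single (i b) 1) (i a) :=
    Finset.single_le_sum (f := fun b => (Finsupp.single (i b) 1 : kˣ →₀ ℕ) (i a))
      (fun _ _ => Nat.zero_le _) (Finset.mem_univ a)
  rw [Finsupp.single_eq_same] at h2
  rw [Finsupp.mem_support_iff]
  omega

theorem Admissible.mem_orbit_of_mem_vvSeq (H : Admissible p q lam ν ν') {i : Fin m → kˣ}
    (hi : i ∈ vvSeq ν m) (a : Fin m) : i a ∈ orbit p lam :=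
  H.theta.1 _ (mem_support_of_sum_single (le_of_le_of_eq le_self_add hi) a)

theorem Admissible.mem_orbitPos_of_mem_klrSeq (H : Admissible p q lam ν ν') {i : Fin m → kˣ}
    (hi : i ∈ klrSeq ν' m) (a : Fin m) : i a ∈ orbitPos p lam := by
  classical
  have h := mem_support_of_sum_single (le_of_eq hi) a
  rw [H.eq_restrict, restrictTo, Finsupp.support_filter, Finset.mem_filter] at h
  exact h.2

/-- If all entries are positive then all their inverses are negative, so restricting `ν` to `I⁺`
keeps exactly the first of the two sums. -/
theorem Admissible.mem_klrSeq (H : Admissible p q lam ν ν') {i : Fin m → kˣ}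
    (hi : i ∈ vvSeq ν m) (h : ∀ a, isNeg p lam (i a) = false) : i ∈ klrSeq ν' m := by
  classical
  have hpos (a) : i a ∈ orbitPos p lam :=
    (mem_orbit_iff.1 (H.mem_orbit_of_mem_vvSeq hi a)).resolve_right (isNeg_eq_false.1 (h a))
  have hneg (a) : (i a)⁻¹ ∉ orbitPos p lam := fun h1 =>
    Set.disjoint_left.1 H.disjoint h1 (inv_mem_orbitNeg (hpos a))
  change ∑ a, Finsupp.single (i a) 1 = ν'
  rw [mem_vvSeq_iff] at hi
  rw [H.eq_restrict, restrictTo, ← hi, Finsupp.filter_sum]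
  refine Finset.sum_congr rfl fun a _ => ?_
  rw [Finsupp.filter_add, Finsupp.filter_single_of_pos _ (hpos a),
    Finsupp.filter_single_of_neg _ (hneg a), add_zero]

/-- By symmetry and support in `I⁺ ⊔ I⁻`, the vector `ν` is `ν'` plus its image under inversion. -/
theorem Admissible.mem_vvSeq (H : Admissible p q lam ν ν') {i : Fin m → kˣ}
    (hi : i ∈ klrSeq ν' m) : i ∈ vvSeq ν m := by
  classical
  have hi' : ∑ a, Finsupp.single (i a) 1 = ν' := hi
  have h1 : ∑ a, Finsupp.single (i a)⁻¹ 1 = ν'.mapDomain (·⁻¹) := by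
    rw [← hi', Finsupp.mapDomain_finsetSum]
    simp only [Finsupp.mapDomain_single]
  change ∑ a, Finsupp.single (i a) 1 + ∑ a, Finsupp.single (i a)⁻¹ 1 = ν
  rw [h1, hi']
  ext z
  have h2 : ν'.mapDomain (·⁻¹) z = ν' z⁻¹ := by
    conv_lhs => rw [← inv_inv z]
    exact Finsupp.mapDomain_apply inv_injective _ _
  rw [Finsupp.add_apply, h2, H.eq_restrict, restrictTo, Finsupp.filter_apply, Finsupp.filter_apply,
    ← H.theta.2 z]
  by_cases hz : z ∈ orbitPos p lam
  · rw [if_pos hz, if_neg fun h => Set.disjoint_left.1 H.disjoint h (inv_mem_orbitNeg hz), add_zero]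
  · rw [if_neg hz, zero_add]
    by_cases hz' : z⁻¹ ∈ orbitPos p lam
    · rw [if_pos hz']
    · rw [if_neg hz']
      by_contra h3
      rcases mem_orbit_iff.1 (H.theta.1 z (Finsupp.mem_support_iff.2 (Ne.symm h3))) with h | h
      · exact hz h
      · exact hz' (inv_mem_orbitPos h)

theorem Admissible.mem_klrSeq_iff (H : Admissible p q lam ν ν') {i : Fin m → kˣ} :
    i ∈ klrSeq ν' m ↔ i ∈ vvSeq ν m ∧ ∀ a, isNeg p lam (i a) = false :=
  ⟨fun h => ⟨H.mem_vvSeq h, fun a => H.isNeg_of_mem_orbitPos (H.mem_orbitPos_of_mem_klrSeq h a)⟩,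
    fun h => H.mem_klrSeq h.1 h.2⟩

/-- The transposition of the positions `a` and `a + 1`. -/
abbrev adjSwap (a : ℕ) (h : a + 1 < m) : Equiv.Perm (Fin m) :=
  Equiv.swap ⟨a, by omega⟩ ⟨a + 1, h⟩

/-- The reflections of type `B` acting on sequences: the first one inverts the first entry, and the
others permute the entries. -/
def reflect : (g : ℕ) → g < m → (Fin m → kˣ) → Fin m → kˣ
  | 0, h, i => Function.update i ⟨0, h⟩ (i ⟨0, h⟩)⁻¹
  | a + 1, h, i => i ∘ adjSwap a h

theorem reflect_mem_vvSeq (g : ℕ) (hg : g < m) {i : Fin m → kˣ} (hi : i ∈ vvSeq ν m) :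
    reflect g hg i ∈ vvSeq ν m := by
  cases g with
  | zero =>
    refine mem_vvSeq_of_perm hi 1 fun a => ?_
    by_cases ha : a = ⟨0, hg⟩
    · subst ha
      exact Or.inr (by simp [reflect])
    · exact Or.inl (Function.update_of_ne ha _ _)
  | succ a => exact mem_vvSeq_of_perm hi (adjSwap a hg) fun b => Or.inl rfl

theorem reflect_reflect (g : ℕ) (hg : g < m) (i : Fin m → kˣ) :
    reflect g hg (reflect g hg i) = i := by
  cases g with
  | zero => simp [reflect]
  | succ a =>
    funext b
    simp [reflect]

/-- The reflection `g` moves a vertex of `I⁻` to the left or inverts one in first position. -/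
def IsDescent (p lam : kˣ) : (g : ℕ) → g < m → (Fin m → kˣ) → Prop
  | 0, h, i => isNeg p lam (i ⟨0, h⟩) = true
  | a + 1, h, i => isNeg p lam (i ⟨a, by omega⟩) = false ∧ isNeg p lam (i ⟨a + 1, h⟩) = true

/-- Walk left from the negative entry: either a positive neighbour appears, or the walk ends at a
negative entry in front. -/
theorem exists_isDescent {i : Fin m → kˣ} {b : Fin m} (h : isNeg p lam (i b) = true) :
    ∃ g hg, IsDescent p lam g hg i := by
  obtain ⟨b, hb⟩ := b
  induction b with
  | zero => exact ⟨0, hb, h⟩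
  | succ a ih =>
    by_cases h1 : isNeg p lam (i ⟨a, by omega⟩) = true
    · exact ih (by omega) h1
    · exact ⟨a + 1, hb, by simpa using h1, h⟩

/-- The sum of the positions of the vertices of `I⁻`. -/
noncomputable def inversions (p lam : kˣ) (i : Fin m → kˣ) : ℕ :=
  ∑ b : Fin m, if isNeg p lam (i b) then b.1 + 1 else 0

/-- Positions are weighted from `1`, so inverting a negative entry in front lowers the sum too, not
only a move to the left. -/
theorem Admissible.inversions_reflect_lt (H : Admissible p q lam ν ν') {g : ℕ} {hg : g < m}
    {i : Fin m → kˣ} (hi : i ∈ vvSeq ν m) (h : IsDescent p lam g hg i) :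
    inversions p lam (reflect g hg i) < inversions p lam i := by
  cases g with
  | zero =>
    have h' : isNeg p lam (i ⟨0, hg⟩) = true := h
    refine Finset.sum_lt_sum (fun b _ => ?_) ⟨⟨0, hg⟩, Finset.mem_univ _, ?_⟩
    · by_cases hb : b = ⟨0, hg⟩
      · subst hb
        simp [reflect, H.isNeg_inv (H.mem_orbit_of_mem_vvSeq hi _), h']
      · rw [reflect, Function.update_of_ne hb]
    · simp [reflect, H.isNeg_inv (H.mem_orbit_of_mem_vvSeq hi _), h']
  | succ a =>
    obtain ⟨h0, h1⟩ := h
    have hne : (⟨a, by omega⟩ : Fin m) ≠ ⟨a + 1, hg⟩ := by simp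
    unfold inversions
    rw [← Equiv.sum_comp (adjSwap a hg)]
    refine Finset.sum_lt_sum (fun b _ => ?_) ⟨⟨a + 1, hg⟩, Finset.mem_univ _, ?_⟩
    · simp only [reflect, Function.comp_apply, Equiv.swap_apply_self]
      by_cases hb : b = ⟨a + 1, hg⟩
      · subst hb
        simp [h1]
      · by_cases hb' : b = ⟨a, by omega⟩
        · subst hb'
          simp [h0]
        · rw [Equiv.swap_apply_of_ne_of_ne hb' hb]
    · simp [reflect, h1]

/-- Induction on sequences along descents. -/
theorem Admissible.descent_induction (H : Admissible p q lam ν ν') {C : (Fin m → kˣ) → Prop}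
    (base : ∀ i ∈ klrSeq ν' m, C i)
    (step : ∀ i ∈ vvSeq ν m, ∀ g hg, IsDescent p lam g hg i → C (reflect g hg i) → C i)
    (i : Fin m → kˣ) (hi : i ∈ vvSeq ν m) : C i := by
  induction hn : inversions p lam i using Nat.strong_induction_on generalizing i with
  | _ n ih =>
    subst hn
    by_cases h : ∀ a, isNeg p lam (i a) = false
    · exact base i (H.mem_klrSeq hi h)
    · push Not at h
      obtain ⟨b, hb⟩ := h
      obtain ⟨g, hg, hd⟩ := exists_isDescent (by simpa using hb)
      exact step i hi g hg hd
        (ih _ (H.inversions_reflect_lt hi hd) _ (reflect_mem_vvSeq g hg hi) rfl)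

theorem reflect_succ_apply (a : ℕ) (h : a + 1 < m) (i : Fin m → kˣ) (b : ℕ) (hb : b < m) :
    reflect (a + 1) h i ⟨b, hb⟩ = if b = a then i ⟨a + 1, h⟩ else
      if b = a + 1 then i ⟨a, by omega⟩ else i ⟨b, hb⟩ := by
  simp only [reflect, Function.comp_apply, Equiv.swap_apply_def, Fin.mk.injEq]
  split_ifs <;> rfl

theorem reflect_zero_apply (h : 0 < m) (i : Fin m → kˣ) (b : ℕ) (hb : b < m) :
    reflect 0 h i ⟨b, hb⟩ = if b = 0 then (i ⟨0, h⟩)⁻¹ else i ⟨b, hb⟩ := by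
  simp [reflect, Function.update_apply]

end Sequences

/-! ### The relations of the VV algebra, sign by sign -/

namespace VVAlgebra

variable {k : Type u} [Field k] {p q lam : kˣ} {ν ν' : kˣ →₀ ℕ} {m : ℕ}

variable (p q ν m) in
open Classical in
/-- The idempotent `e(i)` for a sequence `i`, zero if `i` is not in `ᶿI^ν`. -/
noncomputable def seqE (i : Fin m → kˣ) : VVAlgebra p q ν m :=
  if h : i ∈ vvSeq ν m then gen p q ν m (.e ⟨i, h⟩) else 0

variable (p q ν m) in
/-- The generators `π, σ_1, σ_2, …` in one family. -/
noncomputable def cross : (g : ℕ) → g < m → VVAlgebra p q ν m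
  | 0, h => gen p q ν m (.pi h)
  | a + 1, h => gen p q ν m (.s a h)

local notation "E" => seqE p q ν m
local notation "T" => cross p q ν m
local notation "X[" l "]" => gen p q ν m (VVGen.x l)

theorem seqE_of_mem {i : Fin m → kˣ} (h : i ∈ vvSeq ν m) :
    E i = gen p q ν m (.e ⟨i, h⟩) := dif_pos h

theorem seqE_of_notMem {i : Fin m → kˣ} (h : i ∉ vvSeq ν m) : E i = 0 := dif_neg h

/-- To compare two elements multiplied by `e(i)`, one may assume that `i` is in `ᶿI^ν`. -/
theorem mul_seqE_congr {i : Fin m → kˣ} {a b : VVAlgebra p q ν m}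
    (h : ∀ hi : i ∈ vvSeq ν m, a * gen p q ν m (.e ⟨i, hi⟩) = b * gen p q ν m (.e ⟨i, hi⟩)) :
    a * E i = b * E i := by
  by_cases hi : i ∈ vvSeq ν m
  · rw [seqE_of_mem hi, h hi]
  · rw [seqE_of_notMem hi, mul_zero, mul_zero]

theorem seqE_mul_self (i : Fin m → kˣ) : E i * E i = E i := by
  by_cases hi : i ∈ vvSeq ν m
  · rw [seqE_of_mem hi, e_mul_self]
  · rw [seqE_of_notMem hi, zero_mul]

theorem seqE_mul_ne {i j : Fin m → kˣ} (h : i ≠ j) : E i * E j = 0 := by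
  by_cases hi : i ∈ vvSeq ν m
  · by_cases hj : j ∈ vvSeq ν m
    · rw [seqE_of_mem hi, seqE_of_mem hj, e_mul_ne]
      exact fun h1 => h (congrArg Subtype.val h1)
    · rw [seqE_of_notMem hj, mul_zero]
  · rw [seqE_of_notMem hi, zero_mul]

theorem sum_seqE : ∑ i : vvSeq ν m, E i.1 = 1 := by
  simp_rw [seqE_of_mem (Subtype.coe_prop _)]
  exact eq_of_rel (.klr _ _ .sum_e)

theorem x_mul_seqE (l : Fin m) (i : Fin m → kˣ) : X[l] * E i = E i * X[l] := by
  by_cases hi : i ∈ vvSeq ν m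
  · rw [seqE_of_mem hi]
    exact eq_of_rel (.klr _ _ (.x_e l _))
  · rw [seqE_of_notMem hi, mul_zero, zero_mul]

theorem cross_mul_seqE (g : ℕ) (hg : g < m) (i : Fin m → kˣ) :
    T g hg * E i = E (reflect g hg i) * T g hg := by
  by_cases hi : i ∈ vvSeq ν m
  · rw [seqE_of_mem hi, seqE_of_mem (reflect_mem_vvSeq g hg hi)]
    cases g with
    | zero => exact eq_of_rel (.pi_e hg ⟨i, hi⟩ _ rfl)
    | succ a => exact eq_of_rel (.klr _ _ (.s_e a hg ⟨i, hi⟩ _ rfl))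
  · have hi' : reflect g hg i ∉ vvSeq ν m := fun h =>
      hi (reflect_reflect g hg i ▸ reflect_mem_vvSeq g hg h)
    rw [seqE_of_notMem hi, seqE_of_notMem hi', mul_zero, zero_mul]

theorem cross_succ_comm {a b : ℕ} (ha : a + 1 < m) (hb : b + 1 < m) (h₁ : a ≠ b + 1)
    (h₂ : b ≠ a + 1) : T (a + 1) ha * T (b + 1) hb = T (b + 1) hb * T (a + 1) ha :=
  eq_of_rel (.klr _ _ (.s_comm a b ha hb h₁ h₂))

theorem cross_zero_comm {a : ℕ} (ha : a + 1 < m) (h : a ≠ 0) :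
    T 0 (by omega) * T (a + 1) ha = T (a + 1) ha * T 0 (by omega) :=
  eq_of_rel (.pi_s a ha h)

theorem cross_zero_x_zero (h : 0 < m) : T 0 h * X[⟨0, h⟩] = - (X[⟨0, h⟩] * T 0 h) := by
  exact (eq_of_rel (.pi_x_zero h)).trans (neg_mul (α := VVAlgebra p q ν m) _ _)

theorem cross_zero_x (h : 0 < m) (l : Fin m) (hl : 0 < l.1) : T 0 h * X[l] = X[l] * T 0 h :=
  eq_of_rel (.pi_x h l hl)

theorem cross_succ_x {a : ℕ} (h : a + 1 < m) (l : Fin m) {i : Fin m → kˣ}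
    (hi : isNeg p lam (i ⟨a, by omega⟩) ≠ isNeg p lam (i ⟨a + 1, h⟩)) :
    T (a + 1) h * X[l] * E i = X[adjSwap a h l] * T (a + 1) h * E i := by
  refine mul_seqE_congr fun hi' => ?_
  rw [← sub_eq_zero, ← sub_mul]
  exact eq_of_rel (.klr _ _ (.s_x_else a h l ⟨i, hi'⟩ (Or.inl fun h1 => hi (congrArg _ h1))))

/-- Vertices of opposite sign are distinct and not joined by an arrow, so the square is the trivial
one. -/
theorem cross_succ_sq {a : ℕ} (h : a + 1 < m) {i : Fin m → kˣ}
    (hi : isNeg p lam (i ⟨a, by omega⟩) ≠ isNeg p lam (i ⟨a + 1, h⟩)) :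
    T (a + 1) h * T (a + 1) h * E i = E i := by
  rw [← one_mul (E i), ← mul_assoc, mul_one]
  refine mul_seqE_congr fun hi' => ?_
  rw [one_mul]
  exact eq_of_rel (.klr _ _ (.s_sq_none a h ⟨i, hi'⟩ (fun h1 => hi (congrArg _ h1))
    (fun h1 => hi h1.isNeg_eq) (fun h1 => hi h1.isNeg_eq.symm)))

/-- A correction term requires equal outer entries, which opposite signs exclude. -/
theorem cross_braid {a : ℕ} (h : a + 2 < m) {i : Fin m → kˣ}
    (hi : isNeg p lam (i ⟨a, by omega⟩) ≠ isNeg p lam (i ⟨a + 2, h⟩)) :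
    T (a + 2) h * T (a + 1) (by omega) * T (a + 2) h * E i =
      T (a + 1) (by omega) * T (a + 2) h * T (a + 1) (by omega) * E i := by
  refine mul_seqE_congr fun hi' => ?_
  rw [← sub_eq_zero, ← sub_mul]
  exact eq_of_rel (.klr _ _ (.braid_zero a h ⟨i, hi'⟩ (Or.inl fun h1 => hi (congrArg _ h1))))

end VVAlgebra

namespace Admissible

open VVAlgebra

variable {k : Type u} [Field k] {p q lam : kˣ} {ν ν' : kˣ →₀ ℕ} {m : ℕ}
  (H : Admissible p q lam ν ν')
include H

local notation "E" => seqE p q ν m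
local notation "T" => cross p q ν m
local notation "X[" l "]" => gen p q ν m (VVGen.x l)

theorem ne_q {i : Fin m → kˣ} (hi : i ∈ vvSeq ν m) (a : Fin m) : i a ≠ q :=
  fun h => H.q_notMem (h ▸ H.mem_orbit_of_mem_vvSeq hi a)

theorem ne_q_inv {i : Fin m → kˣ} (hi : i ∈ vvSeq ν m) (a : Fin m) : i a ≠ q⁻¹ := by
  intro h
  have h1 := inv_mem_orbit (H.mem_orbit_of_mem_vvSeq hi a)
  rw [h, inv_inv] at h1
  exact H.q_notMem h1

/-- Neither `q` nor `q⁻¹` is a vertex, so of the three cases for `π²` only the last occurs. The same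
reason removes the error term in `cross_braid_zero`. -/
theorem cross_zero_sq (h : 0 < m) (i : Fin m → kˣ) : T 0 h * T 0 h * E i = E i := by
  rw [← one_mul (E i), ← mul_assoc, mul_one]
  refine mul_seqE_congr fun hi => ?_
  rw [one_mul]
  exact eq_of_rel (.pi_sq_else h ⟨i, hi⟩ (H.ne_q hi _) (H.ne_q_inv hi _))

theorem cross_braid_zero (h : 1 < m) (i : Fin m → kˣ) :
    T 1 h * T 0 (by omega) * T 1 h * T 0 (by omega) * E i =
      T 0 (by omega) * T 1 h * T 0 (by omega) * T 1 h * E i := by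
  refine mul_seqE_congr fun hi => ?_
  have h1 := eq_of_rel (VVRel.braid_zero (p := p) (q := q)
    (x := fun l => X[l]) (s := fun a h => gen p q ν m (.s a h)) (e := fun i => gen p q ν m (.e i))
    (pi := fun h => gen p q ν m (.pi h)) h ⟨i, hi⟩
    (Or.inr ⟨H.ne_q hi _, H.ne_q_inv hi _⟩))
  rw [sub_eq_zero] at h1
  simpa [cross, pow_two, mul_assoc] using h1

/-- Together with `cross_sq_reflect`, this says that the generator of a descent gives mutually
inverse maps between `e(i)` and the idempotent of the reflected sequence. -/
theorem cross_sq {g : ℕ} {hg : g < m} {i : Fin m → kˣ} (h : IsDescent p lam g hg i) :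
    T g hg * T g hg * E i = E i := by
  cases g with
  | zero => exact H.cross_zero_sq hg i
  | succ a =>
    refine cross_succ_sq (lam := lam) hg ?_
    rw [h.1, h.2]
    simp

theorem cross_sq_reflect {g : ℕ} {hg : g < m} {i : Fin m → kˣ} (h : IsDescent p lam g hg i) :
    T g hg * T g hg * E (reflect g hg i) = E (reflect g hg i) := by
  cases g with
  | zero => exact H.cross_zero_sq hg _
  | succ a =>
    refine cross_succ_sq (lam := lam) hg ?_
    simp [reflect_succ_apply, h.1, h.2]

end Admissible

/-! ### The homomorphism from the KLR algebra to the corner, and fullness -/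

section Restriction

variable {k : Type u} [Field k] {A : Type v} [Ring A]

/-- Apart from `∑ e(i) = 1`, the relations for a set of sequences are among those for a larger
set. -/
theorem KLRRel.of_inclusion {p : kˣ} {m : ℕ} {S S' : Set (Fin m → kˣ)} [Fintype S] [Fintype S']
    (hS : S ⊆ S') {x : Fin m → A} {s : (a : ℕ) → a + 1 < m → A} {e : S' → A} {a b : A}
    (h : KLRRel p S x s (fun i => e (Set.inclusion hS i)) a b) :
    KLRRel p S' x s e a b ∨ a = ∑ i, e (Set.inclusion hS i) ∧ b = 1 := by
  cases h with
  | e_mul_self i => exact Or.inl (.e_mul_self (Set.inclusion hS i))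
  | e_mul_ne i j hij => exact Or.inl (.e_mul_ne (Set.inclusion hS i) (Set.inclusion hS j) (fun h => hij (Set.inclusion_injective hS h)))
  | sum_e => exact Or.inr ⟨rfl, rfl⟩
  | s_e a h i j hj => exact Or.inl (.s_e a h (Set.inclusion hS i) (Set.inclusion hS j) hj)
  | x_e l i => exact Or.inl (.x_e l (Set.inclusion hS i))
  | x_comm l l' => exact Or.inl (.x_comm l l')
  | s_sq_none a h i hne h₁ h₂ => exact Or.inl (.s_sq_none a h (Set.inclusion hS i) hne h₁ h₂)
  | s_sq_left a h i hne h₁ h₂ => exact Or.inl (.s_sq_left a h (Set.inclusion hS i) hne h₁ h₂)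
  | s_sq_right a h i hne h₁ h₂ => exact Or.inl (.s_sq_right a h (Set.inclusion hS i) hne h₁ h₂)
  | s_sq_both a h i hne h₁ h₂ => exact Or.inl (.s_sq_both a h (Set.inclusion hS i) hne h₁ h₂)
  | s_sq_eq a h i heq => exact Or.inl (.s_sq_eq a h (Set.inclusion hS i) heq)
  | s_comm a b ha hb h₁ h₂ => exact Or.inl (.s_comm a b ha hb h₁ h₂)
  | braid_zero a h i hc => exact Or.inl (.braid_zero a h (Set.inclusion hS i) hc)
  | braid_right a h i heq h₁ h₂ => exact Or.inl (.braid_right a h (Set.inclusion hS i) heq h₁ h₂)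
  | braid_left a h i heq h₁ h₂ => exact Or.inl (.braid_left a h (Set.inclusion hS i) heq h₁ h₂)
  | braid_both a h i heq h₁ h₂ => exact Or.inl (.braid_both a h (Set.inclusion hS i) heq h₁ h₂)
  | s_x_left a h i heq => exact Or.inl (.s_x_left a h (Set.inclusion hS i) heq)
  | s_x_right a h i heq => exact Or.inl (.s_x_right a h (Set.inclusion hS i) heq)
  | s_x_else a h l i hc => exact Or.inl (.s_x_else a h l (Set.inclusion hS i) hc)

/-- The homomorphism `c ↦ ce` to `eAe` from the centralizer of `e`. -/
def centralizerToCorner {e : A} (he : IsIdempotentElem e) :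
    Subring.centralizer {e} →+* he.Corner where
  toFun c := ⟨c.1 * e, (Subsemigroup.mem_corner_iff he).2
    ⟨by rw [← mul_assoc, Subring.mem_centralizer_iff.1 c.2 e rfl, mul_assoc, he.eq],
      by rw [mul_assoc, he.eq]⟩⟩
  map_one' := Subtype.ext (one_mul e)
  map_mul' c d := Subtype.ext <| by
    change c.1 * d.1 * e = c.1 * e * (d.1 * e)
    rw [mul_assoc c.1 e, ← mul_assoc e, Subring.mem_centralizer_iff.1 d.2 e rfl, mul_assoc d.1,
      he.eq, mul_assoc]
  map_zero' := Subtype.ext (zero_mul e)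
  map_add' c d := Subtype.ext (add_mul c.1 d.1 e)

end Restriction

namespace Admissible

open VVAlgebra

variable {k : Type u} [Field k] {p q lam : kˣ} {ν ν' : kˣ →₀ ℕ} {m : ℕ}

local notation "E" => seqE p q ν m
local notation "T" => cross p q ν m
local notation "X[" l "]" => gen p q ν m (VVGen.x l)
local notation "e₀" => seqIdem p q ν ν' m

theorem _root_.VV.VVAlgebra.ext_mul_seqE {a b : VVAlgebra p q ν m}
    (h : ∀ i ∈ vvSeq ν m, a * E i = b * E i) : a = b := by
  rw [← mul_one a, ← mul_one b, ← sum_seqE, Finset.mul_sum, Finset.mul_sum]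
  exact Finset.sum_congr rfl fun i _ => h i.1 i.2

open Classical in
theorem _root_.VV.VVAlgebra.seqIdem_eq : e₀ = ∑ i : vvSeq ν m with i.1 ∈ klrSeq ν' m, E i.1 :=
  Finset.sum_congr rfl fun i _ => (seqE_of_mem i.2).symm

theorem _root_.VV.VVAlgebra.seqIdem_mul_seqE_of_notMem {i : Fin m → kˣ} (hi : i ∉ klrSeq ν' m) :
    e₀ * E i = 0 := by
  classical
  rw [seqIdem_eq, Finset.sum_mul]
  refine Finset.sum_eq_zero fun j hj => seqE_mul_ne ?_
  rintro rfl
  exact hi (Finset.mem_filter.1 hj).2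

variable (H : Admissible p q lam ν ν')
include H

theorem seqIdem_mul_seqE {i : Fin m → kˣ} (hi : i ∈ klrSeq ν' m) : e₀ * E i = E i := by
  classical
  rw [seqIdem_eq, Finset.sum_mul, Finset.sum_eq_single ⟨i, H.mem_vvSeq hi⟩]
  · exact seqE_mul_self i
  · exact fun j _ hj => seqE_mul_ne fun h => hj (Subtype.ext h)
  · exact fun h => (h (by simpa using hi)).elim

theorem seqE_mul_seqIdem {i : Fin m → kˣ} (hi : i ∈ klrSeq ν' m) : E i * e₀ = E i := by
  classical
  rw [seqIdem_eq, Finset.mul_sum, Finset.sum_eq_single ⟨i, H.mem_vvSeq hi⟩]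
  · exact seqE_mul_self i
  · exact fun j _ hj => seqE_mul_ne fun h => hj (Subtype.ext h.symm)
  · exact fun h => (h (by simpa using hi)).elim

theorem seqIdem_comm_x (l : Fin m) : e₀ * X[l] = X[l] * e₀ := by
  refine ext_mul_seqE fun i _ => ?_
  rw [mul_assoc, mul_assoc, x_mul_seqE]
  by_cases hi : i ∈ klrSeq ν' m
  · rw [H.seqIdem_mul_seqE hi, x_mul_seqE, ← mul_assoc, H.seqIdem_mul_seqE hi]
  · rw [seqIdem_mul_seqE_of_notMem hi, mul_zero, ← mul_assoc, seqIdem_mul_seqE_of_notMem hi,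
      zero_mul]

/-- Permuting entries preserves `I^ν'`. Inverting the first entry does not, so the index starts at
`1` and `π` is left out. -/
theorem seqIdem_comm_cross {a : ℕ} (h : a + 1 < m) : e₀ * T (a + 1) h = T (a + 1) h * e₀ := by
  refine ext_mul_seqE fun i _ => ?_
  rw [mul_assoc, mul_assoc, cross_mul_seqE]
  by_cases hi : i ∈ klrSeq ν' m
  · rw [H.seqIdem_mul_seqE hi, cross_mul_seqE, ← mul_assoc,
      H.seqIdem_mul_seqE (i := reflect (a + 1) h i) (comp_mem_klrSeq hi (adjSwap a h))]
  · have hi' : reflect (a + 1) h i ∉ klrSeq ν' m := fun h1 =>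
      hi (reflect_reflect (a + 1) h i ▸ comp_mem_klrSeq h1 (adjSwap a h))
    rw [seqIdem_mul_seqE_of_notMem hi, mul_zero, ← mul_assoc, seqIdem_mul_seqE_of_notMem hi',
      zero_mul]

theorem seqIdem_comm_e {i : Fin m → kˣ} (hi : i ∈ klrSeq ν' m) : e₀ * E i = E i * e₀ := by
  rw [H.seqIdem_mul_seqE hi, H.seqE_mul_seqIdem hi]

/-- The relations are lifted to the centralizer of `e₀`, where they are relations of the VV algebra,
and then multiplied by `e₀`. Only `∑ e(i) = 1` is not inherited this way; in the corner it becomes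
`e₀ e₀ = e₀`. -/
theorem klrRel_corner (a b : (isIdempotentElem_seqIdem p q ν ν' m).Corner)
    (h : KLRRel p (klrSeq ν' m)
      (fun l => centralizerToCorner (isIdempotentElem_seqIdem p q ν ν' m)
        ⟨X[l], by simpa [Subring.mem_centralizer_iff] using H.seqIdem_comm_x l⟩)
      (fun a h => centralizerToCorner (isIdempotentElem_seqIdem p q ν ν' m)
        ⟨T (a + 1) h, by simpa [Subring.mem_centralizer_iff] using H.seqIdem_comm_cross h⟩)
      (fun i => centralizerToCorner (isIdempotentElem_seqIdem p q ν ν' m)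
        ⟨E i.1, by simpa [Subring.mem_centralizer_iff] using H.seqIdem_comm_e i.2⟩) a b) :
    a = b := by
  obtain ⟨a, b, h', rfl, rfl⟩ := KLRRel.exists_of_map (p := p)
    (A := Subring.centralizer {e₀}) (B := (isIdempotentElem_seqIdem p q ν ν' m).Corner)
    (x := fun l => (⟨X[l], by simpa [Subring.mem_centralizer_iff] using H.seqIdem_comm_x l⟩ :
      Subring.centralizer {e₀}))
    (s := fun a h => ⟨T (a + 1) h,
      by simpa [Subring.mem_centralizer_iff] using H.seqIdem_comm_cross h⟩)
    (e := fun i => ⟨E i.1, by simpa [Subring.mem_centralizer_iff] using H.seqIdem_comm_e i.2⟩)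
    (centralizerToCorner (isIdempotentElem_seqIdem p q ν ν' m)) h
  have hS : klrSeq ν' m ⊆ vvSeq ν m := fun _ => H.mem_vvSeq
  have h1 := h'.map (Subring.subtype _)
  have h2 : KLRRel p (klrSeq ν' m) (fun l => X[l]) (fun a h => gen p q ν m (.s a h))
      (fun i => gen p q ν m (.e (Set.inclusion hS i))) a.1 b.1 := by
    have hE : (fun i : klrSeq ν' m => gen p q ν m (.e (Set.inclusion hS i))) = fun i => E i.1 :=
      funext fun i => (seqE_of_mem (hS i.2)).symm
    rw [hE]
    exact h1
  refine Subtype.ext ?_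
  change a.1 * e₀ = b.1 * e₀
  rcases h2.of_inclusion hS (e := fun i : vvSeq ν m => gen p q ν m (.e i)) with h3 | ⟨h3, h4⟩
  · exact congrArg (· * e₀) (eq_of_rel (p := p) (q := q) (ν := ν) (m := m) (.klr _ _ h3))
  · rw [h3, h4, one_mul]
    refine Eq.trans (congrArg (· * e₀) ?_) (isIdempotentElem_seqIdem p q ν ν' m).eq
    classical
    unfold seqIdem
    refine Finset.sum_bij (fun i _ => Set.inclusion hS i)
      (fun i _ => Finset.mem_filter.2 ⟨Finset.mem_univ _, i.2⟩)
      (fun i _ j _ hij => Set.inclusion_injective _ hij)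
      (fun j hj => ⟨⟨j.1, (Finset.mem_filter.1 hj).2⟩, Finset.mem_univ _, rfl⟩) fun i _ => rfl

/-- The homomorphism from the KLR algebra to the corner. -/
noncomputable def toCorner :
    KLRAlgebra p ν' m →ₐ[k] (isIdempotentElem_seqIdem p q ν ν' m).Corner :=
  KLRAlgebra.lift _ _ _ H.klrRel_corner

theorem toCorner_x (l : Fin m) :
    (H.toCorner (KLRAlgebra.gen p ν' m (.x l))).1 = X[l] * e₀ :=
  congrArg Subtype.val (KLRAlgebra.lift_x H.klrRel_corner l)

theorem toCorner_s (a : ℕ) (h : a + 1 < m) :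
    (H.toCorner (KLRAlgebra.gen p ν' m (.s a h))).1 = T (a + 1) h * e₀ :=
  congrArg Subtype.val (KLRAlgebra.lift_s H.klrRel_corner a h)

theorem toCorner_e (i : klrSeq ν' m) :
    (H.toCorner (KLRAlgebra.gen p ν' m (.e i))).1 = E i.1 :=
  (congrArg Subtype.val (KLRAlgebra.lift_e H.klrRel_corner i)).trans (H.seqE_mul_seqIdem i.2)

/-- Along a descent with generator `T` to `i'` one has `e(i) = T T e(i) = T e(i') T`, so membership
propagates from positive sequences. -/
theorem seqE_mem_span (i : Fin m → kˣ) (hi : i ∈ vvSeq ν m) :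
    E i ∈ TwoSidedIdeal.span {e₀} := by
  refine H.descent_induction (C := fun i => E i ∈ TwoSidedIdeal.span {e₀})
    (fun i hi => ?_) (fun i hi g hg hd h => ?_) i hi
  · rw [← H.seqE_mul_seqIdem hi]
    exact TwoSidedIdeal.mul_mem_left _ _ _ (TwoSidedIdeal.subset_span rfl)
  · rw [← H.cross_sq hd, mul_assoc, cross_mul_seqE]
    exact TwoSidedIdeal.mul_mem_left _ _ _ (TwoSidedIdeal.mul_mem_right _ _ _ h)

theorem span_seqIdem : TwoSidedIdeal.span {e₀} = ⊤ := by
  rw [← TwoSidedIdeal.one_mem_iff, ← sum_seqE]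
  exact sum_mem fun i _ => H.seqE_mem_span i.1 i.2

end Admissible

theorem mul_mul_eq_neg {A : Type u} [Ring A] {x t y r : A} (h : t * x = -(x * t))
    (hr : x * y = y * r) : x * (t * y) = t * y * -r := by
  rw [mul_neg, mul_assoc, ← hr, ← mul_assoc, ← mul_assoc, h, neg_mul, neg_neg]

/-! ### Braid relations on sequences and commutation of descents -/

section Reflections

variable {k : Type u} [Field k] {p q lam : kˣ} {ν ν' : kˣ →₀ ℕ} {m : ℕ}

theorem reflect_zero_comm {b : ℕ} (h : b + 1 < m) (hb : b ≠ 0) (i : Fin m → kˣ) :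
    reflect 0 (by omega) (reflect (b + 1) h i) = reflect (b + 1) h (reflect 0 (by omega) i) := by
  funext ⟨c, hc⟩
  simp only [reflect_succ_apply, reflect_zero_apply]
  split_ifs <;> first | rfl | omega | (subst_vars; first | rfl | simp_all)

theorem reflect_succ_comm {a b : ℕ} (ha : a + 1 < m) (hb : b + 1 < m) (h₁ : a ≠ b + 1)
    (h₂ : b ≠ a + 1) (i : Fin m → kˣ) :
    reflect (a + 1) ha (reflect (b + 1) hb i) = reflect (b + 1) hb (reflect (a + 1) ha i) := by
  funext ⟨c, hc⟩
  simp only [reflect_succ_apply]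
  split_ifs <;> first | rfl | omega | (subst_vars; rfl)

theorem reflect_braid {a : ℕ} (h : a + 2 < m) (i : Fin m → kˣ) :
    reflect (a + 2) h (reflect (a + 1) (by omega) (reflect (a + 2) h i)) =
      reflect (a + 1) (by omega) (reflect (a + 2) h (reflect (a + 1) (by omega) i)) := by
  funext ⟨c, hc⟩
  simp only [reflect_succ_apply]
  split_ifs <;> first | rfl | omega

theorem reflect_braid_zero (h : 1 < m) (i : Fin m → kˣ) :
    reflect 1 h (reflect 0 (by omega) (reflect 1 h (reflect 0 (by omega) i))) =
      reflect 0 (by omega) (reflect 1 h (reflect 0 (by omega) (reflect 1 h i))) := by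
  funext ⟨c, hc⟩
  simp only [reflect_succ_apply, reflect_zero_apply]
  split_ifs <;> first | rfl | omega | (subst_vars; first | rfl | simp_all)

theorem Admissible.isNeg_reflect_zero_apply (H : Admissible p q lam ν ν') {i : Fin m → kˣ}
    (hi : i ∈ vvSeq ν m) (hm : 0 < m) (b : ℕ) (hb : b < m) :
    isNeg p lam (reflect 0 hm i ⟨b, hb⟩) =
      if b = 0 then !isNeg p lam (i ⟨0, hm⟩) else isNeg p lam (i ⟨b, hb⟩) := by
  rw [reflect_zero_apply, apply_ite (isNeg p lam), H.isNeg_inv (H.mem_orbit_of_mem_vvSeq hi _)]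

theorem isNeg_reflect_succ_apply {a : ℕ} (h : a + 1 < m) (i : Fin m → kˣ) (b : ℕ) (hb : b < m) :
    isNeg p lam (reflect (a + 1) h i ⟨b, hb⟩) =
      if b = a then isNeg p lam (i ⟨a + 1, h⟩) else
        if b = a + 1 then isNeg p lam (i ⟨a, by omega⟩) else isNeg p lam (i ⟨b, hb⟩) := by
  rw [reflect_succ_apply, apply_ite (isNeg p lam), apply_ite (isNeg p lam)]

/-- Neighbouring generators would require a common entry to be both positive and negative, so
distinct descents are never neighbours in the diagram of type `B`. -/
theorem VVAlgebra.cross_comm_of_isDescent {g h : ℕ} {hg : g < m} {hh : h < m} {i : Fin m → kˣ}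
    (h₁ : IsDescent p lam g hg i) (h₂ : IsDescent p lam h hh i) (hgh : g ≠ h) :
    cross p q ν m g hg * cross p q ν m h hh = cross p q ν m h hh * cross p q ν m g hg := by
  cases g with
  | zero =>
    cases h with
    | zero => exact absurd rfl hgh
    | succ b =>
      refine cross_zero_comm hh ?_
      rintro rfl
      simp_all [IsDescent]
  | succ a =>
    cases h with
    | zero =>
      refine (cross_zero_comm hg ?_).symm
      rintro rfl
      simp_all [IsDescent]
    | succ b =>
      refine cross_succ_comm hg hh ?_ ?_ <;>
      · rintro rfl
        simp_all [IsDescent]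

theorem reflect_comm_of_isDescent {g h : ℕ} {hg : g < m} {hh : h < m} {i : Fin m → kˣ}
    (h₁ : IsDescent p lam g hg i) (h₂ : IsDescent p lam h hh i) (hgh : g ≠ h) :
    reflect g hg (reflect h hh i) = reflect h hh (reflect g hg i) := by
  cases g with
  | zero =>
    cases h with
    | zero => exact absurd rfl hgh
    | succ b =>
      refine reflect_zero_comm hh ?_ i
      rintro rfl
      simp_all [IsDescent]
  | succ a =>
    cases h with
    | zero =>
      refine (reflect_zero_comm hg ?_ i).symm
      rintro rfl
      simp_all [IsDescent]
    | succ b =>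
      refine reflect_succ_comm hg hh ?_ ?_ i <;>
      · rintro rfl
        simp_all [IsDescent]

/-- Distinct descents involve disjoint sets of positions, so performing one leaves the other
available. -/
theorem Admissible.isDescent_reflect (H : Admissible p q lam ν ν') {g h : ℕ} {hg : g < m}
    {hh : h < m} {i : Fin m → kˣ} (hi : i ∈ vvSeq ν m)
    (h₁ : IsDescent p lam g hg i) (h₂ : IsDescent p lam h hh i) (hgh : g ≠ h) :
    IsDescent p lam g hg (reflect h hh i) := by
  cases g with
  | zero =>
    cases h with
    | zero => exact absurd rfl hgh
    | succ b =>
      have : b ≠ 0 := by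
        rintro rfl
        simp_all [IsDescent]
      simp only [IsDescent, isNeg_reflect_succ_apply] at h₁ h₂ ⊢
      rw [if_neg (by omega), if_neg (by omega)]
      exact h₁
  | succ a =>
    cases h with
    | zero =>
      have : a ≠ 0 := by
        rintro rfl
        simp_all [IsDescent]
      simp only [IsDescent, H.isNeg_reflect_zero_apply hi] at h₁ h₂ ⊢
      rw [if_neg (by omega), if_neg (by omega)]
      exact h₁
    | succ b =>
      have : a ≠ b + 1 := by
        rintro rfl
        simp_all [IsDescent]
      have : b ≠ a + 1 := by
        rintro rfl
        simp_all [IsDescent]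
      simp only [IsDescent, isNeg_reflect_succ_apply] at h₁ h₂ ⊢
      rw [if_neg (by omega), if_neg (by omega), if_neg (by omega), if_neg (by omega)]
      exact h₁

end Reflections

/-! ### Paths and surjectivity onto the corner -/

namespace Admissible

open VVAlgebra

variable {k : Type u} [Field k] {p q lam : kˣ} {ν ν' : kˣ →₀ ℕ} {m : ℕ}

local notation "E" => seqE p q ν m
local notation "T" => cross p q ν m
local notation "X[" l "]" => gen p q ν m (VVGen.x l)
local notation "e₀" => seqIdem p q ν ν' m

/-- The elements of `e(i) 𝔚_ν e` obtained from the idempotents `e(j)`, `j ∈ I^ν'`, by undoing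
descents. -/
inductive _root_.VV.IsPath (p q lam : kˣ) (ν ν' : kˣ →₀ ℕ) (m : ℕ) :
    (Fin m → kˣ) → VVAlgebra p q ν m → Prop
  | base (i : Fin m → kˣ) (hi : i ∈ klrSeq ν' m) : IsPath p q lam ν ν' m i (seqE p q ν m i)
  | step (i : Fin m → kˣ) (hi : i ∈ vvSeq ν m) (g : ℕ) (hg : g < m) (hd : IsDescent p lam g hg i)
      (u : VVAlgebra p q ν m) (hu : IsPath p q lam ν ν' m (reflect g hg i) u) :
      IsPath p q lam ν ν' m i (cross p q ν m g hg * u)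

local notation "Path" => IsPath p q lam ν ν' m

variable (H : Admissible p q lam ν ν')
include H

theorem not_isDescent {i : Fin m → kˣ} (hi : i ∈ klrSeq ν' m) {g : ℕ} {hg : g < m} :
    ¬ IsDescent p lam g hg i := by
  have h1 := (H.mem_klrSeq_iff.1 hi).2
  cases g <;> simp [IsDescent, h1]

theorem mem_vvSeq_of_path {i : Fin m → kˣ} {u : VVAlgebra p q ν m} (h : Path i u) :
    i ∈ vvSeq ν m := by
  cases h with
  | base i hi => exact H.mem_vvSeq hi
  | step i hi g hg hd u hu => exact hi

omit H in
theorem _root_.VV.IsPath.seqE_mul {i : Fin m → kˣ} {u : VVAlgebra p q ν m} (h : Path i u) :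
    E i * u = u := by
  induction h with
  | base i hi => exact seqE_mul_self i
  | step i hi g hg hd u hu ih =>
    rw [← mul_assoc, ← reflect_reflect g hg i, ← cross_mul_seqE, mul_assoc, ih]

omit H in
theorem _root_.VV.IsPath.mul_congr {i : Fin m → kˣ} {u a b : VVAlgebra p q ν m} (h : Path i u)
    (hab : a * E i = b * E i) : a * u = b * u := by
  rw [← h.seqE_mul, ← mul_assoc, hab, mul_assoc]

/-- A path may start with any descent. -/
theorem exists_path_of_isDescent {i : Fin m → kˣ} {u : VVAlgebra p q ν m} (h : Path i u)
    {g : ℕ} {hg : g < m} (hd : IsDescent p lam g hg i) :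
    ∃ u', Path (reflect g hg i) u' ∧ u = T g hg * u' := by
  induction h with
  | base i hi => exact absurd hd (H.not_isDescent hi)
  | step i hi h hh hd' u hu ih =>
    by_cases hgh : g = h
    · subst hgh
      exact ⟨u, hu, rfl⟩
    -- Diamond argument: `g` is still a descent after `h`, so by induction the rest of the path may
    -- begin with `g`, and the two commuting generators are exchanged.
    · obtain ⟨u', hu', rfl⟩ := ih (H.isDescent_reflect hi hd hd' hgh)
      refine ⟨T h hh * u', .step _ (reflect_mem_vvSeq g hg hi) h hh
        (H.isDescent_reflect hi hd' hd (Ne.symm hgh)) u' ?_, ?_⟩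
      · rwa [reflect_comm_of_isDescent hd' hd (Ne.symm hgh)]
      · rw [← mul_assoc, ← mul_assoc, cross_comm_of_isDescent hd hd' hgh]

/-- Every crossing of a path involves opposite signs or is `π`, so `x_l` passes with at most a
change of index or sign. At the positive end it becomes the image of a KLR generator. -/
theorem exists_x_mul_path {i : Fin m → kˣ} {u : VVAlgebra p q ν m} (h : Path i u) (l : Fin m) :
    ∃ r, X[l] * u = u * (H.toCorner r).1 := by
  induction h generalizing l with
  | base i hi =>
    refine ⟨KLRAlgebra.gen p ν' m (.x l), ?_⟩
    rw [H.toCorner_x, x_mul_seqE, ← H.seqIdem_comm_x, ← mul_assoc, H.seqE_mul_seqIdem hi]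
  | step i hi g hg hd u hu ih =>
    cases g with
    | zero =>
      by_cases hl : 0 < l.1
      · obtain ⟨r, hr⟩ := ih l
        exact ⟨r, by rw [← mul_assoc, ← cross_zero_x hg l hl, mul_assoc, hr, mul_assoc]⟩
      · obtain rfl : l = ⟨0, hg⟩ := Fin.ext (by simpa using hl)
        obtain ⟨r, hr⟩ := ih ⟨0, hg⟩
        refine ⟨-r, ?_⟩
        have h1 : (H.toCorner (-r)).1 = -(H.toCorner r).1 := by
          rw [map_neg]
          rfl
        rw [h1]
        exact mul_mul_eq_neg (A := VVAlgebra p q ν m) (cross_zero_x_zero hg) hr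
    | succ a =>
      obtain ⟨r, hr⟩ := ih (adjSwap a hg l)
      refine ⟨r, ?_⟩
      have h1 : T (a + 1) hg * X[adjSwap a hg l] * u = X[l] * T (a + 1) hg * u := by
        refine hu.mul_congr ?_
        rw [cross_succ_x (lam := lam), Equiv.swap_apply_self]
        simp [isNeg_reflect_succ_apply, hd.1, hd.2]
      rw [← mul_assoc, ← h1, mul_assoc, hr, mul_assoc]

end Admissible

namespace Admissible

open VVAlgebra

variable {k : Type u} [Field k] {p q lam : kˣ} {ν ν' : kˣ →₀ ℕ} {m : ℕ}

local notation "E" => seqE p q ν m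
local notation "T" => cross p q ν m
local notation "X[" l "]" => gen p q ν m (VVGen.x l)
local notation "e₀" => seqIdem p q ν ν' m
local notation "Path" => IsPath p q lam ν ν' m

variable (H : Admissible p q lam ν ν')
include H

/-- A generator that does not move a vertex of `I⁻` past one of `I⁺` passes through a path. -/
theorem exists_cross_mul_path_of_isNeg_eq {i : Fin m → kˣ} {u : VVAlgebra p q ν m} (h : Path i u)
    {a : ℕ} (ha : a + 1 < m) (heq : isNeg p lam (i ⟨a, by omega⟩) = isNeg p lam (i ⟨a + 1, ha⟩)) :
    ∃ u' r, Path (reflect (a + 1) ha i) u' ∧ T (a + 1) ha * u = u' * (H.toCorner r).1 := by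
  induction hn : inversions p lam i using Nat.strong_induction_on generalizing i u a with
  | _ n ih =>
    subst hn
    cases h with
    | base i hi =>
      refine ⟨_, KLRAlgebra.gen p ν' m (.s a ha),
        .base _ (comp_mem_klrSeq hi (adjSwap a ha)), ?_⟩
      rw [H.toCorner_s, ← mul_assoc, ← cross_mul_seqE, mul_assoc, H.seqE_mul_seqIdem hi]
    | step i hi g hg hd u hu =>
      have hlt := H.inversions_reflect_lt hi hd
      -- If the first descent of the path is far from positions `a`, `a + 1`, the generator commutes
      -- with it and the induction applies to the rest.
      have hcomm (h1 : T (a + 1) ha * T g hg = T g hg * T (a + 1) ha)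
          (h2 : reflect (a + 1) ha (reflect g hg i) = reflect g hg (reflect (a + 1) ha i))
          (h3 : isNeg p lam (reflect g hg i ⟨a, by omega⟩) =
            isNeg p lam (reflect g hg i ⟨a + 1, ha⟩))
          (h4 : IsDescent p lam g hg (reflect (a + 1) ha i)) :
          ∃ u' r, Path (reflect (a + 1) ha i) u' ∧
            T (a + 1) ha * (T g hg * u) = u' * (H.toCorner r).1 := by
        obtain ⟨u', r, hu', hr⟩ := ih _ hlt hu ha h3 rfl
        refine ⟨T g hg * u', r, .step _ (reflect_mem_vvSeq _ ha hi) g hg h4 u' (h2 ▸ hu'), ?_⟩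
        rw [← mul_assoc, h1, mul_assoc, hr, mul_assoc]
      cases g with
      | zero =>
        by_cases ha0 : a = 0
        · subst ha0
          -- The first two signs are `(-,-)`. The path may be taken to begin with `π σ π`, through
          -- the patterns `(+,-)`, `(-,+)`, `(+,+)`; the type `B` braid relation moves `σ` behind
          -- it.
          have hi1 := reflect_mem_vvSeq 0 hg hi
          have hi2 := reflect_mem_vvSeq (0 + 1) ha hi1
          simp only [IsDescent] at hd
          rw [hd] at heq
          have hd1 : IsDescent p lam (0 + 1) ha (reflect 0 hg i) := by
            simp [IsDescent, H.isNeg_reflect_zero_apply hi, hd, ← heq]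
          obtain ⟨u1, hu1, rfl⟩ := H.exists_path_of_isDescent hu hd1
          have hd2 : IsDescent p lam 0 hg (reflect (0 + 1) ha (reflect 0 hg i)) := by
            simp [IsDescent, isNeg_reflect_succ_apply, H.isNeg_reflect_zero_apply hi, ← heq]
          obtain ⟨u2, hu2, rfl⟩ := H.exists_path_of_isDescent hu1 hd2
          obtain ⟨u3, r, hu3, hr⟩ := ih _ ((H.inversions_reflect_lt hi2 hd2).trans
            ((H.inversions_reflect_lt hi1 hd1).trans hlt)) hu2 ha (by
              simp [H.isNeg_reflect_zero_apply hi2, isNeg_reflect_succ_apply,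
                H.isNeg_reflect_zero_apply hi, hd, ← heq]) rfl
          have hi3 := reflect_mem_vvSeq (0 + 1) ha hi
          have hi4 := reflect_mem_vvSeq 0 hg hi3
          refine ⟨T 0 hg * (T (0 + 1) ha * (T 0 hg * u3)), r, ?_, ?_⟩
          · refine .step _ hi3 0 hg ?_ _ (.step _ hi4 (0 + 1) ha ?_ _
              (.step _ (reflect_mem_vvSeq (0 + 1) ha hi4) 0 hg ?_ _ ?_))
            · simp [IsDescent, isNeg_reflect_succ_apply, ← heq]
            · simp [IsDescent, H.isNeg_reflect_zero_apply hi3, isNeg_reflect_succ_apply, hd, ← heq]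
            · simp [IsDescent, H.isNeg_reflect_zero_apply hi3, isNeg_reflect_succ_apply, hd]
            · have h1 := reflect_braid_zero ha i
              rw [← h1]
              exact hu3
          · have h1 := hu2.mul_congr (H.cross_braid_zero ha _)
            simp only [mul_assoc] at h1 ⊢
            rw [← hr]
            exact h1
        · refine hcomm (cross_zero_comm ha ha0).symm (reflect_zero_comm ha ha0 i).symm ?_ ?_
          · simp only [H.isNeg_reflect_zero_apply hi]
            rw [if_neg ha0, if_neg (by omega), heq]
          · simp only [IsDescent, isNeg_reflect_succ_apply]
            rw [if_neg (by omega), if_neg (by omega)]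
            exact hd
      | succ b =>
        have hs (c : ℕ) : ¬ c = c + 1 + 1 := by omega
        have hs' (c : ℕ) : ¬ c + 1 + 1 = c := by omega
        by_cases h1 : a = b + 1
        · subst h1
          -- The signs in positions `b`, `b + 1`, `b + 2` are `(+,-,-)`. The positive entry is
          -- carried to the right past both negative ones, and the braid relation has no correction
          -- since the outer signs differ.
          have hi1 := reflect_mem_vvSeq (b + 1) hg hi
          obtain ⟨hb0, hb1⟩ := hd
          rw [hb1] at heq
          have hd1 : IsDescent p lam (b + 1 + 1) ha (reflect (b + 1) hg i) := by
            simp [IsDescent, isNeg_reflect_succ_apply, hb0, ← heq, hs']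
          obtain ⟨u1, hu1, rfl⟩ := H.exists_path_of_isDescent hu hd1
          obtain ⟨u2, r, hu2, hr⟩ := ih _ ((H.inversions_reflect_lt hi1 hd1).trans hlt) hu1 hg (by
            simp [isNeg_reflect_succ_apply, hb1, ← heq, hs, hs']) rfl
          have hi2 := reflect_mem_vvSeq (b + 1 + 1) ha hi
          refine ⟨T (b + 1) hg * (T (b + 1 + 1) ha * u2), r, ?_, ?_⟩
          · refine .step _ hi2 (b + 1) hg ?_ _
              (.step _ (reflect_mem_vvSeq (b + 1) hg hi2) (b + 1 + 1) ha ?_ _ ?_)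
            · simp [IsDescent, isNeg_reflect_succ_apply, hb0, ← heq, hs]
            · simp [IsDescent, isNeg_reflect_succ_apply, hb0, hb1, hs, hs']
            · rw [reflect_braid ha i]
              exact hu2
          · have h1 := hu1.mul_congr (cross_braid (lam := lam) ha (by
              simp [isNeg_reflect_succ_apply, hb0, hb1, hs]))
            simp only [mul_assoc] at h1 ⊢
            rw [← hr]
            exact h1
        · by_cases h2 : b = a + 1
          · subst h2
            -- The mirror case: the signs in positions `a`, `a + 1`, `a + 2` are `(+,+,-)`, and the
            -- negative entry is carried to the left past both positive ones.
            have hi1 := reflect_mem_vvSeq (a + 1 + 1) hg hi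
            obtain ⟨hb0, hb1⟩ := hd
            rw [hb0] at heq
            have hd1 : IsDescent p lam (a + 1) ha (reflect (a + 1 + 1) hg i) := by
              simp [IsDescent, isNeg_reflect_succ_apply, hb1, heq, hs]
            obtain ⟨u1, hu1, rfl⟩ := H.exists_path_of_isDescent hu hd1
            obtain ⟨u2, r, hu2, hr⟩ := ih _ ((H.inversions_reflect_lt hi1 hd1).trans hlt) hu1 hg (by
              simp [isNeg_reflect_succ_apply, hb0, heq, hs, hs']) rfl
            have hi2 := reflect_mem_vvSeq (a + 1) ha hi
            refine ⟨T (a + 1 + 1) hg * (T (a + 1) ha * u2), r, ?_, ?_⟩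
            · refine .step _ hi2 (a + 1 + 1) hg ?_ _
                (.step _ (reflect_mem_vvSeq (a + 1 + 1) hg hi2) (a + 1) ha ?_ _ ?_)
              · simp [IsDescent, isNeg_reflect_succ_apply, heq, hb1, hs']
              · simp [IsDescent, isNeg_reflect_succ_apply, hb0, hb1, hs, hs']
              · rw [← reflect_braid hg i]
                exact hu2
            · have h1 := hu1.mul_congr (cross_braid (lam := lam) hg (by
                simp [isNeg_reflect_succ_apply, hb0, hb1, hs']))
              simp only [mul_assoc] at h1 ⊢
              rw [← hr]
              exact h1.symm
          · have h3 : a ≠ b := by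
              rintro rfl
              rw [hd.1, hd.2] at heq
              exact absurd heq (by simp)
            refine hcomm (cross_succ_comm ha hg h1 h2) (reflect_succ_comm ha hg h1 h2 i) ?_ ?_
            · simp only [isNeg_reflect_succ_apply]
              rw [if_neg h3, if_neg h1, if_neg (by omega), if_neg (by omega), heq]
            · simp only [IsDescent, isNeg_reflect_succ_apply]
              rw [if_neg (Ne.symm h3), if_neg h2, if_neg (by omega), if_neg (by omega)]
              exact hd

theorem path_mul_seqIdem {i : Fin m → kˣ} {u : VVAlgebra p q ν m} (h : Path i u) : u * e₀ = u := by
  induction h with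
  | base i hi => exact H.seqE_mul_seqIdem hi
  | step i hi g hg hd u hu ih => rw [mul_assoc, ih]

/-- There are three cases. A descent cancels against the first step of the path, the inverse of a
descent prolongs the path, and otherwise the two neighbouring signs agree and the generator passes
to the end. -/
theorem exists_cross_mul_path {i : Fin m → kˣ} {u : VVAlgebra p q ν m} (h : Path i u)
    (g : ℕ) (hg : g < m) :
    ∃ u' r, Path (reflect g hg i) u' ∧ T g hg * u = u' * (H.toCorner r).1 := by
  have hi := H.mem_vvSeq_of_path h
  have h1 (u' : VVAlgebra p q ν m) (hu' : Path (reflect g hg i) u') (he : T g hg * u = u') :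
      ∃ u' r, Path (reflect g hg i) u' ∧ T g hg * u = u' * (H.toCorner r).1 := by
    refine ⟨u', 1, hu', ?_⟩
    rw [map_one, he]
    exact (H.path_mul_seqIdem hu').symm
  by_cases hd : IsDescent p lam g hg i
  · obtain ⟨u', hu', rfl⟩ := H.exists_path_of_isDescent h hd
    refine h1 u' hu' ?_
    have h2 : T g hg * T g hg * E (reflect g hg i) = 1 * E (reflect g hg i) := by
      rw [one_mul]
      exact H.cross_sq_reflect hd
    rw [← mul_assoc, hu'.mul_congr h2, one_mul]
  · by_cases hd' : IsDescent p lam g hg (reflect g hg i)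
    · refine h1 _ (.step _ (reflect_mem_vvSeq g hg hi) g hg hd' u ?_) rfl
      rwa [reflect_reflect]
    · cases g with
      | zero =>
        -- Inverting the first entry changes its sign, so `π` is a descent for `i` or for its
        -- reflection.
        simp only [IsDescent, H.isNeg_reflect_zero_apply hi] at hd hd'
        simp_all
      | succ a =>
        refine H.exists_cross_mul_path_of_isNeg_eq h hg ?_
        simp only [IsDescent, isNeg_reflect_succ_apply] at hd hd'
        revert hd hd'
        cases isNeg p lam (i ⟨a, by omega⟩) <;> cases isNeg p lam (i ⟨a + 1, hg⟩) <;> simp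

/-- The span of the paths as a right module over the image of the KLR algebra. -/
def pathSpan : AddSubgroup (VVAlgebra p q ν m) :=
  AddSubgroup.closure {w | ∃ i u r, Path i u ∧ w = u * (H.toCorner r).1}

theorem mul_toCorner_mem_pathSpan {i : Fin m → kˣ} {u : VVAlgebra p q ν m} (h : Path i u)
    (r : KLRAlgebra p ν' m) : u * (H.toCorner r).1 ∈ H.pathSpan :=
  AddSubgroup.subset_closure ⟨i, u, r, h, rfl⟩

theorem mul_toCorner_mul_mem_pathSpan {i : Fin m → kˣ} {u : VVAlgebra p q ν m} (h : Path i u)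
    (r r' : KLRAlgebra p ν' m) : u * (H.toCorner r).1 * (H.toCorner r').1 ∈ H.pathSpan := by
  have h1 : (H.toCorner (r * r')).1 = (H.toCorner r).1 * (H.toCorner r').1 := by
    rw [map_mul]
    rfl
  rw [mul_assoc, ← h1]
  exact H.mul_toCorner_mem_pathSpan h _

theorem gen_mul_mem_pathSpan (g : VVGen (vvSeq ν m)) {i : Fin m → kˣ} {u : VVAlgebra p q ν m}
    (h : Path i u) (r : KLRAlgebra p ν' m) :
    gen p q ν m g * (u * (H.toCorner r).1) ∈ H.pathSpan := by
  have hcross (g : ℕ) (hg : g < m) : T g hg * (u * (H.toCorner r).1) ∈ H.pathSpan := by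
    obtain ⟨u', r', hu', hr'⟩ := H.exists_cross_mul_path h g hg
    rw [← mul_assoc, hr']
    exact H.mul_toCorner_mul_mem_pathSpan hu' r' r
  cases g with
  | x l =>
    obtain ⟨r', hr'⟩ := H.exists_x_mul_path h l
    rw [← mul_assoc, hr']
    exact H.mul_toCorner_mul_mem_pathSpan h r' r
  | s a ha => exact hcross (a + 1) ha
  | pi hm => exact hcross 0 hm
  | e j =>
    rw [← seqE_of_mem j.2, ← h.seqE_mul, ← mul_assoc, ← mul_assoc]
    by_cases hij : j.1 = i
    · rw [hij, seqE_mul_self, h.seqE_mul]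
      exact H.mul_toCorner_mem_pathSpan h r
    · rw [seqE_mul_ne hij, zero_mul, zero_mul]
      exact zero_mem _

/-- The span is a left ideal because this can be tested on generators of the algebra, where it is
`gen_mul_mem_pathSpan`. -/
theorem mul_mem_pathSpan (w : VVAlgebra p q ν m) {y : VVAlgebra p q ν m} (hy : y ∈ H.pathSpan) :
    w * y ∈ H.pathSpan := by
  have hw : w ∈ Algebra.adjoin k (Set.range (gen p q ν m)) := by
    rw [adjoin_range_gen]
    trivial
  induction hw using Algebra.adjoin_induction generalizing y with
  | mem w hw =>
    obtain ⟨g, rfl⟩ := hw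
    induction hy using AddSubgroup.closure_induction with
    | mem y hy =>
      obtain ⟨i, u, r, h, rfl⟩ := hy
      exact H.gen_mul_mem_pathSpan g h r
    | zero =>
      rw [mul_zero]
      exact zero_mem _
    | add y z _ _ hy hz =>
      rw [mul_add]
      exact add_mem hy hz
    | neg y _ hy =>
      rw [mul_neg (α := VVAlgebra p q ν m)]
      exact neg_mem hy
  -- `pathSpan` is only an additive subgroup by definition; scalars are absorbed into the KLR factor
  -- on the right.
  | algebraMap c =>
    induction hy using AddSubgroup.closure_induction with
    | mem y hy =>
      obtain ⟨i, u, r, h, rfl⟩ := hy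
      have h1 : (H.toCorner (c • r)).1 = c • (H.toCorner r).1 := by
        rw [map_smul]
        rfl
      rw [← Algebra.smul_def, ← mul_smul_comm, ← h1]
      exact H.mul_toCorner_mem_pathSpan h _
    | zero =>
      rw [mul_zero]
      exact zero_mem _
    | add y z _ _ hy hz =>
      rw [mul_add]
      exact add_mem hy hz
    | neg y _ hy =>
      rw [mul_neg (α := VVAlgebra p q ν m)]
      exact neg_mem hy
  | add w w' _ _ hw hw' =>
    rw [add_mul]
    exact add_mem (hw hy) (hw' hy)
  | mul w w' _ _ hw hw' =>
    rw [mul_assoc]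
    exact hw (hw' hy)

theorem seqIdem_mem_pathSpan : e₀ ∈ H.pathSpan := by
  classical
  rw [seqIdem_eq]
  refine sum_mem fun i hi => ?_
  have h := IsPath.base (q := q) (ν := ν) (lam := lam) (p := p) i.1 (Finset.mem_filter.1 hi).2
  have h1 := H.mul_toCorner_mem_pathSpan h 1
  rw [map_one] at h1
  exact (H.path_mul_seqIdem h) ▸ h1

/-- Multiplication by `e₀` kills a path starting at a sequence outside `I^ν'`. A positive sequence
has no descent, so a path starting there is just its idempotent. -/
theorem exists_toCorner_eq {y : VVAlgebra p q ν m} (hy : y ∈ H.pathSpan) :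
    ∃ r, (H.toCorner r).1 = e₀ * y := by
  induction hy using AddSubgroup.closure_induction with
  | mem y hy =>
    obtain ⟨i, u, r, h, rfl⟩ := hy
    by_cases hi : i ∈ klrSeq ν' m
    · have h1 : u = E i := by
        cases h with
        | base i hi => rfl
        | step i _ g hg hd u hu => exact absurd hd (H.not_isDescent hi)
      refine ⟨KLRAlgebra.gen p ν' m (.e ⟨i, hi⟩) * r, ?_⟩
      rw [h1, ← mul_assoc, H.seqIdem_mul_seqE hi, ← H.toCorner_e ⟨i, hi⟩, map_mul]
      rfl
    · refine ⟨0, ?_⟩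
      rw [← h.seqE_mul, map_zero, ← mul_assoc, ← mul_assoc, seqIdem_mul_seqE_of_notMem hi,
        zero_mul, zero_mul]
      rfl
  | zero => exact ⟨0, by rw [map_zero, mul_zero]; rfl⟩
  | add y z _ _ hy hz =>
    obtain ⟨r, hr⟩ := hy
    obtain ⟨r', hr'⟩ := hz
    refine ⟨r + r', ?_⟩
    rw [map_add, mul_add, ← hr, ← hr']
    rfl
  | neg y _ hy =>
    obtain ⟨r, hr⟩ := hy
    refine ⟨-r, ?_⟩
    rw [map_neg, mul_neg (α := VVAlgebra p q ν m), ← hr]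
    rfl

theorem toCorner_surjective : Function.Surjective (H.toCorner (m := m)) := by
  intro c
  have h1 : c.1 ∈ H.pathSpan := by
    rw [← corner_mul _ c]
    exact H.mul_mem_pathSpan _ H.seqIdem_mem_pathSpan
  obtain ⟨r, hr⟩ := H.exists_toCorner_eq h1
  exact ⟨r, Subtype.ext (hr.trans (mul_corner _ c))⟩

end Admissible

/-! ### Sign patterns and the straightening permutation -/

section SignPatterns

variable {m : ℕ}

/-- The number of signs `-` (that is, `true`) after the position `l`. -/
def negAfter (ε : Fin m → Bool) (l : ℕ) : ℕ := ∑ b : Fin m, if l < b.1 ∧ ε b = true then 1 else 0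

theorem negAfter_succ (ε : Fin m → Bool) {a : ℕ} (h : a + 1 < m) :
    negAfter ε a = negAfter ε (a + 1) + if ε ⟨a + 1, h⟩ = true then 1 else 0 := by
  have h1 : (if ε ⟨a + 1, h⟩ = true then 1 else 0) =
      ∑ b : Fin m, if b = ⟨a + 1, h⟩ then (if ε b = true then 1 else 0) else 0 := by
    rw [Finset.sum_ite_eq' Finset.univ (⟨a + 1, h⟩ : Fin m) fun b => if ε b = true then 1 else 0]
    simp
  rw [h1, negAfter, negAfter, ← Finset.sum_add_distrib]
  refine Finset.sum_congr rfl fun b _ => ?_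
  simp only [Fin.ext_iff]
  split_ifs <;> first | rfl | omega | (exfalso; simp_all <;> omega)

theorem negAfter_add_lt (ε : Fin m → Bool) (l : Fin m) : negAfter ε l + l < m := by
  have h : negAfter ε l ≤ (Finset.Ioi l).card := by
    rw [negAfter, ← Finset.card_filter]
    refine Finset.card_le_card fun b hb => ?_
    simp only [Finset.mem_filter, Finset.mem_univ, true_and] at hb
    exact Finset.mem_Ioi.2 hb.1
  rw [Fin.card_Ioi] at h
  omega

theorem negAfter_antitone (ε : Fin m → Bool) {a b : ℕ} (hab : a ≤ b) (hb : b < m) :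
    negAfter ε b ≤ negAfter ε a := by
  induction b, hab using Nat.le_induction with
  | base => exact le_rfl
  | succ b hab ih =>
    have := ih (by omega)
    have := negAfter_succ ε hb
    omega

theorem negAfter_add_monotone (ε : Fin m → Bool) {a b : ℕ} (hab : a ≤ b) (hb : b < m) :
    negAfter ε a + a ≤ negAfter ε b + b := by
  induction b, hab using Nat.le_induction with
  | base => exact le_rfl
  | succ b hab ih =>
    have := ih (by omega)
    have := negAfter_succ ε hb
    split_ifs at this <;> omega

/-- The exchange carries a sign across the cut behind position `l` only if `l = a`. -/
theorem negAfter_comp_adjSwap (ε : Fin m → Bool) {a : ℕ} (h : a + 1 < m) {l : ℕ} (hl : l ≠ a) :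
    negAfter (ε ∘ adjSwap a h) l = negAfter ε l := by
  rw [negAfter, ← Equiv.sum_comp (adjSwap a h)]
  refine Finset.sum_congr rfl fun b _ => ?_
  rw [Function.comp_apply, Equiv.swap_apply_self]
  congr 2
  rw [Equiv.swap_apply_def]
  simp only [Fin.ext_iff, eq_iff_iff]
  split_ifs <;> simp only <;> omega

/-- The sign pattern obtained by changing the first sign. -/
def flipFirst (h : 0 < m) (ε : Fin m → Bool) : Fin m → Bool :=
  Function.update ε ⟨0, h⟩ (!ε ⟨0, h⟩)

theorem flipFirst_apply (h : 0 < m) (ε : Fin m → Bool) (l : Fin m) :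
    flipFirst h ε l = if l.1 = 0 then !ε l else ε l := by
  by_cases hl : l = ⟨0, h⟩
  · subst hl
    simp [flipFirst]
  · rw [flipFirst, Function.update_of_ne hl, if_neg fun h => hl (Fin.ext h)]

theorem flipFirst_flipFirst (h : 0 < m) (ε : Fin m → Bool) :
    flipFirst h (flipFirst h ε) = ε := by
  funext l
  simp only [flipFirst_apply]
  split_ifs <;> simp

theorem flipFirst_comp_adjSwap {a : ℕ} (h : a + 1 < m) (ha : a ≠ 0) (ε : Fin m → Bool) :
    flipFirst (by omega) (ε ∘ adjSwap a h) = flipFirst (by omega) ε ∘ adjSwap a h := by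
  funext l
  simp only [flipFirst_apply, Function.comp_apply, Equiv.swap_apply_def, Fin.ext_iff]
  split_ifs <;> simp_all

theorem negAfter_flipFirst (h : 0 < m) (ε : Fin m → Bool) (l : ℕ) :
    negAfter (flipFirst h ε) l = negAfter ε l := by
  refine Finset.sum_congr rfl fun b _ => ?_
  rw [flipFirst_apply]
  split_ifs <;> first | rfl | omega

/-- The position to which the entry in position `l` moves when the entries with sign `-` are moved
one after the other to the front. -/
def straightenFun (ε : Fin m → Bool) (l : Fin m) : Fin m :=
  ⟨negAfter ε l + if ε l = true then 0 else l.1, by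
    have := negAfter_add_lt ε l
    split_ifs <;> omega⟩

/-- A later entry lands in front of all earlier ones if its sign is `-`, and behind all of them if
it is `+`. This follows since `negAfter ε l` decreases and `negAfter ε l + l` increases weakly in
`l`. -/
theorem straightenFun_ne (ε : Fin m → Bool) {l l' : Fin m} (h : l < l') :
    straightenFun ε l ≠ straightenFun ε l' := by
  obtain ⟨l', hl'⟩ := l'
  obtain ⟨l, hl⟩ := l
  cases l' with
  | zero => exact absurd h (Nat.not_lt_zero _)
  | succ b =>
    have hlb : l ≤ b := Nat.lt_succ_iff.1 h
    have h1 := negAfter_antitone ε hlb (by omega)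
    have h2 := negAfter_add_monotone ε hlb (by omega)
    have h3 := negAfter_succ ε hl'
    simp only [straightenFun, ne_eq, Fin.mk.injEq]
    split_ifs at h3 ⊢ <;> omega

theorem straightenFun_injective (ε : Fin m → Bool) : Function.Injective (straightenFun ε) := by
  intro l l' h
  by_contra hne
  rcases lt_or_gt_of_ne hne with h1 | h1
  · exact straightenFun_ne ε h1 h
  · exact straightenFun_ne ε h1 h.symm

/-- The permutation that moves the entries with sign `-` one after the other to the front. -/
noncomputable def straighten (ε : Fin m → Bool) : Equiv.Perm (Fin m) :=
  Equiv.ofBijective (straightenFun ε) (Finite.injective_iff_bijective.1 (straightenFun_injective ε))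

theorem val_straighten (ε : Fin m → Bool) (l : Fin m) :
    (straighten ε l).1 = negAfter ε l + if ε l = true then 0 else l.1 := rfl

theorem straighten_false (l : Fin m) : straighten (fun _ => false) l = l :=
  Fin.ext (by simp [val_straighten, negAfter])

/-- An entry in position `0` is already in front, whatever its sign; only the signs behind it decide
where it is pushed. -/
theorem straighten_flipFirst (h : 0 < m) (ε : Fin m → Bool) :
    straighten (flipFirst h ε) = straighten ε := by
  ext l
  rw [val_straighten, val_straighten, negAfter_flipFirst, flipFirst_apply]
  split_ifs <;> first | rfl | omega

/-- Exchanging neighbours of opposite sign is a step of the straightening or undoes one, so every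
entry keeps its destination. -/
theorem straighten_comp_adjSwap {ε : Fin m → Bool} {a : ℕ} (h : a + 1 < m)
    (hε : ε ⟨a, by omega⟩ ≠ ε ⟨a + 1, h⟩) (l : Fin m) :
    straighten (ε ∘ adjSwap a h) l = straighten ε (adjSwap a h l) := by
  have h1 := negAfter_succ ε h
  have h2 := negAfter_succ (ε ∘ adjSwap a h) h
  rw [negAfter_comp_adjSwap ε h (l := a + 1) (by omega), Function.comp_apply,
    Equiv.swap_apply_right] at h2
  refine Fin.ext ?_
  rw [val_straighten, val_straighten, Function.comp_apply]
  by_cases hl : l = ⟨a, by omega⟩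
  · subst hl
    rw [Equiv.swap_apply_left]
    dsimp only
    rw [h2]
    cases h3 : ε ⟨a, by omega⟩ <;> cases h4 : ε ⟨a + 1, h⟩ <;> simp_all
    omega
  · by_cases hl' : l = ⟨a + 1, h⟩
    · subst hl'
      rw [Equiv.swap_apply_right, negAfter_comp_adjSwap ε h (by simp)]
      dsimp only
      rw [h1]
      cases h3 : ε ⟨a, by omega⟩ <;> cases h4 : ε ⟨a + 1, h⟩ <;> simp_all
      omega
    · rw [Equiv.swap_apply_of_ne_of_ne hl hl', negAfter_comp_adjSwap ε h]
      exact fun h5 => hl (Fin.ext h5)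

theorem straighten_of_false {ε : Fin m → Bool} {a : ℕ} (h : a + 1 < m)
    (h₁ : ε ⟨a, by omega⟩ = false) (h₂ : ε ⟨a + 1, h⟩ = false) :
    (straighten ε ⟨a + 1, h⟩).1 = (straighten ε ⟨a, by omega⟩).1 + 1 := by
  have h1 := negAfter_succ ε h
  simp only [val_straighten, h₁, h₂] at h1 ⊢
  simp at h1 ⊢
  omega

/-- The entries of sign `-` go to the front in turn, the later ones passing the earlier; hence their
order is reversed. -/
theorem straighten_of_true {ε : Fin m → Bool} {a : ℕ} (h : a + 1 < m)
    (h₁ : ε ⟨a, by omega⟩ = true) (h₂ : ε ⟨a + 1, h⟩ = true) :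
    (straighten ε ⟨a, by omega⟩).1 = (straighten ε ⟨a + 1, h⟩).1 + 1 := by
  have h1 := negAfter_succ ε h
  simp only [val_straighten, h₁, h₂] at h1 ⊢
  simpa using h1

theorem comp_adjSwap_of_eq {ε : Fin m → Bool} {a : ℕ} (h : a + 1 < m)
    (hε : ε ⟨a, by omega⟩ = ε ⟨a + 1, h⟩) : ε ∘ adjSwap a h = ε := by
  funext l
  rw [Function.comp_apply, Equiv.swap_apply_def]
  split_ifs <;> simp_all

theorem comp_adjSwap_adjSwap {α : Type*} (ε : Fin m → α) {a : ℕ} (h : a + 1 < m) :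
    (ε ∘ adjSwap a h) ∘ adjSwap a h = ε := by
  funext l
  simp

/-- The two neighbours `a`, `a + 1` of equal sign move to neighbouring positions `t`, `t + 1`. -/
theorem exists_straighten_adj {ε : Fin m → Bool} {a : ℕ} (h : a + 1 < m)
    (hε : ε ⟨a, by omega⟩ = ε ⟨a + 1, h⟩) :
    ∃ (t : ℕ) (ht : t + 1 < m),
      min (straighten ε ⟨a, by omega⟩).1 (straighten ε ⟨a + 1, h⟩).1 = t ∧
      ((ε ⟨a, by omega⟩ = false ∧ ε ⟨a + 1, h⟩ = false ∧
          straighten ε ⟨a, by omega⟩ = ⟨t, by omega⟩ ∧ straighten ε ⟨a + 1, h⟩ = ⟨t + 1, ht⟩) ∨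
        (ε ⟨a, by omega⟩ = true ∧ ε ⟨a + 1, h⟩ = true ∧
          straighten ε ⟨a, by omega⟩ = ⟨t + 1, ht⟩ ∧ straighten ε ⟨a + 1, h⟩ = ⟨t, by omega⟩)) := by
  cases h1 : ε ⟨a, by omega⟩ with
  | false =>
    have h2 := straighten_of_false h h1 (hε ▸ h1)
    refine ⟨(straighten ε ⟨a, by omega⟩).1, h2 ▸ (straighten ε ⟨a + 1, h⟩).2, by omega,
      Or.inl ⟨h1, hε ▸ h1, rfl, Fin.ext h2⟩⟩
  | true =>
    have h2 := straighten_of_true h h1 (hε ▸ h1)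
    refine ⟨(straighten ε ⟨a + 1, h⟩).1, h2 ▸ (straighten ε ⟨a, by omega⟩).2, by omega,
      Or.inr ⟨h1, hε ▸ h1, Fin.ext h2, rfl⟩⟩

end SignPatterns

/-! ### Sequences with a prescribed sign pattern -/

section Lifts

variable {k : Type u} [Field k] {p q lam : kˣ} {ν ν' : kˣ →₀ ℕ} {m : ℕ}

/-- The sequence with sign pattern `ε` that straightens to `j`. -/
noncomputable def liftSeq (ε : Fin m → Bool) (j : Fin m → kˣ) (l : Fin m) : kˣ :=
  if ε l = true then (j (straighten ε l))⁻¹ else j (straighten ε l)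

theorem liftSeq_injective (ε : Fin m → Bool) :
    Function.Injective (liftSeq ε : (Fin m → kˣ) → Fin m → kˣ) := by
  intro j j' h
  funext l
  obtain ⟨l, rfl⟩ := (straighten ε).surjective l
  have h1 := congrFun h l
  unfold liftSeq at h1
  split_ifs at h1
  · exact inv_injective h1
  · exact h1

theorem liftSeq_false (j : Fin m → kˣ) : liftSeq (fun _ => false) j = j := by
  funext l
  simp [liftSeq, straighten_false]

theorem liftSeq_comp_adjSwap {ε : Fin m → Bool} {a : ℕ} (h : a + 1 < m)
    (hε : ε ⟨a, by omega⟩ ≠ ε ⟨a + 1, h⟩) (j : Fin m → kˣ) :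
    liftSeq (ε ∘ adjSwap a h) j = liftSeq ε j ∘ adjSwap a h := by
  funext l
  simp only [liftSeq, straighten_comp_adjSwap h hε, Function.comp_apply]

theorem liftSeq_flipFirst (h : 0 < m) (ε : Fin m → Bool) (j : Fin m → kˣ) :
    liftSeq (flipFirst h ε) j = reflect 0 h (liftSeq ε j) := by
  funext ⟨l, hl⟩
  simp only [liftSeq, straighten_flipFirst, reflect_zero_apply, flipFirst_apply]
  by_cases h0 : l = 0
  · subst h0
    cases ε ⟨0, h⟩ <;> simp
  · simp [h0]

namespace Admissible

variable (H : Admissible p q lam ν ν')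
include H

theorem liftSeq_mem_vvSeq (ε : Fin m → Bool) {j : Fin m → kˣ} (hj : j ∈ klrSeq ν' m) :
    liftSeq ε j ∈ vvSeq ν m := by
  refine mem_vvSeq_of_perm (H.mem_vvSeq hj) (straighten ε) fun l => ?_
  unfold liftSeq
  split_ifs
  · exact Or.inr rfl
  · exact Or.inl rfl

theorem isNeg_liftSeq (ε : Fin m → Bool) {j : Fin m → kˣ} (hj : j ∈ klrSeq ν' m) (l : Fin m) :
    isNeg p lam (liftSeq ε j l) = ε l := by
  have h1 := H.mem_orbitPos_of_mem_klrSeq hj (straighten ε l)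
  unfold liftSeq
  split_ifs with h
  · rw [h, isNeg_eq_true]
    exact inv_mem_orbitNeg h1
  · rw [H.isNeg_of_mem_orbitPos h1]
    simpa using h

end Admissible

end Lifts

/-! ### Coefficients of the action on functions of sign patterns -/

section Coefficients

variable {k : Type u} [Field k] {p q lam : kˣ} {ν ν' : kˣ →₀ ℕ} {m : ℕ}
variable {R : Type w} [Ring R] (X : Fin m → R) (S : (a : ℕ) → a + 1 < m → R)
  (e : klrSeq ν' m → R)

/-- The coefficient by which `x_l` acts in the component of sign pattern `ε`. -/
noncomputable def xCoef (ε : Fin m → Bool) (l : Fin m) : R :=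
  if ε l = true then -X (straighten ε l) else X (straighten ε l)

/-- The coefficient by which a transposition of the entries in positions `l` and `l'`, that have
become neighbours, acts in the component of sign pattern `ε`. -/
noncomputable def sCoef (ε : Fin m → Bool) (l l' : Fin m) : R :=
  if ε l = ε l' then
    -- The default `0` is not reached for neighbours of equal sign (`exists_straighten_adj`); `min`
    -- covers both orders of arrival.
    (if h : min (straighten ε l).1 (straighten ε l').1 + 1 < m then S _ h else 0)
  else 1

open Classical in
/-- The coefficient by which `e(i)` acts in the component of sign pattern `ε`. -/
noncomputable def eCoef (ε : Fin m → Bool) (i : Fin m → kˣ) : R :=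
  ∑ j, if liftSeq ε j.1 = i then e j else 0

variable {X S e}

theorem sCoef_of_ne {ε : Fin m → Bool} {l l' : Fin m} (h : ε l ≠ ε l') : sCoef S ε l l' = 1 :=
  if_neg h

theorem sCoef_comp_adjSwap {ε : Fin m → Bool} {b : ℕ} (h : b + 1 < m)
    (hε : ε ⟨b, by omega⟩ ≠ ε ⟨b + 1, h⟩) (l l' : Fin m) :
    sCoef S (ε ∘ adjSwap b h) l l' = sCoef S ε (adjSwap b h l) (adjSwap b h l') := by
  simp only [sCoef, straighten_comp_adjSwap h hε, Function.comp_apply]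

theorem sCoef_comp_adjSwap_of_ne {ε : Fin m → Bool} {b : ℕ} (h : b + 1 < m) {l l' : Fin m}
    (h₁ : l.1 ≠ b) (h₂ : l.1 ≠ b + 1) (h₃ : l'.1 ≠ b) (h₄ : l'.1 ≠ b + 1) :
    sCoef S (ε ∘ adjSwap b h) l l' = sCoef S ε l l' := by
  by_cases hε : ε ⟨b, by omega⟩ = ε ⟨b + 1, h⟩
  · rw [comp_adjSwap_of_eq h hε]
  · rw [sCoef_comp_adjSwap h hε, Equiv.swap_apply_of_ne_of_ne, Equiv.swap_apply_of_ne_of_ne] <;>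
    simpa [Fin.ext_iff]

theorem exists_sCoef_eq {ε : Fin m → Bool} {a : ℕ} (h : a + 1 < m)
    (hε : ε ⟨a, by omega⟩ = ε ⟨a + 1, h⟩) :
    ∃ (t : ℕ) (ht : t + 1 < m), sCoef S ε ⟨a, by omega⟩ ⟨a + 1, h⟩ = S t ht ∧
      ((ε ⟨a, by omega⟩ = false ∧ ε ⟨a + 1, h⟩ = false ∧
          straighten ε ⟨a, by omega⟩ = ⟨t, by omega⟩ ∧ straighten ε ⟨a + 1, h⟩ = ⟨t + 1, ht⟩) ∨
        (ε ⟨a, by omega⟩ = true ∧ ε ⟨a + 1, h⟩ = true ∧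
          straighten ε ⟨a, by omega⟩ = ⟨t + 1, ht⟩ ∧ straighten ε ⟨a + 1, h⟩ = ⟨t, by omega⟩)) := by
  obtain ⟨t, ht, hmin, hc⟩ := exists_straighten_adj h hε
  refine ⟨t, ht, ?_, hc⟩
  rw [sCoef, if_pos hε]
  simp only [hmin, ht, dite_true]

/-- Of three signs that are not all equal exactly two agree. Each side thus has one nontrivial
factor, and it is the crossing of that same pair. -/
theorem sCoef_braid {ε : Fin m → Bool} {a : ℕ} (h : a + 2 < m)
    (hε : ε ⟨a, by omega⟩ ≠ ε ⟨a + 1, by omega⟩ ∨ ε ⟨a + 1, by omega⟩ ≠ ε ⟨a + 2, h⟩) :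
    sCoef S ε ⟨a + 1, by omega⟩ ⟨a + 2, h⟩ *
        (sCoef S (ε ∘ adjSwap (a + 1) h) ⟨a, by omega⟩ ⟨a + 1, by omega⟩ *
          sCoef S ((ε ∘ adjSwap (a + 1) h) ∘ adjSwap a (by omega)) ⟨a + 1, by omega⟩ ⟨a + 2, h⟩) =
      sCoef S ε ⟨a, by omega⟩ ⟨a + 1, by omega⟩ *
        (sCoef S (ε ∘ adjSwap a (by omega)) ⟨a + 1, by omega⟩ ⟨a + 2, h⟩ *
          sCoef S ((ε ∘ adjSwap a (by omega)) ∘ adjSwap (a + 1) h)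
            ⟨a, by omega⟩ ⟨a + 1, by omega⟩) := by
  have ha : a + 1 < m := by omega
  have e1 : adjSwap (a + 1) h ⟨a, by omega⟩ = ⟨a, by omega⟩ :=
    Equiv.swap_apply_of_ne_of_ne (by simp) (by simp; omega)
  have e2 : adjSwap (a + 1) h ⟨a + 1, by omega⟩ = ⟨a + 2, h⟩ := Equiv.swap_apply_left _ _
  have e3 : adjSwap (a + 1) h ⟨a + 2, h⟩ = ⟨a + 1, by omega⟩ := Equiv.swap_apply_right _ _
  have e4 : adjSwap a ha ⟨a, by omega⟩ = ⟨a + 1, by omega⟩ := Equiv.swap_apply_left _ _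
  have e5 : adjSwap a ha ⟨a + 1, by omega⟩ = ⟨a, by omega⟩ := Equiv.swap_apply_right _ _
  have e6 : adjSwap a ha ⟨a + 2, h⟩ = ⟨a + 2, h⟩ :=
    Equiv.swap_apply_of_ne_of_ne (by simp) (by simp)
  by_cases h12 : ε ⟨a, by omega⟩ = ε ⟨a + 1, by omega⟩
  · have h23 : ε ⟨a + 1, by omega⟩ ≠ ε ⟨a + 2, h⟩ := hε.resolve_left (not_not_intro h12)
    have h13 : ε ⟨a, by omega⟩ ≠ ε ⟨a + 2, h⟩ := h12 ▸ h23
    rw [comp_adjSwap_of_eq ha h12, sCoef_comp_adjSwap ha, sCoef_comp_adjSwap h h23,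
      sCoef_comp_adjSwap h h23, e5, e6, e1, e2, e3, sCoef_of_ne h23, sCoef_of_ne h13]
    · simp
    · rw [Function.comp_apply, Function.comp_apply, e1, e2]
      exact h13
  · by_cases h23 : ε ⟨a + 1, by omega⟩ = ε ⟨a + 2, h⟩
    · have h13 : ε ⟨a, by omega⟩ ≠ ε ⟨a + 2, h⟩ := h23 ▸ h12
      rw [comp_adjSwap_of_eq h h23, sCoef_comp_adjSwap h, sCoef_comp_adjSwap ha h12,
        sCoef_comp_adjSwap ha h12, e5, e6, e1, e2, e4, sCoef_of_ne h12, sCoef_of_ne h13]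
      · simp [e6]
      · rw [Function.comp_apply, Function.comp_apply, e5, e6]
        exact h13
    · have h13 : ε ⟨a, by omega⟩ = ε ⟨a + 2, h⟩ := by
        revert h12 h23
        cases ε ⟨a, by omega⟩ <;> cases ε ⟨a + 1, by omega⟩ <;> cases ε ⟨a + 2, h⟩ <;> simp
      rw [comp_adjSwap_of_eq (ε := ε ∘ adjSwap (a + 1) h) ha,
        comp_adjSwap_of_eq (ε := ε ∘ adjSwap a ha) h, sCoef_comp_adjSwap h h23,
        sCoef_comp_adjSwap h h23, sCoef_comp_adjSwap ha h12, sCoef_comp_adjSwap ha h12,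
        e1, e2, e3, e4, e5, e6, sCoef_of_ne h12, sCoef_of_ne h23, sCoef_of_ne (Ne.symm h12),
        sCoef_of_ne (Ne.symm h23)]
      · exact (congrArg ε e5).trans (h13.trans (congrArg ε e6).symm)
      · exact (congrArg ε e1).trans (h13.trans (congrArg ε e2).symm)

theorem sCoef_flipFirst (h : 0 < m) {ε : Fin m → Bool} {l l' : Fin m} (h₁ : l.1 ≠ 0)
    (h₂ : l'.1 ≠ 0) : sCoef S (flipFirst h ε) l l' = sCoef S ε l l' := by
  simp only [sCoef, straighten_flipFirst, flipFirst_apply, if_neg h₁, if_neg h₂]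

/-- On each side exactly one factor is nontrivial, and `sCoef` depends only on the unordered pair of
straightened positions, which is the same on both sides. -/
theorem sCoef_braid_zero (h : 1 < m) (ε : Fin m → Bool) :
    sCoef S ε ⟨0, by omega⟩ ⟨1, h⟩ *
        sCoef S (flipFirst (by omega) (ε ∘ adjSwap 0 h)) ⟨0, by omega⟩ ⟨1, h⟩ =
      sCoef S (flipFirst (by omega) ε) ⟨0, by omega⟩ ⟨1, h⟩ *
        sCoef S (flipFirst (by omega) (flipFirst (by omega) ε ∘ adjSwap 0 h))
          ⟨0, by omega⟩ ⟨1, h⟩ := by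
  have h0 : 0 < m := by omega
  have e1 : adjSwap 0 h ⟨0, by omega⟩ = ⟨1, h⟩ := Equiv.swap_apply_left _ _
  have e2 : adjSwap 0 h ⟨1, h⟩ = ⟨0, by omega⟩ := Equiv.swap_apply_right _ _
  by_cases hε : ε ⟨0, by omega⟩ = ε ⟨1, h⟩
  · have hf : flipFirst h0 ε ⟨0, by omega⟩ ≠ flipFirst h0 ε ⟨1, h⟩ := by
      simp [flipFirst_apply, hε]
    rw [comp_adjSwap_of_eq (ε := ε) h hε, sCoef_of_ne hf, mul_one, one_mul]
    simp only [sCoef, straighten_flipFirst, straighten_comp_adjSwap h hf, e1, e2]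
    rw [if_pos hε, if_pos]
    · simp only [min_comm (straighten ε ⟨1, h⟩).1]
    · simp [flipFirst_apply, hε]
  · have hf : flipFirst h0 ε ⟨0, by omega⟩ = flipFirst h0 ε ⟨1, h⟩ := by
      simp only [flipFirst_apply]
      revert hε
      cases ε ⟨0, by omega⟩ <;> cases ε ⟨1, h⟩ <;> simp
    rw [comp_adjSwap_of_eq (ε := flipFirst h0 ε) h hf, flipFirst_flipFirst, sCoef_of_ne hε,
      mul_one, one_mul]
    simp only [sCoef, straighten_flipFirst, straighten_comp_adjSwap h hε, e1, e2]
    rw [if_pos hf, if_pos]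
    · simp only [min_comm (straighten ε ⟨1, h⟩).1]
    · simp only [flipFirst_apply, Function.comp_apply, e1, e2]
      revert hε
      cases ε ⟨0, by omega⟩ <;> cases ε ⟨1, h⟩ <;> simp

theorem eCoef_liftSeq (ε : Fin m → Bool) (j : klrSeq ν' m) : eCoef e ε (liftSeq ε j.1) = e j := by
  classical
  unfold eCoef
  rw [Finset.sum_eq_single j]
  · rw [if_pos rfl]
  · exact fun j' _ hj => if_neg fun h => hj (Subtype.ext (liftSeq_injective ε h))
  · exact fun h => absurd (Finset.mem_univ _) h

/-- Since `liftSeq ε` is injective, the sum defining `eCoef` has at most one nonzero term. -/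
theorem exists_of_eCoef_ne_zero (e : klrSeq ν' m → R) (ε : Fin m → Bool) (i : Fin m → kˣ) :
    (∃ j : klrSeq ν' m, liftSeq ε j.1 = i ∧ eCoef e ε i = e j) ∨ eCoef e ε i = 0 := by
  classical
  by_cases h : ∃ j : klrSeq ν' m, liftSeq ε j.1 = i
  · obtain ⟨j, rfl⟩ := h
    exact Or.inl ⟨j, rfl, eCoef_liftSeq ε j⟩
  · exact Or.inr (Finset.sum_eq_zero fun j _ => if_neg fun hj => h ⟨j, hj⟩)

theorem eCoef_comp_adjSwap {ε : Fin m → Bool} {a : ℕ} (h : a + 1 < m)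
    (hε : ε ⟨a, by omega⟩ ≠ ε ⟨a + 1, h⟩) (i : Fin m → kˣ) :
    eCoef e (ε ∘ adjSwap a h) i = eCoef e ε (i ∘ adjSwap a h) := by
  classical
  unfold eCoef
  refine Finset.sum_congr rfl fun j _ => ?_
  rw [liftSeq_comp_adjSwap h hε]
  congr 1
  refine propext ⟨?_, fun h1 => ?_⟩
  · rintro rfl
    rw [comp_adjSwap_adjSwap]
  · rw [h1, comp_adjSwap_adjSwap]

theorem eCoef_flipFirst (h : 0 < m) (ε : Fin m → Bool) (i : Fin m → kˣ) :
    eCoef e (flipFirst h ε) i = eCoef e ε (reflect 0 h i) := by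
  classical
  unfold eCoef
  refine Finset.sum_congr rfl fun j _ => ?_
  rw [liftSeq_flipFirst]
  congr 1
  refine propext ⟨?_, fun h1 => ?_⟩
  · rintro rfl
    rw [reflect_reflect]
  · rw [h1, reflect_reflect]

/-- Conjugation by `straighten ε` turns the transposition of `a`, `a + 1` into that of `t`, `t + 1`,
and equal signs mean that it respects `ε`. -/
theorem liftSeq_comp_adjSwap_of_eq {ε : Fin m → Bool} {a : ℕ} (h : a + 1 < m)
    (hε : ε ⟨a, by omega⟩ = ε ⟨a + 1, h⟩) {t : ℕ} (ht : t + 1 < m)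
    (hc : (straighten ε ⟨a, by omega⟩ = ⟨t, by omega⟩ ∧ straighten ε ⟨a + 1, h⟩ = ⟨t + 1, ht⟩) ∨
      (straighten ε ⟨a, by omega⟩ = ⟨t + 1, ht⟩ ∧ straighten ε ⟨a + 1, h⟩ = ⟨t, by omega⟩))
    (j : Fin m → kˣ) :
    liftSeq ε (j ∘ adjSwap t ht) = liftSeq ε j ∘ adjSwap a h := by
  funext l
  have h1 : ε (adjSwap a h l) = ε l := congrFun (comp_adjSwap_of_eq h hε) l
  have h2 : adjSwap t ht (straighten ε l) = straighten ε (adjSwap a h l) := by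
    have h3 : adjSwap t ht = Equiv.swap (straighten ε ⟨a, by omega⟩) (straighten ε ⟨a + 1, h⟩) := by
      rcases hc with ⟨hc, hc'⟩ | ⟨hc, hc'⟩
      · rw [hc, hc']
      · rw [hc, hc', Equiv.swap_comm]
    rw [h3, (straighten ε).injective.map_swap]
  simp only [liftSeq, Function.comp_apply, h1, h2]

end Coefficients

/-! ### The KLR relations between coefficients -/

section CoefficientRelations

variable {k : Type u} [Field k] {p q lam : kˣ} {ν ν' : kˣ →₀ ℕ} {m : ℕ}
variable {R : Type w} [Ring R] {X : Fin m → R} {S : (a : ℕ) → a + 1 < m → R}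
  {e : klrSeq ν' m → R} (H : Admissible p q lam ν ν')
  (hR : ∀ a b, KLRRel p (klrSeq ν' m) X S e a b → a = b)

include H in
-- A lift with pattern `ε` has exactly the signs `ε`, so `e(i)` acts by zero at patterns other than
-- that of `i`.
theorem eCoef_eq_zero_of_ne {ε : Fin m → Bool} {i : Fin m → kˣ} {l l' : Fin m}
    (hε : ε l ≠ ε l') (hi : isNeg p lam (i l) = isNeg p lam (i l')) : eCoef e ε i = 0 := by
  rcases exists_of_eCoef_ne_zero e ε i with ⟨j, rfl, -⟩ | h
  · rw [H.isNeg_liftSeq ε j.2, H.isNeg_liftSeq ε j.2] at hi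
    exact absurd hi hε
  · exact h

include hR in
theorem sCoef_mul_eCoef {ε : Fin m → Bool} {a : ℕ} (h : a + 1 < m) (i : Fin m → kˣ) :
    sCoef S ε ⟨a, by omega⟩ ⟨a + 1, h⟩ * eCoef e (ε ∘ adjSwap a h) i =
      eCoef e ε (i ∘ adjSwap a h) * sCoef S ε ⟨a, by omega⟩ ⟨a + 1, h⟩ := by
  classical
  by_cases hε : ε ⟨a, by omega⟩ = ε ⟨a + 1, h⟩
  · obtain ⟨t, ht, hS, hc⟩ := exists_sCoef_eq (S := S) h hε
    have hc' := hc.imp (fun h => h.2.2) fun h => h.2.2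
    rw [hS, comp_adjSwap_of_eq h hε]
    unfold eCoef
    rw [Finset.mul_sum, Finset.sum_mul]
    let τ : klrSeq ν' m ≃ klrSeq ν' m :=
      { toFun := fun j => ⟨j.1 ∘ adjSwap t ht, comp_mem_klrSeq j.2 _⟩
        invFun := fun j => ⟨j.1 ∘ adjSwap t ht, comp_mem_klrSeq j.2 _⟩
        left_inv := fun j => Subtype.ext (comp_adjSwap_adjSwap j.1 ht)
        right_inv := fun j => Subtype.ext (comp_adjSwap_adjSwap j.1 ht) }
    refine Fintype.sum_equiv τ _ _ fun j => ?_
    have h1 : liftSeq ε (τ j).1 = liftSeq ε j.1 ∘ adjSwap a h :=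
      liftSeq_comp_adjSwap_of_eq h hε ht hc' j.1
    rw [h1]
    by_cases hj : liftSeq ε j.1 = i
    · rw [if_pos hj, if_pos (by rw [hj])]
      exact hR _ _ (.s_e t ht j (τ j) rfl)
    · rw [if_neg hj, if_neg, mul_zero, zero_mul]
      intro h2
      refine hj ?_
      rw [← comp_adjSwap_adjSwap (liftSeq ε j.1) h, h2, comp_adjSwap_adjSwap]
  · rw [sCoef_of_ne hε, one_mul, mul_one, eCoef_comp_adjSwap h hε]

include hR in
theorem eCoef_mul_self (ε : Fin m → Bool) (i : Fin m → kˣ) :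
    eCoef e ε i * eCoef e ε i = eCoef e ε i := by
  rcases exists_of_eCoef_ne_zero e ε i with ⟨j, -, h⟩ | h
  · rw [h]
    exact hR _ _ (.e_mul_self j)
  · rw [h, zero_mul]

include hR in
theorem eCoef_mul_ne (ε : Fin m → Bool) {i i' : Fin m → kˣ} (hi : i ≠ i') :
    eCoef e ε i * eCoef e ε i' = 0 := by
  rcases exists_of_eCoef_ne_zero e ε i with ⟨j, hj, h⟩ | h
  · rcases exists_of_eCoef_ne_zero e ε i' with ⟨j', hj', h'⟩ | h'
    · rw [h, h']
      refine hR _ _ (.e_mul_ne j j' ?_)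
      rintro rfl
      exact hi (hj.symm.trans hj')
    · rw [h', mul_zero]
  · rw [h, zero_mul]

include hR in
theorem xCoef_mul_eCoef (ε : Fin m → Bool) (l : Fin m) (i : Fin m → kˣ) :
    xCoef X ε l * eCoef e ε i = eCoef e ε i * xCoef X ε l := by
  rcases exists_of_eCoef_ne_zero e ε i with ⟨j, -, h⟩ | h
  · have h1 := hR _ _ (.x_e (straighten ε l) j)
    rw [h, xCoef]
    split_ifs
    · rw [neg_mul, mul_neg, h1]
    · exact h1
  · rw [h, zero_mul, mul_zero]

include hR in
theorem xCoef_comm (ε : Fin m → Bool) (l l' : Fin m) :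
    xCoef X ε l * xCoef X ε l' = xCoef X ε l' * xCoef X ε l := by
  have h1 := hR _ _ (.x_comm (straighten ε l) (straighten ε l'))
  unfold xCoef
  split_ifs <;> simp [h1]

include hR in
theorem sCoef_comm (ε : Fin m → Bool) {a b : ℕ} (ha : a + 1 < m) (hb : b + 1 < m)
    (h₁ : a ≠ b + 1) (h₂ : b ≠ a + 1) :
    sCoef S ε ⟨a, by omega⟩ ⟨a + 1, ha⟩ * sCoef S ε ⟨b, by omega⟩ ⟨b + 1, hb⟩ =
      sCoef S ε ⟨b, by omega⟩ ⟨b + 1, hb⟩ * sCoef S ε ⟨a, by omega⟩ ⟨a + 1, ha⟩ := by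
  by_cases hab : a = b
  · subst hab
    rfl
  by_cases hεa : ε ⟨a, by omega⟩ = ε ⟨a + 1, ha⟩
  · by_cases hεb : ε ⟨b, by omega⟩ = ε ⟨b + 1, hb⟩
    · obtain ⟨t, ht, hS, hc⟩ := exists_sCoef_eq (S := S) ha hεa
      obtain ⟨t', ht', hS', hc'⟩ := exists_sCoef_eq (S := S) hb hεb
      have hne {l l' : Fin m} (hl : l ≠ l') : (straighten ε l).1 ≠ (straighten ε l').1 :=
        fun h => hl ((straighten ε).injective (Fin.ext h))
      -- Straightening is injective, so the disjoint pairs land in disjoint pairs of neighbours,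
      -- whose crossings commute.
      have n1 := hne (l := ⟨a, by omega⟩) (l' := ⟨b, by omega⟩) (by simpa using hab)
      have n2 := hne (l := ⟨a, by omega⟩) (l' := ⟨b + 1, hb⟩) (by simpa using h₁)
      have n3 := hne (l := ⟨a + 1, ha⟩) (l' := ⟨b, by omega⟩) (by simpa using Ne.symm h₂)
      have n4 := hne (l := ⟨a + 1, ha⟩) (l' := ⟨b + 1, hb⟩) (by simpa using hab)
      rw [hS, hS']
      refine hR _ _ (.s_comm t t' ht ht' ?_ ?_) <;>
      rcases hc with ⟨-, -, c1, c2⟩ | ⟨-, -, c1, c2⟩ <;>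
      rcases hc' with ⟨-, -, c3, c4⟩ | ⟨-, -, c3, c4⟩ <;>
      simp only [c1, c2, c3, c4] at n1 n2 n3 n4 <;> omega
    · rw [sCoef_of_ne hεb, one_mul, mul_one]
  · rw [sCoef_of_ne hεa, one_mul, mul_one]

/-- This is the dictionary for two neighbours of equal sign. For sign `-` the order is reversed, the
entries are inverted and the variables negated, while the crossing keeps its sign. -/
theorem exists_adj (X : Fin m → R) (S : (a : ℕ) → a + 1 < m → R) {ε : Fin m → Bool} {a : ℕ}
    (h : a + 1 < m) (hε : ε ⟨a, by omega⟩ = ε ⟨a + 1, h⟩) (j : Fin m → kˣ) :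
    ∃ (t : ℕ) (ht : t + 1 < m), sCoef S ε ⟨a, by omega⟩ ⟨a + 1, h⟩ = S t ht ∧
      ((ε ⟨a, by omega⟩ = false ∧
          straighten ε ⟨a, by omega⟩ = ⟨t, by omega⟩ ∧ straighten ε ⟨a + 1, h⟩ = ⟨t + 1, ht⟩ ∧
          xCoef X ε ⟨a, by omega⟩ = X ⟨t, by omega⟩ ∧ xCoef X ε ⟨a + 1, h⟩ = X ⟨t + 1, ht⟩ ∧
          liftSeq ε j ⟨a, by omega⟩ = j ⟨t, by omega⟩ ∧
          liftSeq ε j ⟨a + 1, h⟩ = j ⟨t + 1, ht⟩) ∨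
        (ε ⟨a, by omega⟩ = true ∧
          straighten ε ⟨a, by omega⟩ = ⟨t + 1, ht⟩ ∧ straighten ε ⟨a + 1, h⟩ = ⟨t, by omega⟩ ∧
          xCoef X ε ⟨a, by omega⟩ = -X ⟨t + 1, ht⟩ ∧ xCoef X ε ⟨a + 1, h⟩ = -X ⟨t, by omega⟩ ∧
          liftSeq ε j ⟨a, by omega⟩ = (j ⟨t + 1, ht⟩)⁻¹ ∧
          liftSeq ε j ⟨a + 1, h⟩ = (j ⟨t, by omega⟩)⁻¹)) := by
  obtain ⟨t, ht, hS, hc⟩ := exists_sCoef_eq (S := S) h hε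
  refine ⟨t, ht, hS, hc.imp ?_ ?_⟩
  · rintro ⟨h1, h2, h3, h4⟩
    simp [xCoef, liftSeq, h1, h2, h3, h4]
  · rintro ⟨h1, h2, h3, h4⟩
    simp [xCoef, liftSeq, h1, h2, h3, h4]

include hR in
theorem sCoef_sq_none {ε : Fin m → Bool} {a : ℕ} (h : a + 1 < m) {i : Fin m → kˣ}
    (hne : i ⟨a, by omega⟩ ≠ i ⟨a + 1, h⟩)
    (h₁ : ¬ Arrow p (i ⟨a, by omega⟩) (i ⟨a + 1, h⟩))
    (h₂ : ¬ Arrow p (i ⟨a + 1, h⟩) (i ⟨a, by omega⟩)) :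
    sCoef S ε ⟨a, by omega⟩ ⟨a + 1, h⟩ *
      sCoef S (ε ∘ adjSwap a h) ⟨a, by omega⟩ ⟨a + 1, h⟩ * eCoef e ε i = eCoef e ε i := by
  by_cases hε : ε ⟨a, by omega⟩ = ε ⟨a + 1, h⟩
  · rcases exists_of_eCoef_ne_zero e ε i with ⟨j, rfl, he⟩ | he
    · obtain ⟨t, ht, hS, ⟨-, -, -, -, -, l1, l2⟩ | ⟨-, -, -, -, -, l1, l2⟩⟩ :=
        exists_adj X S h hε j.1 <;>
        rw [l1, l2] at hne h₁ h₂ <;> rw [comp_adjSwap_of_eq h hε, hS, he]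
      · exact hR _ _ (.s_sq_none t ht j hne h₁ h₂)
      · rw [arrow_inv_iff] at h₁ h₂
        exact hR _ _ (.s_sq_none t ht j (fun h => hne (congrArg _ h.symm)) h₁ h₂)
    · rw [he, mul_zero]
  · rw [sCoef_of_ne hε, sCoef_of_ne, one_mul, one_mul]
    rw [Function.comp_apply, Function.comp_apply, Equiv.swap_apply_left, Equiv.swap_apply_right]
    exact Ne.symm hε

include H hR in
-- For sign `-`, inversion and reversal each turn the arrow around, and negation and reversal each
-- change the sign of the difference of the variables; so the same KLR relation applies. Opposite
-- signs are excluded by the arrow.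
theorem sCoef_sq_left {ε : Fin m → Bool} {a : ℕ} (h : a + 1 < m) {i : Fin m → kˣ}
    (hne : i ⟨a, by omega⟩ ≠ i ⟨a + 1, h⟩)
    (h₁ : ¬ Arrow p (i ⟨a, by omega⟩) (i ⟨a + 1, h⟩))
    (h₂ : Arrow p (i ⟨a + 1, h⟩) (i ⟨a, by omega⟩)) :
    sCoef S ε ⟨a, by omega⟩ ⟨a + 1, h⟩ *
      sCoef S (ε ∘ adjSwap a h) ⟨a, by omega⟩ ⟨a + 1, h⟩ * eCoef e ε i =
        (xCoef X ε ⟨a + 1, h⟩ - xCoef X ε ⟨a, by omega⟩) * eCoef e ε i := by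
  by_cases hε : ε ⟨a, by omega⟩ = ε ⟨a + 1, h⟩
  · rcases exists_of_eCoef_ne_zero e ε i with ⟨j, rfl, he⟩ | he
    · obtain ⟨t, ht, hS, ⟨-, -, -, x1, x2, l1, l2⟩ | ⟨-, -, -, x1, x2, l1, l2⟩⟩ :=
        exists_adj X S h hε j.1 <;>
        rw [l1, l2] at hne h₁ h₂ <;> rw [comp_adjSwap_of_eq h hε, hS, he, x1, x2]
      · exact hR _ _ (.s_sq_left t ht j hne h₁ h₂)
      · rw [arrow_inv_iff] at h₁ h₂
        rw [neg_sub_neg]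
        exact hR _ _ (.s_sq_left t ht j (fun h => hne (congrArg _ h.symm)) h₁ h₂)
    · rw [he, mul_zero, mul_zero]
  · rw [eCoef_eq_zero_of_ne H hε h₂.isNeg_eq.symm, mul_zero, mul_zero]

include H hR in
theorem sCoef_sq_right {ε : Fin m → Bool} {a : ℕ} (h : a + 1 < m) {i : Fin m → kˣ}
    (hne : i ⟨a, by omega⟩ ≠ i ⟨a + 1, h⟩)
    (h₁ : Arrow p (i ⟨a, by omega⟩) (i ⟨a + 1, h⟩))
    (h₂ : ¬ Arrow p (i ⟨a + 1, h⟩) (i ⟨a, by omega⟩)) :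
    sCoef S ε ⟨a, by omega⟩ ⟨a + 1, h⟩ *
      sCoef S (ε ∘ adjSwap a h) ⟨a, by omega⟩ ⟨a + 1, h⟩ * eCoef e ε i =
        (xCoef X ε ⟨a, by omega⟩ - xCoef X ε ⟨a + 1, h⟩) * eCoef e ε i := by
  by_cases hε : ε ⟨a, by omega⟩ = ε ⟨a + 1, h⟩
  · rcases exists_of_eCoef_ne_zero e ε i with ⟨j, rfl, he⟩ | he
    · obtain ⟨t, ht, hS, ⟨-, -, -, x1, x2, l1, l2⟩ | ⟨-, -, -, x1, x2, l1, l2⟩⟩ :=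
        exists_adj X S h hε j.1 <;>
        rw [l1, l2] at hne h₁ h₂ <;> rw [comp_adjSwap_of_eq h hε, hS, he, x1, x2]
      · exact hR _ _ (.s_sq_right t ht j hne h₁ h₂)
      · rw [arrow_inv_iff] at h₁ h₂
        rw [neg_sub_neg]
        exact hR _ _ (.s_sq_right t ht j (fun h => hne (congrArg _ h.symm)) h₁ h₂)
    · rw [he, mul_zero, mul_zero]
  · rw [eCoef_eq_zero_of_ne H hε h₁.isNeg_eq, mul_zero, mul_zero]

include H hR in
theorem sCoef_sq_both {ε : Fin m → Bool} {a : ℕ} (h : a + 1 < m) {i : Fin m → kˣ}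
    (hne : i ⟨a, by omega⟩ ≠ i ⟨a + 1, h⟩)
    (h₁ : Arrow p (i ⟨a, by omega⟩) (i ⟨a + 1, h⟩))
    (h₂ : Arrow p (i ⟨a + 1, h⟩) (i ⟨a, by omega⟩)) :
    sCoef S ε ⟨a, by omega⟩ ⟨a + 1, h⟩ *
      sCoef S (ε ∘ adjSwap a h) ⟨a, by omega⟩ ⟨a + 1, h⟩ * eCoef e ε i =
        (xCoef X ε ⟨a + 1, h⟩ - xCoef X ε ⟨a, by omega⟩) *
          (xCoef X ε ⟨a, by omega⟩ - xCoef X ε ⟨a + 1, h⟩) * eCoef e ε i := by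
  by_cases hε : ε ⟨a, by omega⟩ = ε ⟨a + 1, h⟩
  · rcases exists_of_eCoef_ne_zero e ε i with ⟨j, rfl, he⟩ | he
    · obtain ⟨t, ht, hS, ⟨-, -, -, x1, x2, l1, l2⟩ | ⟨-, -, -, x1, x2, l1, l2⟩⟩ :=
        exists_adj X S h hε j.1 <;>
        rw [l1, l2] at hne h₁ h₂ <;> rw [comp_adjSwap_of_eq h hε, hS, he, x1, x2]
      · exact hR _ _ (.s_sq_both t ht j hne h₁ h₂)
      · rw [arrow_inv_iff] at h₁ h₂
        rw [neg_sub_neg, neg_sub_neg]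
        exact hR _ _ (.s_sq_both t ht j (fun h => hne (congrArg _ h.symm)) h₁ h₂)
    · rw [he, mul_zero, mul_zero]
  · rw [eCoef_eq_zero_of_ne H hε h₁.isNeg_eq, mul_zero, mul_zero]

include H hR in
theorem sCoef_sq_eq {ε : Fin m → Bool} {a : ℕ} (h : a + 1 < m) {i : Fin m → kˣ}
    (heq : i ⟨a, by omega⟩ = i ⟨a + 1, h⟩) :
    sCoef S ε ⟨a, by omega⟩ ⟨a + 1, h⟩ *
      sCoef S (ε ∘ adjSwap a h) ⟨a, by omega⟩ ⟨a + 1, h⟩ * eCoef e ε i = 0 := by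
  by_cases hε : ε ⟨a, by omega⟩ = ε ⟨a + 1, h⟩
  · rcases exists_of_eCoef_ne_zero e ε i with ⟨j, rfl, he⟩ | he
    · obtain ⟨t, ht, hS, ⟨-, -, -, x1, x2, l1, l2⟩ | ⟨-, -, -, x1, x2, l1, l2⟩⟩ :=
        exists_adj X S h hε j.1 <;>
        rw [l1, l2] at heq <;> rw [comp_adjSwap_of_eq h hε, hS, he]
      · exact hR _ _ (.s_sq_eq t ht j heq)
      · exact hR _ _ (.s_sq_eq t ht j (inv_injective heq).symm)
    · rw [he, mul_zero]
  · rw [eCoef_eq_zero_of_ne H hε (congrArg _ heq), mul_zero]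

include H hR in
-- For sign `-` the reversal replaces this relation by the one for the right variable, and negating
-- the variables corrects the sign.
theorem sCoef_x_left {ε : Fin m → Bool} {a : ℕ} (h : a + 1 < m) {i : Fin m → kˣ}
    (heq : i ⟨a, by omega⟩ = i ⟨a + 1, h⟩) :
    sCoef S ε ⟨a, by omega⟩ ⟨a + 1, h⟩ * xCoef X (ε ∘ adjSwap a h) ⟨a, by omega⟩ *
        eCoef e (ε ∘ adjSwap a h) i -
      xCoef X ε ⟨a + 1, h⟩ * sCoef S ε ⟨a, by omega⟩ ⟨a + 1, h⟩ *
        eCoef e (ε ∘ adjSwap a h) i = -eCoef e ε i := by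
  by_cases hε : ε ⟨a, by omega⟩ = ε ⟨a + 1, h⟩
  · rw [comp_adjSwap_of_eq h hε, ← sub_mul]
    rcases exists_of_eCoef_ne_zero e ε i with ⟨j, rfl, he⟩ | he
    · obtain ⟨t, ht, hS, ⟨-, -, -, x1, x2, l1, l2⟩ | ⟨-, -, -, x1, x2, l1, l2⟩⟩ :=
        exists_adj X S h hε j.1 <;>
        rw [l1, l2] at heq <;> rw [hS, he, x1, x2]
      · exact hR _ _ (.s_x_left t ht j heq)
      · refine Eq.trans ?_ (congrArg Neg.neg
          (hR _ _ (.s_x_right t ht j (inv_injective heq).symm)))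
        noncomm_ring
    · rw [he, mul_zero, neg_zero]
  · have hε' : (ε ∘ adjSwap a h) ⟨a, by omega⟩ ≠ (ε ∘ adjSwap a h) ⟨a + 1, h⟩ := by
      rw [Function.comp_apply, Function.comp_apply, Equiv.swap_apply_left, Equiv.swap_apply_right]
      exact Ne.symm hε
    rw [eCoef_eq_zero_of_ne H hε (congrArg _ heq), eCoef_eq_zero_of_ne H hε' (congrArg _ heq)]
    simp

include H hR in
theorem sCoef_x_right {ε : Fin m → Bool} {a : ℕ} (h : a + 1 < m) {i : Fin m → kˣ}
    (heq : i ⟨a, by omega⟩ = i ⟨a + 1, h⟩) :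
    sCoef S ε ⟨a, by omega⟩ ⟨a + 1, h⟩ * xCoef X (ε ∘ adjSwap a h) ⟨a + 1, h⟩ *
        eCoef e (ε ∘ adjSwap a h) i -
      xCoef X ε ⟨a, by omega⟩ * sCoef S ε ⟨a, by omega⟩ ⟨a + 1, h⟩ *
        eCoef e (ε ∘ adjSwap a h) i = eCoef e ε i := by
  by_cases hε : ε ⟨a, by omega⟩ = ε ⟨a + 1, h⟩
  · rw [comp_adjSwap_of_eq h hε, ← sub_mul]
    rcases exists_of_eCoef_ne_zero e ε i with ⟨j, rfl, he⟩ | he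
    · obtain ⟨t, ht, hS, ⟨-, -, -, x1, x2, l1, l2⟩ | ⟨-, -, -, x1, x2, l1, l2⟩⟩ :=
        exists_adj X S h hε j.1 <;>
        rw [l1, l2] at heq <;> rw [hS, he, x1, x2]
      · exact hR _ _ (.s_x_right t ht j heq)
      · refine Eq.trans ?_ (neg_eq_iff_eq_neg.2
          (hR _ _ (.s_x_left t ht j (inv_injective heq).symm)))
        noncomm_ring
    · rw [he, mul_zero]
  · have hε' : (ε ∘ adjSwap a h) ⟨a, by omega⟩ ≠ (ε ∘ adjSwap a h) ⟨a + 1, h⟩ := by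
      rw [Function.comp_apply, Function.comp_apply, Equiv.swap_apply_left, Equiv.swap_apply_right]
      exact Ne.symm hε
    rw [eCoef_eq_zero_of_ne H hε (congrArg _ heq), eCoef_eq_zero_of_ne H hε' (congrArg _ heq)]
    simp

theorem xCoef_comp_adjSwap {ε : Fin m → Bool} {a : ℕ} (h : a + 1 < m)
    (hε : ε ⟨a, by omega⟩ ≠ ε ⟨a + 1, h⟩) (l : Fin m) :
    xCoef X (ε ∘ adjSwap a h) l = xCoef X ε (adjSwap a h l) := by
  simp only [xCoef, straighten_comp_adjSwap h hε, Function.comp_apply]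

include hR in
theorem sCoef_x_else {ε : Fin m → Bool} {a : ℕ} (h : a + 1 < m) {i : Fin m → kˣ} (l : Fin m)
    (hc : i ⟨a, by omega⟩ ≠ i ⟨a + 1, h⟩ ∨ (l.1 ≠ a ∧ l.1 ≠ a + 1)) :
    sCoef S ε ⟨a, by omega⟩ ⟨a + 1, h⟩ * xCoef X (ε ∘ adjSwap a h) l *
        eCoef e (ε ∘ adjSwap a h) i -
      xCoef X ε (adjSwap a h l) * sCoef S ε ⟨a, by omega⟩ ⟨a + 1, h⟩ *
        eCoef e (ε ∘ adjSwap a h) i = 0 := by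
  by_cases hε : ε ⟨a, by omega⟩ = ε ⟨a + 1, h⟩
  · rw [comp_adjSwap_of_eq h hε, ← sub_mul]
    rcases exists_of_eCoef_ne_zero e ε i with ⟨j, rfl, he⟩ | he
    · have hl : ε (adjSwap a h l) = ε l := congrFun (comp_adjSwap_of_eq h hε) l
      obtain ⟨t, ht, hS, hcase⟩ := exists_adj X S h hε j.1
      have hτ : adjSwap t ht (straighten ε l) = straighten ε (adjSwap a h l) := by
        have h3 : adjSwap t ht =
            Equiv.swap (straighten ε ⟨a, by omega⟩) (straighten ε ⟨a + 1, h⟩) := by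
          rcases hcase with ⟨-, h1, h2, -⟩ | ⟨-, h1, h2, -⟩
          · rw [h1, h2]
          · rw [h1, h2, Equiv.swap_comm]
        rw [h3, (straighten ε).injective.map_swap]
      have hc' : j.1 ⟨t, by omega⟩ ≠ j.1 ⟨t + 1, ht⟩ ∨
          ((straighten ε l).1 ≠ t ∧ (straighten ε l).1 ≠ t + 1) := by
        have hne (l' : Fin m) (hl : l ≠ l') : (straighten ε l).1 ≠ (straighten ε l').1 :=
          fun h => hl ((straighten ε).injective (Fin.ext h))
        rcases hc with hc | hc
        · refine Or.inl fun h1 => hc ?_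
          rcases hcase with ⟨-, -, -, -, -, h2, h3⟩ | ⟨-, -, -, -, -, h2, h3⟩ <;> rw [h2, h3, h1]
        · have n1 := hne ⟨a, by omega⟩ fun h => hc.1 (congrArg _ h)
          have n2 := hne ⟨a + 1, h⟩ fun h => hc.2 (congrArg _ h)
          rcases hcase with ⟨-, h1, h2, -⟩ | ⟨-, h1, h2, -⟩ <;> rw [h1] at n1 <;> rw [h2] at n2
          · exact Or.inr ⟨n1, n2⟩
          · exact Or.inr ⟨n2, n1⟩
      have h4 := hR _ _ (.s_x_else t ht (straighten ε l) j hc')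
      rw [hτ] at h4
      rw [hS, he, xCoef, xCoef, hl]
      split_ifs
      · rw [mul_neg, neg_mul, neg_sub_neg, ← neg_sub, neg_mul, h4, neg_zero]
      · exact h4
    · rw [he, mul_zero]
  · rw [sCoef_of_ne hε, xCoef_comp_adjSwap h hε, one_mul, mul_one, sub_self]

/-- The coefficient of the difference of the two sides of a braid relation. -/
noncomputable def braidCoef (S : (a : ℕ) → a + 1 < m → R) (ε : Fin m → Bool) (a : ℕ)
    (h : a + 2 < m) : R :=
  sCoef S ε ⟨a + 1, by omega⟩ ⟨a + 2, h⟩ *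
      (sCoef S (ε ∘ adjSwap (a + 1) h) ⟨a, by omega⟩ ⟨a + 1, by omega⟩ *
        sCoef S ((ε ∘ adjSwap (a + 1) h) ∘ adjSwap a (by omega)) ⟨a + 1, by omega⟩ ⟨a + 2, h⟩) -
    sCoef S ε ⟨a, by omega⟩ ⟨a + 1, by omega⟩ *
      (sCoef S (ε ∘ adjSwap a (by omega)) ⟨a + 1, by omega⟩ ⟨a + 2, h⟩ *
        sCoef S ((ε ∘ adjSwap a (by omega)) ∘ adjSwap (a + 1) h) ⟨a, by omega⟩ ⟨a + 1, by omega⟩)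

theorem braidCoef_of_ne {ε : Fin m → Bool} {a : ℕ} (h : a + 2 < m)
    (hε : ¬ (ε ⟨a, by omega⟩ = ε ⟨a + 1, by omega⟩ ∧ ε ⟨a + 1, by omega⟩ = ε ⟨a + 2, h⟩)) :
    braidCoef S ε a h = 0 :=
  sub_eq_zero.2 (sCoef_braid h (by tauto))

theorem comp_adjSwap_braid {α : Type*} (ε : Fin m → α) {a : ℕ} (h : a + 2 < m) :
    ((ε ∘ adjSwap (a + 1) h) ∘ adjSwap a (by omega)) ∘ adjSwap (a + 1) h =
      ((ε ∘ adjSwap a (by omega)) ∘ adjSwap (a + 1) h) ∘ adjSwap a (by omega) := by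
  have h₁ : a + 1 < m := by omega
  have hne : (⟨a, by omega⟩ : Fin m) ≠ ⟨a + 2, h⟩ := by simp
  have hσ : adjSwap (a + 1) h * adjSwap a h₁ * adjSwap (a + 1) h =
      adjSwap a h₁ * adjSwap (a + 1) h * adjSwap a h₁ := by
    have h2 := Equiv.swap_mul_swap_mul_swap (x := (⟨a, by omega⟩ : Fin m))
      (y := ⟨a + 1, h₁⟩) (z := ⟨a + 2, h⟩) (by simp) hne
    have h3 := Equiv.swap_mul_swap_mul_swap (x := (⟨a + 2, h⟩ : Fin m))
      (y := ⟨a + 1, h₁⟩) (z := ⟨a, by omega⟩) (by simp) hne.symm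
    rw [Equiv.swap_comm (⟨a + 2, h⟩ : Fin m) ⟨a + 1, h₁⟩,
      Equiv.swap_comm (⟨a + 1, h₁⟩ : Fin m) ⟨a, by omega⟩] at h3
    exact h2.trans ((Equiv.swap_comm _ _).trans h3.symm)
  exact congrArg (fun τ : Equiv.Perm (Fin m) => ε ∘ τ) hσ

theorem comp_adjSwap_braid_of_eq {ε : Fin m → Bool} {a : ℕ} (h : a + 2 < m)
    (h₁ : ε ⟨a, by omega⟩ = ε ⟨a + 1, by omega⟩) (h₂ : ε ⟨a + 1, by omega⟩ = ε ⟨a + 2, h⟩) :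
    ((ε ∘ adjSwap (a + 1) h) ∘ adjSwap a (by omega)) ∘ adjSwap (a + 1) h = ε := by
  have ha : a + 1 < m := by omega
  rw [comp_adjSwap_of_eq (ε := ε) h h₂, comp_adjSwap_of_eq (ε := ε) ha h₁,
    comp_adjSwap_of_eq (ε := ε) h h₂]

/-- Reversing three entries exchanges the two crossings, so for sign `-` the braid difference
changes sign. -/
theorem exists_adj_three (X : Fin m → R) (S : (a : ℕ) → a + 1 < m → R) {ε : Fin m → Bool} {a : ℕ}
    (h : a + 2 < m) (h₁ : ε ⟨a, by omega⟩ = ε ⟨a + 1, by omega⟩)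
    (h₂ : ε ⟨a + 1, by omega⟩ = ε ⟨a + 2, h⟩) (j : Fin m → kˣ) :
    ∃ (t : ℕ) (ht : t + 2 < m),
      (braidCoef S ε a h = S (t + 1) ht * S t (by omega) * S (t + 1) ht -
            S t (by omega) * S (t + 1) ht * S t (by omega) ∧
          xCoef X ε ⟨a, by omega⟩ = X ⟨t, by omega⟩ ∧
          xCoef X ε ⟨a + 1, by omega⟩ = X ⟨t + 1, by omega⟩ ∧
          xCoef X ε ⟨a + 2, h⟩ = X ⟨t + 2, ht⟩ ∧
          liftSeq ε j ⟨a, by omega⟩ = j ⟨t, by omega⟩ ∧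
          liftSeq ε j ⟨a + 1, by omega⟩ = j ⟨t + 1, by omega⟩ ∧
          liftSeq ε j ⟨a + 2, h⟩ = j ⟨t + 2, ht⟩) ∨
        (braidCoef S ε a h = -(S (t + 1) ht * S t (by omega) * S (t + 1) ht -
            S t (by omega) * S (t + 1) ht * S t (by omega)) ∧
          xCoef X ε ⟨a, by omega⟩ = -X ⟨t + 2, by omega⟩ ∧
          xCoef X ε ⟨a + 1, by omega⟩ = -X ⟨t + 1, by omega⟩ ∧
          xCoef X ε ⟨a + 2, h⟩ = -X ⟨t, by omega⟩ ∧
          liftSeq ε j ⟨a, by omega⟩ = (j ⟨t + 2, ht⟩)⁻¹ ∧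
          liftSeq ε j ⟨a + 1, by omega⟩ = (j ⟨t + 1, by omega⟩)⁻¹ ∧
          liftSeq ε j ⟨a + 2, h⟩ = (j ⟨t, by omega⟩)⁻¹) := by
  have ha : a + 1 < m := by omega
  have hb : braidCoef S ε a h =
      sCoef S ε ⟨a + 1, ha⟩ ⟨a + 2, h⟩ * (sCoef S ε ⟨a, by omega⟩ ⟨a + 1, ha⟩ *
        sCoef S ε ⟨a + 1, ha⟩ ⟨a + 2, h⟩) -
      sCoef S ε ⟨a, by omega⟩ ⟨a + 1, ha⟩ * (sCoef S ε ⟨a + 1, ha⟩ ⟨a + 2, h⟩ *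
        sCoef S ε ⟨a, by omega⟩ ⟨a + 1, ha⟩) := by
    unfold braidCoef
    rw [comp_adjSwap_of_eq (ε := ε) h h₂, comp_adjSwap_of_eq (ε := ε) ha h₁,
      comp_adjSwap_of_eq (ε := ε) h h₂]
  obtain ⟨t, ht, hS, hc⟩ := exists_adj X S ha h₁ j
  obtain ⟨t', ht', hS', hc'⟩ := exists_adj X S h h₂ j
  rcases hc with ⟨ha, s1, s2, x1, x2, l1, l2⟩ | ⟨ha, s1, s2, x1, x2, l1, l2⟩
  · rcases hc' with ⟨hb', s3, s4, x3, x4, l3, l4⟩ | ⟨hb', -⟩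
    · obtain rfl : t' = t + 1 := (Fin.mk.inj (s3.symm.trans s2))
      refine ⟨t, ht', Or.inl ⟨?_, x1, x2, x4, l1, l2, l4⟩⟩
      rw [hb, hS, hS', mul_assoc, mul_assoc]
    · rw [h₁, hb'] at ha
      exact absurd ha (by simp)
  · rcases hc' with ⟨hb', -⟩ | ⟨hb', s3, s4, x3, x4, l3, l4⟩
    · rw [h₁, hb'] at ha
      exact absurd ha (by simp)
    · obtain rfl : t = t' + 1 := (Fin.mk.inj (s2.symm.trans s3))
      refine ⟨t', ht, Or.inr ⟨?_, x1, x2, x4, l1, l2, l4⟩⟩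
      rw [hb, hS, hS', neg_sub, mul_assoc, mul_assoc]

include hR in
theorem braidCoef_zero {ε ε' : Fin m → Bool} {a : ℕ} (h : a + 2 < m)
    (hε' : ε' = ((ε ∘ adjSwap (a + 1) h) ∘ adjSwap a (by omega)) ∘ adjSwap (a + 1) h)
    {i : Fin m → kˣ}
    (hc : i ⟨a, by omega⟩ ≠ i ⟨a + 2, h⟩ ∨
      (¬ Arrow p (i ⟨a, by omega⟩) (i ⟨a + 1, by omega⟩) ∧
        ¬ Arrow p (i ⟨a + 1, by omega⟩) (i ⟨a, by omega⟩))) :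
    braidCoef S ε a h * eCoef e ε' i = 0 := by
  by_cases hε : ε ⟨a, by omega⟩ = ε ⟨a + 1, by omega⟩ ∧ ε ⟨a + 1, by omega⟩ = ε ⟨a + 2, h⟩
  · rw [hε', comp_adjSwap_braid_of_eq h hε.1 hε.2]
    rcases exists_of_eCoef_ne_zero e ε i with ⟨j, rfl, he⟩ | he
    · obtain ⟨t, ht, ⟨hb, -, -, -, l1, l2, l3⟩ | ⟨hb, -, -, -, l1, l2, l3⟩⟩ :=
        exists_adj_three X S h hε.1 hε.2 j.1 <;>
        rw [l1, l2, l3] at hc <;> rw [hb, he]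
      · exact hR _ _ (.braid_zero t ht j hc)
      · rw [arrow_inv_iff, arrow_inv_iff] at hc
        rw [neg_mul, neg_eq_zero]
        refine hR _ _ (.braid_zero t ht j ?_)
        by_cases h1 : j.1 ⟨t, by omega⟩ = j.1 ⟨t + 2, ht⟩
        · rw [h1] at hc ⊢
          exact Or.inr (And.symm (hc.resolve_left fun h => h rfl))
        · exact Or.inl h1
    · rw [he, mul_zero]
  · rw [braidCoef_of_ne h hε, zero_mul]

include H in
-- The correction term of a braid relation involves three entries of one sign; at a pattern that is
-- not constant on them both sides vanish.
theorem braidCoef_ne {ε ε' : Fin m → Bool} {a : ℕ} (h : a + 2 < m) {i : Fin m → kˣ}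
    (hε : ¬ (ε ⟨a, by omega⟩ = ε ⟨a + 1, by omega⟩ ∧ ε ⟨a + 1, by omega⟩ = ε ⟨a + 2, h⟩))
    (heq : i ⟨a, by omega⟩ = i ⟨a + 2, h⟩)
    (hi : isNeg p lam (i ⟨a, by omega⟩) = isNeg p lam (i ⟨a + 1, by omega⟩)) :
    braidCoef S ε a h * eCoef e ε' i = 0 ∧ eCoef e ε i = 0 := by
  refine ⟨by rw [braidCoef_of_ne h hε, zero_mul], ?_⟩
  by_cases h1 : ε ⟨a, by omega⟩ = ε ⟨a + 1, by omega⟩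
  · exact eCoef_eq_zero_of_ne H (fun h2 => hε ⟨h1, h2⟩) (hi.symm.trans (congrArg _ heq))
  · exact eCoef_eq_zero_of_ne H h1 hi

include H hR in
-- For sign `-` inversion reverses the arrow, and as the outer entries are equal the reversed order
-- does not turn it back. The opposite relation applies, and its sign cancels that of the braid
-- difference.
theorem braidCoef_right {ε ε' : Fin m → Bool} {a : ℕ} (h : a + 2 < m)
    (hε' : ε' = ((ε ∘ adjSwap (a + 1) h) ∘ adjSwap a (by omega)) ∘ adjSwap (a + 1) h)
    {i : Fin m → kˣ} (heq : i ⟨a, by omega⟩ = i ⟨a + 2, h⟩)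
    (h₁ : Arrow p (i ⟨a, by omega⟩) (i ⟨a + 1, by omega⟩))
    (h₂ : ¬ Arrow p (i ⟨a + 1, by omega⟩) (i ⟨a, by omega⟩)) :
    braidCoef S ε a h * eCoef e ε' i = eCoef e ε i := by
  by_cases hε : ε ⟨a, by omega⟩ = ε ⟨a + 1, by omega⟩ ∧ ε ⟨a + 1, by omega⟩ = ε ⟨a + 2, h⟩
  · rw [hε', comp_adjSwap_braid_of_eq h hε.1 hε.2]
    rcases exists_of_eCoef_ne_zero e ε i with ⟨j, rfl, he⟩ | he
    · obtain ⟨t, ht, ⟨hb, -, -, -, l1, l2, l3⟩ | ⟨hb, -, -, -, l1, l2, l3⟩⟩ :=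
        exists_adj_three X S h hε.1 hε.2 j.1 <;>
        rw [l1, l2] at h₁ h₂ <;> rw [l1, l3] at heq <;> rw [hb, he]
      · exact hR _ _ (.braid_right t ht j heq h₁ h₂)
      · rw [arrow_inv_iff, inv_injective heq] at h₁ h₂
        rw [neg_mul, neg_eq_iff_eq_neg]
        exact hR _ _ (.braid_left t ht j (inv_injective heq).symm h₂ h₁)
    · rw [he, mul_zero]
  · obtain ⟨h3, h4⟩ := braidCoef_ne (S := S) (e := e) (ε' := ε') H h hε heq h₁.isNeg_eq
    rw [h3, h4]

include H hR in
theorem braidCoef_left {ε ε' : Fin m → Bool} {a : ℕ} (h : a + 2 < m)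
    (hε' : ε' = ((ε ∘ adjSwap (a + 1) h) ∘ adjSwap a (by omega)) ∘ adjSwap (a + 1) h)
    {i : Fin m → kˣ} (heq : i ⟨a, by omega⟩ = i ⟨a + 2, h⟩)
    (h₁ : ¬ Arrow p (i ⟨a, by omega⟩) (i ⟨a + 1, by omega⟩))
    (h₂ : Arrow p (i ⟨a + 1, by omega⟩) (i ⟨a, by omega⟩)) :
    braidCoef S ε a h * eCoef e ε' i = -eCoef e ε i := by
  by_cases hε : ε ⟨a, by omega⟩ = ε ⟨a + 1, by omega⟩ ∧ ε ⟨a + 1, by omega⟩ = ε ⟨a + 2, h⟩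
  · rw [hε', comp_adjSwap_braid_of_eq h hε.1 hε.2]
    rcases exists_of_eCoef_ne_zero e ε i with ⟨j, rfl, he⟩ | he
    · obtain ⟨t, ht, ⟨hb, -, -, -, l1, l2, l3⟩ | ⟨hb, -, -, -, l1, l2, l3⟩⟩ :=
        exists_adj_three X S h hε.1 hε.2 j.1 <;>
        rw [l1, l2] at h₁ h₂ <;> rw [l1, l3] at heq <;> rw [hb, he]
      · exact hR _ _ (.braid_left t ht j heq h₁ h₂)
      · rw [arrow_inv_iff, inv_injective heq] at h₁ h₂
        rw [neg_mul, neg_inj]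
        exact hR _ _ (.braid_right t ht j (inv_injective heq).symm h₂ h₁)
    · rw [he, mul_zero, neg_zero]
  · obtain ⟨h3, h4⟩ := braidCoef_ne (S := S) (e := e) (ε' := ε') H h hε heq h₂.isNeg_eq.symm
    rw [h3, h4, neg_zero]

include H hR in
theorem braidCoef_both {ε ε' : Fin m → Bool} {a : ℕ} (h : a + 2 < m)
    (hε' : ε' = ((ε ∘ adjSwap (a + 1) h) ∘ adjSwap a (by omega)) ∘ adjSwap (a + 1) h)
    {i : Fin m → kˣ} (heq : i ⟨a, by omega⟩ = i ⟨a + 2, h⟩)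
    (h₁ : Arrow p (i ⟨a, by omega⟩) (i ⟨a + 1, by omega⟩))
    (h₂ : Arrow p (i ⟨a + 1, by omega⟩) (i ⟨a, by omega⟩)) :
    braidCoef S ε a h * eCoef e ε' i =
      (2 * xCoef X ε ⟨a + 1, by omega⟩ - xCoef X ε ⟨a + 2, h⟩ - xCoef X ε ⟨a, by omega⟩) *
        eCoef e ε i := by
  by_cases hε : ε ⟨a, by omega⟩ = ε ⟨a + 1, by omega⟩ ∧ ε ⟨a + 1, by omega⟩ = ε ⟨a + 2, h⟩
  · rw [hε', comp_adjSwap_braid_of_eq h hε.1 hε.2]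
    rcases exists_of_eCoef_ne_zero e ε i with ⟨j, rfl, he⟩ | he
    · obtain ⟨t, ht, ⟨hb, x1, x2, x3, l1, l2, l3⟩ | ⟨hb, x1, x2, x3, l1, l2, l3⟩⟩ :=
        exists_adj_three X S h hε.1 hε.2 j.1 <;>
        rw [l1, l2] at h₁ h₂ <;> rw [l1, l3] at heq <;> rw [hb, he, x1, x2, x3]
      · exact hR _ _ (.braid_both t ht j heq h₁ h₂)
      · rw [arrow_inv_iff, inv_injective heq] at h₁ h₂
        rw [neg_mul, hR _ _ (.braid_both t ht j (inv_injective heq).symm h₂ h₁)]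
        noncomm_ring
    · rw [he, mul_zero, mul_zero]
  · obtain ⟨h3, h4⟩ := braidCoef_ne (S := S) (e := e) (ε' := ε') H h hε heq h₁.isNeg_eq
    rw [h3, h4, mul_zero]

end CoefficientRelations

/-! ### The representation on functions from sign patterns to `R` -/

section Representation

variable {k : Type u} [Field k] {p q lam : kˣ} {ν ν' : kˣ →₀ ℕ} {m : ℕ}
variable {R : Type w} [Ring R]

/-- The operator `f ↦ (ε ↦ c ε * f (g ε))` on functions. -/
def monomialEnd (k : Type u) [Field k] [Algebra k R] {Ω : Type*} (c : Ω → R) (g : Ω → Ω) :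
    Module.End k (Ω → R) where
  toFun f ε := c ε * f (g ε)
  map_add' _ _ := funext fun _ => mul_add _ _ _
  map_smul' _ _ := funext fun _ => mul_smul_comm _ _ _

theorem monomialEnd_apply [Algebra k R] {Ω : Type*} (c : Ω → R) (g : Ω → Ω) (f : Ω → R) (ε : Ω) :
    monomialEnd k c g f ε = c ε * f (g ε) := rfl

section Apply

variable [Algebra k R] {Ω : Type*} (F G : Module.End k (Ω → R)) (f : Ω → R) (ε : Ω)

theorem end_mul_apply : (F * G) f ε = F (G f) ε := rfl

theorem end_sub_apply : (F - G) f ε = F f ε - G f ε := rfl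

theorem end_two_apply : (2 : Module.End k (Ω → R)) f ε = 2 * f ε := by
  rw [← one_add_one_eq_two, ← one_add_one_eq_two, add_mul, one_mul]
  rfl

end Apply

variable (X : Fin m → R) (S : (a : ℕ) → a + 1 < m → R) (e : klrSeq ν' m → R)
variable [Algebra k R]

/-- The action of `x_l`. -/
noncomputable def repX (k : Type u) [Field k] [Algebra k R] (l : Fin m) :
    Module.End k ((Fin m → Bool) → R) :=
  monomialEnd k (fun ε => xCoef X ε l) id

/-- The action of `σ_a`. -/
noncomputable def repS (k : Type u) [Field k] [Algebra k R] (a : ℕ) (h : a + 1 < m) :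
    Module.End k ((Fin m → Bool) → R) :=
  monomialEnd k (fun ε => sCoef S ε ⟨a, by omega⟩ ⟨a + 1, h⟩) (· ∘ adjSwap a h)

/-- The action of `e(i)`. -/
noncomputable def repE (i : vvSeq ν m) : Module.End k ((Fin m → Bool) → R) :=
  monomialEnd k (fun ε => eCoef e ε i.1) id

variable (R m) in
/-- The action of `π`. -/
noncomputable def repPi (k : Type u) [Field k] [Algebra k R] (h : 0 < m) :
    Module.End k ((Fin m → Bool) → R) :=
  monomialEnd k (fun _ => 1) (flipFirst h)

variable {X S e} (H : Admissible p q lam ν ν')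
  (hR : ∀ a b, KLRRel p (klrSeq ν' m) X S e a b → a = b)

include H in
-- At a fixed pattern `ε` each `e j` occurs for exactly one `i`, namely `liftSeq ε j`.
theorem sum_repE (hsum : ∑ j, e j = 1) :
    (∑ i : vvSeq ν m, repE e i) = (1 : Module.End k ((Fin m → Bool) → R)) := by
  classical
  refine LinearMap.ext fun f => funext fun ε => ?_
  rw [LinearMap.sum_apply, Finset.sum_apply]
  simp only [repE, monomialEnd_apply, id, ← Finset.sum_mul]
  refine Eq.trans ?_ (one_mul (f ε))
  congr 1
  simp only [eCoef]
  rw [Finset.sum_comm, ← hsum]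
  refine Finset.sum_congr rfl fun j _ => ?_
  rw [Finset.sum_eq_single ⟨liftSeq ε j.1, H.liftSeq_mem_vvSeq ε j.2⟩]
  · rw [if_pos rfl]
  · exact fun i _ hi => if_neg fun h => hi (Subtype.ext h.symm)
  · exact fun h => absurd (Finset.mem_univ _) h

theorem comp_adjSwap_comm {α : Type*} (ε : Fin m → α) {a b : ℕ} (ha : a + 1 < m) (hb : b + 1 < m)
    (h₁ : a ≠ b + 1) (h₂ : b ≠ a + 1) :
    (ε ∘ adjSwap a ha) ∘ adjSwap b hb = (ε ∘ adjSwap b hb) ∘ adjSwap a ha := by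
  by_cases hab : a = b
  · subst hab
    rfl
  have hσ : adjSwap a ha * adjSwap b hb = adjSwap b hb * adjSwap a ha := by
    refine (Equiv.Perm.disjoint_swap_swap ?_).commute
    simp only [List.nodup_cons, List.mem_cons, Fin.mk.injEq, List.not_mem_nil, or_false,
      List.nodup_nil]
    refine ⟨by omega, by omega, ?_⟩
    simp
  exact congrArg (fun τ : Equiv.Perm (Fin m) => ε ∘ τ) hσ

/-- Both sides change the first two signs and leave the others alone. -/
theorem flipFirst_comp_adjSwap_zero (h : 1 < m) (ε : Fin m → Bool) :
    flipFirst (by omega) (flipFirst (by omega) (ε ∘ adjSwap 0 h) ∘ adjSwap 0 h) =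
      flipFirst (by omega) (flipFirst (by omega) ε ∘ adjSwap 0 h) ∘ adjSwap 0 h := by
  have h0 : 0 < m := by omega
  have e1 : adjSwap 0 h ⟨0, by omega⟩ = ⟨1, h⟩ := Equiv.swap_apply_left _ _
  have e2 : adjSwap 0 h ⟨1, h⟩ = ⟨0, by omega⟩ := Equiv.swap_apply_right _ _
  funext ⟨l, hl⟩
  by_cases hl0 : l = 0
  · subst hl0
    simp [flipFirst_apply, e1, e2]
  by_cases hl1 : l = 1
  · subst hl1
    simp [flipFirst_apply, e1, e2]
  have e3 : adjSwap 0 h ⟨l, hl⟩ = ⟨l, hl⟩ :=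
    Equiv.swap_apply_of_ne_of_ne (by simpa using hl0) (by simpa using hl1)
  simp [flipFirst_apply, e3, hl0]

theorem xCoef_flipFirst (h : 0 < m) (ε : Fin m → Bool) (l : Fin m) :
    xCoef X (flipFirst h ε) l = if l.1 = 0 then -xCoef X ε l else xCoef X ε l := by
  simp only [xCoef, straighten_flipFirst, flipFirst_apply]
  by_cases hl : l.1 = 0
  · cases ε l <;> simp [hl]
  · simp [hl]

theorem repS_sq_mul_repE_apply (a : ℕ) (h : a + 1 < m) (i : vvSeq ν m)
    (f : (Fin m → Bool) → R) (ε : Fin m → Bool) :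
    (repS S k a h * repS S k a h * repE e i) f ε =
      sCoef S ε ⟨a, by omega⟩ ⟨a + 1, h⟩ *
        sCoef S (ε ∘ adjSwap a h) ⟨a, by omega⟩ ⟨a + 1, h⟩ * eCoef e ε i.1 * f ε := by
  have h1 : (repS S k a h * repS S k a h * repE e i) f ε =
      sCoef S ε ⟨a, by omega⟩ ⟨a + 1, h⟩ *
        (sCoef S (ε ∘ adjSwap a h) ⟨a, by omega⟩ ⟨a + 1, h⟩ *
          (eCoef e ((ε ∘ adjSwap a h) ∘ adjSwap a h) i.1 *
            f ((ε ∘ adjSwap a h) ∘ adjSwap a h))) := rfl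
  rw [h1, comp_adjSwap_adjSwap, mul_assoc, mul_assoc]

theorem repS_braid_mul_repE_apply (a : ℕ) (h : a + 2 < m) (i : vvSeq ν m)
    (f : (Fin m → Bool) → R) (ε : Fin m → Bool) :
    ((repS S k (a + 1) h * repS S k a (by omega) * repS S k (a + 1) h -
        repS S k a (by omega) * repS S k (a + 1) h * repS S k a (by omega)) * repE e i) f ε =
      braidCoef S ε a h *
        eCoef e (((ε ∘ adjSwap (a + 1) h) ∘ adjSwap a (by omega)) ∘ adjSwap (a + 1) h) i.1 *
        f (((ε ∘ adjSwap (a + 1) h) ∘ adjSwap a (by omega)) ∘ adjSwap (a + 1) h) := by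
  rw [sub_mul, end_sub_apply, braidCoef, sub_mul, sub_mul]
  congr 1
  · simp only [mul_assoc]
    rfl
  · rw [comp_adjSwap_braid]
    simp only [mul_assoc]
    rfl

theorem repS_repX_apply (a : ℕ) (h : a + 1 < m) (l l' : Fin m) (i : vvSeq ν m)
    (f : (Fin m → Bool) → R) (ε : Fin m → Bool) :
    ((repS S k a h * repX X k l - repX X k l' * repS S k a h) * repE e i) f ε =
      (sCoef S ε ⟨a, by omega⟩ ⟨a + 1, h⟩ * xCoef X (ε ∘ adjSwap a h) l *
          eCoef e (ε ∘ adjSwap a h) i.1 -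
        xCoef X ε l' * sCoef S ε ⟨a, by omega⟩ ⟨a + 1, h⟩ *
          eCoef e (ε ∘ adjSwap a h) i.1) * f (ε ∘ adjSwap a h) := by
  rw [sub_mul, end_sub_apply, sub_mul]
  simp only [mul_assoc]
  rfl

omit [Algebra k R] in
include H in
-- The operators evaluate `f` at the permuted pattern, the correction term at `ε`. Where the
-- coefficient is nonzero the two signs agree, so both patterns coincide.
theorem eCoef_mul_comp_adjSwap {a : ℕ} (h : a + 1 < m) (i : Fin m → kˣ)
    (heq : i ⟨a, by omega⟩ = i ⟨a + 1, h⟩) (f : (Fin m → Bool) → R) (ε : Fin m → Bool) :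
    eCoef e ε i * f (ε ∘ adjSwap a h) = eCoef e ε i * f ε := by
  by_cases hε : ε ⟨a, by omega⟩ = ε ⟨a + 1, h⟩
  · rw [comp_adjSwap_of_eq h hε]
  · rw [eCoef_eq_zero_of_ne H hε (congrArg _ heq), zero_mul, zero_mul]

omit [Algebra k R] in
include H in
theorem eCoef_mul_comp_braid {a : ℕ} (h : a + 2 < m) (i : Fin m → kˣ)
    (heq : i ⟨a, by omega⟩ = i ⟨a + 2, h⟩)
    (hi : isNeg p lam (i ⟨a, by omega⟩) = isNeg p lam (i ⟨a + 1, by omega⟩))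
    (f : (Fin m → Bool) → R) (ε : Fin m → Bool) :
    eCoef e ε i * f (((ε ∘ adjSwap (a + 1) h) ∘ adjSwap a (by omega)) ∘ adjSwap (a + 1) h) =
      eCoef e ε i * f ε := by
  by_cases hε : ε ⟨a, by omega⟩ = ε ⟨a + 1, by omega⟩ ∧ ε ⟨a + 1, by omega⟩ = ε ⟨a + 2, h⟩
  · rw [comp_adjSwap_braid_of_eq h hε.1 hε.2]
  -- Only the vanishing of `eCoef` is needed; `S := 0` and `ε' := ε` are placeholders.
  · rw [(braidCoef_ne (S := fun _ _ => (0 : R)) (ε' := ε) H h hε heq hi).2, zero_mul, zero_mul]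

include H hR in
-- All operators are monomial, so each relation reduces to an identity of left coefficients at one
-- pattern `ε`, proved above.
theorem rep_klrRel (hsum : ∑ j, e j = 1) (a b : Module.End k ((Fin m → Bool) → R))
    (hab : KLRRel p (vvSeq ν m) (repX X k) (repS S k) (repE e) a b) : a = b := by
  cases hab with
  | sum_e => exact sum_repE H hsum
  | e_mul_self i =>
    refine LinearMap.ext fun f => funext fun ε => ?_
    exact (mul_assoc _ _ _).symm.trans (congrArg (· * f ε) (eCoef_mul_self hR ε i.1))
  | e_mul_ne i j hij =>
    refine LinearMap.ext fun f => funext fun ε => ?_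
    refine (mul_assoc _ _ _).symm.trans ((congrArg (· * f ε)
      (eCoef_mul_ne hR ε fun h => hij (Subtype.ext h))).trans (zero_mul _))
  | s_e a h i j hj =>
    refine LinearMap.ext fun f => funext fun ε => ?_
    have h1 := sCoef_mul_eCoef hR (ε := ε) h i.1
    rw [← hj] at h1
    exact (mul_assoc _ _ _).symm.trans ((congrArg (· * f (ε ∘ adjSwap a h)) h1).trans
      (mul_assoc _ _ _))
  | x_e l i =>
    refine LinearMap.ext fun f => funext fun ε => ?_
    exact (mul_assoc _ _ _).symm.trans ((congrArg (· * f ε) (xCoef_mul_eCoef hR ε l i.1)).trans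
      (mul_assoc _ _ _))
  | x_comm l l' =>
    refine LinearMap.ext fun f => funext fun ε => ?_
    exact (mul_assoc _ _ _).symm.trans ((congrArg (· * f ε) (xCoef_comm hR ε l l')).trans
      (mul_assoc _ _ _))
  | s_sq_none a h i hne h₁ h₂ =>
    refine LinearMap.ext fun f => funext fun ε => ?_
    rw [repS_sq_mul_repE_apply, sCoef_sq_none hR h hne h₁ h₂]
    rfl
  | s_sq_left a h i hne h₁ h₂ =>
    refine LinearMap.ext fun f => funext fun ε => ?_
    rw [repS_sq_mul_repE_apply, sCoef_sq_left H hR h hne h₁ h₂, sub_mul, sub_mul, sub_mul,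
      mul_assoc, mul_assoc]
    rfl
  | s_sq_right a h i hne h₁ h₂ =>
    refine LinearMap.ext fun f => funext fun ε => ?_
    rw [repS_sq_mul_repE_apply, sCoef_sq_right H hR h hne h₁ h₂, sub_mul, sub_mul, sub_mul,
      mul_assoc, mul_assoc]
    rfl
  | s_sq_both a h i hne h₁ h₂ =>
    refine LinearMap.ext fun f => funext fun ε => ?_
    rw [repS_sq_mul_repE_apply, sCoef_sq_both H hR h hne h₁ h₂, mul_assoc, mul_assoc, sub_mul,
      sub_mul]
    rfl
  | s_sq_eq a h i heq =>
    refine LinearMap.ext fun f => funext fun ε => ?_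
    rw [repS_sq_mul_repE_apply, sCoef_sq_eq H hR h heq, zero_mul]
    rfl
  | s_comm a b ha hb h₁ h₂ =>
    refine LinearMap.ext fun f => funext fun ε => ?_
    by_cases hab : a = b
    · subst hab
      rfl
    have h3 : sCoef S (ε ∘ adjSwap a ha) ⟨b, by omega⟩ ⟨b + 1, hb⟩ =
        sCoef S ε ⟨b, by omega⟩ ⟨b + 1, hb⟩ :=
      sCoef_comp_adjSwap_of_ne ha (by simpa using Ne.symm hab) h₂ (by simpa using Ne.symm h₁)
        (by simpa using Ne.symm hab)
    have h4 : sCoef S (ε ∘ adjSwap b hb) ⟨a, by omega⟩ ⟨a + 1, ha⟩ =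
        sCoef S ε ⟨a, by omega⟩ ⟨a + 1, ha⟩ :=
      sCoef_comp_adjSwap_of_ne hb (by simpa using hab) h₁ (by simpa using Ne.symm h₂)
        (by simpa using hab)
    have h5 : (repS S k a ha * repS S k b hb) f ε =
        sCoef S ε ⟨a, by omega⟩ ⟨a + 1, ha⟩ *
          (sCoef S (ε ∘ adjSwap a ha) ⟨b, by omega⟩ ⟨b + 1, hb⟩ *
            f ((ε ∘ adjSwap a ha) ∘ adjSwap b hb)) := rfl
    have h6 : (repS S k b hb * repS S k a ha) f ε =
        sCoef S ε ⟨b, by omega⟩ ⟨b + 1, hb⟩ *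
          (sCoef S (ε ∘ adjSwap b hb) ⟨a, by omega⟩ ⟨a + 1, ha⟩ *
            f ((ε ∘ adjSwap b hb) ∘ adjSwap a ha)) := rfl
    rw [h5, h6, h3, h4, comp_adjSwap_comm ε ha hb h₁ h₂, ← mul_assoc, ← mul_assoc,
      sCoef_comm hR ε ha hb h₁ h₂]
  | braid_zero a h i hc =>
    refine LinearMap.ext fun f => funext fun ε => ?_
    rw [repS_braid_mul_repE_apply, braidCoef_zero hR h rfl hc, zero_mul]
    rfl
  | braid_right a h i heq h₁ h₂ =>
    refine LinearMap.ext fun f => funext fun ε => ?_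
    rw [repS_braid_mul_repE_apply, braidCoef_right H hR h rfl heq h₁ h₂,
      eCoef_mul_comp_braid H h i.1 heq h₁.isNeg_eq]
    rfl
  | braid_left a h i heq h₁ h₂ =>
    refine LinearMap.ext fun f => funext fun ε => ?_
    rw [repS_braid_mul_repE_apply, braidCoef_left H hR h rfl heq h₁ h₂, neg_mul,
      eCoef_mul_comp_braid H h i.1 heq h₂.isNeg_eq.symm]
    rfl
  | braid_both a h i heq h₁ h₂ =>
    refine LinearMap.ext fun f => funext fun ε => ?_
    rw [repS_braid_mul_repE_apply, braidCoef_both H hR h rfl heq h₁ h₂, mul_assoc,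
      eCoef_mul_comp_braid H h i.1 heq h₁.isNeg_eq, end_mul_apply, end_sub_apply, end_sub_apply,
      end_mul_apply, end_two_apply, sub_mul, sub_mul, mul_assoc]
    rfl
  | s_x_left a h i heq =>
    refine LinearMap.ext fun f => funext fun ε => ?_
    rw [repS_repX_apply, sCoef_x_left H hR h heq, neg_mul, eCoef_mul_comp_adjSwap H h i.1 heq]
    rfl
  | s_x_right a h i heq =>
    refine LinearMap.ext fun f => funext fun ε => ?_
    rw [repS_repX_apply, sCoef_x_right H hR h heq, eCoef_mul_comp_adjSwap H h i.1 heq]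
    rfl
  | s_x_else a h l i hc =>
    refine LinearMap.ext fun f => funext fun ε => ?_
    rw [repS_repX_apply, sCoef_x_else hR h l hc, zero_mul]
    rfl

include H hR in
theorem rep_vvRel (hsum : ∑ j, e j = 1) (a b : Module.End k ((Fin m → Bool) → R))
    (hab : VVRel p q (vvSeq ν m) (repX X k) (repS S k) (repE e) (repPi m R k) a b) : a = b := by
  cases hab with
  | klr a b h => exact rep_klrRel H hR hsum a b h
  | pi_e h i j hj =>
    refine LinearMap.ext fun f => funext fun ε => ?_
    have h1 := eCoef_flipFirst (e := e) h ε i.1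
    rw [show reflect 0 h i.1 = j.1 from hj.symm] at h1
    change 1 * (eCoef e (flipFirst h ε) i.1 * f (flipFirst h ε)) =
      eCoef e ε j.1 * (1 * f (flipFirst h ε))
    rw [h1, one_mul, one_mul]
  | pi_sq_pos h i hq => exact absurd hq (H.ne_q i.2 _)
  | pi_sq_neg h i hq => exact absurd hq (H.ne_q_inv i.2 _)
  | pi_sq_else h i hq hq' =>
    refine LinearMap.ext fun f => funext fun ε => ?_
    change 1 * (1 * (eCoef e (flipFirst h (flipFirst h ε)) i.1 *
      f (flipFirst h (flipFirst h ε)))) = eCoef e ε i.1 * f ε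
    rw [flipFirst_flipFirst, one_mul, one_mul]
  | pi_x_zero h =>
    refine LinearMap.ext fun f => funext fun ε => ?_
    change 1 * (xCoef X (flipFirst h ε) ⟨0, h⟩ * f (flipFirst h ε)) =
      -(xCoef X ε ⟨0, h⟩ * (1 * f (flipFirst h ε)))
    rw [xCoef_flipFirst, if_pos rfl, one_mul, one_mul, neg_mul]
  | pi_x h l hl =>
    refine LinearMap.ext fun f => funext fun ε => ?_
    change 1 * (xCoef X (flipFirst h ε) l * f (flipFirst h ε)) =
      xCoef X ε l * (1 * f (flipFirst h ε))
    rw [xCoef_flipFirst, if_neg hl.ne', one_mul, one_mul]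
  | braid_zero h i hc =>
    refine LinearMap.ext fun f => funext fun ε => ?_
    have h0 : 0 < m := by omega
    have h1 : (((repS S k 0 h * repPi m R k h0) ^ 2 * repE e i) f) ε =
        sCoef S ε ⟨0, h0⟩ ⟨1, h⟩ * (1 * (sCoef S (flipFirst h0 (ε ∘ adjSwap 0 h)) ⟨0, h0⟩ ⟨1, h⟩ *
          (1 * repE e i f (flipFirst h0 (flipFirst h0 (ε ∘ adjSwap 0 h) ∘ adjSwap 0 h))))) := by
      rw [pow_two]
      rfl
    have h2 : (((repPi m R k h0 * repS S k 0 h) ^ 2 * repE e i) f) ε =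
        1 * (sCoef S (flipFirst h0 ε) ⟨0, h0⟩ ⟨1, h⟩ *
          (1 * (sCoef S (flipFirst h0 (flipFirst h0 ε ∘ adjSwap 0 h)) ⟨0, h0⟩ ⟨1, h⟩ *
            repE e i f (flipFirst h0 (flipFirst h0 ε ∘ adjSwap 0 h) ∘ adjSwap 0 h)))) := by
      rw [pow_two]
      rfl
    rw [end_sub_apply, h1, h2, flipFirst_comp_adjSwap_zero, one_mul, one_mul, one_mul, one_mul,
      ← mul_assoc, ← mul_assoc, sCoef_braid_zero, sub_self]
    rfl
  | braid_pos h i h₁ h₂ => exact absurd h₂ (H.ne_q_inv i.2 _)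
  | braid_neg h i h₁ h₂ => exact absurd h₂ (H.ne_q i.2 _)
  | pi_s a h ha =>
    refine LinearMap.ext fun f => funext fun ε => ?_
    have h0 : 0 < m := by omega
    change 1 * (sCoef S (flipFirst h0 ε) ⟨a, by omega⟩ ⟨a + 1, h⟩ *
      f (flipFirst h0 ε ∘ adjSwap a h)) =
      sCoef S ε ⟨a, by omega⟩ ⟨a + 1, h⟩ * (1 * f (flipFirst h0 (ε ∘ adjSwap a h)))
    rw [sCoef_flipFirst h0 (by simpa using ha) (by simp), one_mul, one_mul,
      flipFirst_comp_adjSwap h ha]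

end Representation

/-! ### Injectivity and the main theorem -/

section Faithful

variable {k : Type u} [Field k] {p q lam : kˣ} {ν ν' : kˣ →₀ ℕ} {m : ℕ}
variable (H : Admissible p q lam ν ν')

open VVAlgebra (seqE seqE_of_mem cross)

namespace Admissible

/-- The representation of the VV algebra on the functions from sign patterns to the KLR algebra. -/
noncomputable def signRep :
    VVAlgebra p q ν m →ₐ[k] Module.End k ((Fin m → Bool) → KLRAlgebra p ν' m) :=
  VVAlgebra.lift (repX (fun l => KLRAlgebra.gen p ν' m (.x l)) k)
    (repS (fun a h => KLRAlgebra.gen p ν' m (.s a h)) k)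
    (repE fun i => KLRAlgebra.gen p ν' m (.e i)) (repPi m (KLRAlgebra p ν' m) k)
    (rep_vvRel H (fun _ _ => KLRAlgebra.eq_of_rel) (KLRAlgebra.eq_of_rel .sum_e))

theorem signRep_x (l : Fin m) : H.signRep (VVAlgebra.gen p q ν m (.x l)) =
    repX (fun l => KLRAlgebra.gen p ν' m (.x l)) k l :=
  VVAlgebra.lift_x _ l

theorem signRep_s (a : ℕ) (h : a + 1 < m) : H.signRep (VVAlgebra.gen p q ν m (.s a h)) =
    repS (fun a h => KLRAlgebra.gen p ν' m (.s a h)) k a h :=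
  VVAlgebra.lift_s _ a h

theorem signRep_toCorner_e (i : klrSeq ν' m) (f : (Fin m → Bool) → KLRAlgebra p ν' m) :
    H.signRep (H.toCorner (KLRAlgebra.gen p ν' m (.e i))).1 f (fun _ => false) =
      KLRAlgebra.gen p ν' m (.e i) * f fun _ => false := by
  rw [toCorner_e, seqE_of_mem (H.mem_vvSeq i.2), signRep, VVAlgebra.lift_e]
  have h1 := eCoef_liftSeq (e := fun i => KLRAlgebra.gen p ν' m (.e i)) (fun _ => false) i
  rw [liftSeq_false] at h1
  exact congrArg (· * f fun _ => false) h1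

/-- Here `φ(1) = e₀`. Its effect at the all-positive pattern must be known first, because the images
of `x_l` and `σ_a` contain the factor `e₀`. -/
theorem signRep_toCorner_one (f : (Fin m → Bool) → KLRAlgebra p ν' m) :
    H.signRep (H.toCorner 1).1 f (fun _ => false) = f fun _ => false := by
  have h1 : (∑ i, KLRAlgebra.gen p ν' m (.e i)) = 1 := KLRAlgebra.eq_of_rel .sum_e
  refine Eq.trans ?_ (one_mul (f fun _ => false))
  rw [← h1]
  refine Finset.sum_induction _ (fun r => H.signRep (H.toCorner r).1 f (fun _ => false) =
    r * f fun _ => false) (fun a b ha hb => ?_) ?_ fun i _ => H.signRep_toCorner_e i f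
  · rw [map_add, add_mul, ← ha, ← hb]
    exact congrFun (congrArg (fun F : Module.End k _ => F f)
      (map_add H.signRep (H.toCorner a).1 (H.toCorner b).1)) _
  · rw [map_zero, zero_mul]
    exact congrFun (congrArg (fun F : Module.End k _ => F f) (map_zero H.signRep)) _

theorem signRep_seqIdem (f : (Fin m → Bool) → KLRAlgebra p ν' m) :
    H.signRep (seqIdem p q ν ν' m) f (fun _ => false) = f fun _ => false := by
  have h1 := H.signRep_toCorner_one f
  rw [map_one] at h1
  exact h1

/-- The all-positive pattern is fixed by permutations and straightening is the identity there, so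
each generator acts by left multiplication by itself. -/
theorem signRep_toCorner (r : KLRAlgebra p ν' m) (f : (Fin m → Bool) → KLRAlgebra p ν' m) :
    H.signRep (H.toCorner r).1 f (fun _ => false) = r * f fun _ => false := by
  have hr : r ∈ Algebra.adjoin k (Set.range (KLRAlgebra.gen p ν' m)) := by
    rw [KLRAlgebra.adjoin_range_gen]
    trivial
  induction hr using Algebra.adjoin_induction generalizing f with
  | mem r hr =>
    obtain ⟨g | ⟨a, h⟩ | i, rfl⟩ := hr
    · rw [toCorner_x, map_mul, signRep_x, end_mul_apply, repX, monomialEnd_apply, id,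
        signRep_seqIdem, xCoef, straighten_false, if_neg (by simp)]
    · have h1 : cross p q ν m (a + 1) h = VVAlgebra.gen p q ν m (.s a h) := rfl
      rw [toCorner_s, h1, map_mul, signRep_s, end_mul_apply, repS, monomialEnd_apply,
        show (fun _ : Fin m => false) ∘ adjSwap a h = fun _ => false from rfl,
        signRep_seqIdem, sCoef, if_pos rfl]
      simp only [straighten_false]
      have h2 : min a (a + 1) = a := by omega
      simp only [h2, h, dite_true]
    · exact H.signRep_toCorner_e i f
  | algebraMap c =>
    rw [Algebra.algebraMap_eq_smul_one, map_smul, smul_mul_assoc, one_mul,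
      ← H.signRep_toCorner_one f]
    exact congrFun (congrArg (fun F : Module.End k _ => F f)
      (map_smul H.signRep c (H.toCorner 1).1)) _
  | add a b _ _ ha hb =>
    rw [map_add, add_mul, ← ha, ← hb]
    exact congrFun (congrArg (fun F : Module.End k _ => F f)
      (map_add H.signRep (H.toCorner a).1 (H.toCorner b).1)) _
  | mul a b _ _ ha hb =>
    rw [map_mul, mul_assoc, ← hb, ← ha]
    exact congrFun (congrArg (fun F : Module.End k _ => F f)
      (map_mul H.signRep (H.toCorner a).1 (H.toCorner b).1)) _

/-- Applying `φ(r)` to the constant function `1` and evaluating at the all-positive pattern returns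
`r`. -/
theorem toCorner_injective : Function.Injective (H.toCorner (m := m)) := by
  intro r r' h
  have h1 := H.signRep_toCorner r fun _ => 1
  rw [h, signRep_toCorner, mul_one, mul_one] at h1
  exact h1.symm

end Admissible

end Faithful

end VV

theorem mainTheorem5 {k : Type u} [Field k] (hchar : ringChar k ≠ 2)
    (p q lam : kˣ) (hp : p ≠ 1) (hp' : p ≠ -1)
    (h1 : (1 : kˣ) ∉ VV.orbit p lam) (h1' : (-1 : kˣ) ∉ VV.orbit p lam)
    (hpI : p ∉ VV.orbit p lam) (hqI : q ∉ VV.orbit p lam)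
    (hdisj : Disjoint (VV.orbitPos p lam) (VV.orbitNeg p lam))
    (ν : kˣ →₀ ℕ) (hν : VV.IsThetaDimVector (VV.orbit p lam) ν)
    (m : ℕ) (hm : ν.degree = 2 * m)
    (ν' : kˣ →₀ ℕ) (hν' : ν' = VV.restrictTo (VV.orbitPos p lam) ν) :
    IsMoritaEquivalent k (VV.VVAlgebra p q ν m) (VV.KLRAlgebra p ν' m) ∧
    TwoSidedIdeal.span {VV.seqIdem p q ν ν' m} = ⊤ ∧
    ∃ φ : VV.KLRAlgebra p ν' m ≃ₐ[k] (VV.isIdempotentElem_seqIdem p q ν ν' m).Corner,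
      (∀ (i : VV.klrSeq ν' m) (j : VV.vvSeq ν m), i.1 = j.1 →
        (φ (VV.KLRAlgebra.gen p ν' m (.e i))).1 = VV.VVAlgebra.gen p q ν m (.e j)) ∧
      (∀ l : Fin m, (φ (VV.KLRAlgebra.gen p ν' m (.x l))).1 =
        VV.VVAlgebra.gen p q ν m (.x l) * VV.seqIdem p q ν ν' m) ∧
      (∀ (a : ℕ) (h : a + 1 < m), (φ (VV.KLRAlgebra.gen p ν' m (.s a h))).1 =
        VV.VVAlgebra.gen p q ν m (.s a h) * VV.seqIdem p q ν ν' m) ∧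
      ∃ E : MoritaEquivalence k (VV.VVAlgebra p q ν m) (VV.KLRAlgebra p ν' m),
        Nonempty (E.eqv.functor ≅
          VV.cornerFunctor.{u, u} (VV.isIdempotentElem_seqIdem p q ν ν' m) ⋙
            ModuleCat.restrictScalars (φ : VV.KLRAlgebra p ν' m →+*
              (VV.isIdempotentElem_seqIdem p q ν ν' m).Corner)) := by
  have H : VV.Admissible p q lam ν ν' := ⟨hdisj, hqI, hν, hν'⟩
  let φ := AlgEquiv.ofBijective (H.toCorner (m := m)) ⟨H.toCorner_injective, H.toCorner_surjective⟩
  obtain ⟨E, hE⟩ := VV.exists_moritaEquivalence (VV.isIdempotentElem_seqIdem p q ν ν' m)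
    H.span_seqIdem φ
  refine ⟨⟨⟨E⟩⟩, H.span_seqIdem, φ, fun i j hij => ?_, H.toCorner_x, H.toCorner_s, E, hE⟩
  refine (H.toCorner_e i).trans ?_
  rw [hij, VV.VVAlgebra.seqE_of_mem j.2]
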